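/- Let $\alpha,T>0$. For $x\in\mathbb R^2$ write $x^\perp=(-x_2,x_1)$ and $$K^\alpha(x)=\frac{x^\perp}{|x|}\,D\Psi^\alpha(|x|),\qquad D\Psi^\alpha(r)=\frac1{2\pi}\Big[-\frac1\alpha K_1\Big(\frac r\alpha\Big)+\frac1r\Big],\qquad K^\alpha(0)=0,$$ where $K_1$ is the modified Bessel function of the second kind of order one. Let $\mathcal M(\mathbb R^2)$ be the space of finite signed Radon measures on $\mathbb R^2$. A weak solution on $[0,T]$ of the Euler-$\alpha$ equations $\partial_t q+(u\cdot\nabla)q=0$, $u=K^\alpha*q$, with initial vorticity $q^{in}\in\mathcal M(\mathbb R^2)$ is a weak-$*$ continuous map $q:[0,T]\to\mathcal M(\mathbb R^2)=C_0(\mathbb R^2)^*$ with $q(0)=q^{in}$ such that, for all $\psi\in C_c^\infty(\mathbb R^2\times(0,T))$, $$\int_0^T\!\!\int\partial_t\psi(x,t)\,dq(x,t)\,dt+\int_0^T\!\!\iint\frac12 K^\alpha(x-y)\cdot\big(\nabla\psi(x,t)-\nabla\psi(y,t)\big)\,dq(x,t)\,dq(y,t)\,dt=0 .$$ Let $I=\{\sigma\in\mathbb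 R:\sigma_0\le\sigma\le\sigma_1\}$ with $-\infty\le\sigma_0<\sigma_1\le\infty$. We say that $\mu\in\mathcal M(\mathbb R^2)$ is carried by a continuous curve $x:I\to\mathbb R^2$, whose derivative $x_\sigma$ exists a.e., with density $\gamma\in L^1(|x_\sigma|\,d\sigma)$ if $\int\varphi\,d\mu=\int_I\varphi(x(\sigma))\,\gamma(\sigma)|x_\sigma(\sigma)|\,d\sigma$ for all $\varphi\in C_c^\infty(\mathbb R^2)$ (and similarly for other parameter intervals). **Proposition.** Let $q^{in}$ be carried by the curve $x^{in}:I\to\mathbb R^2$ with density $\gamma^{in}\in L^1(|x^{in}_\sigma|\,d\sigma)$, and let $q$ be a weak solution of the Euler-$\alpha$ equations on $[0,T]$ with initial vorticity $q^{in}$. 1. There is a unique Lagrangian flow map $\eta$ on $[0,T]$, i.e. $\partial_t\eta(x,t)=u(\eta(x,t),t)$ with $u=K^\alpha*q$, and $\eta(x,0)=x$. Each $\eta(\cdot,t)$ is a homeomorphism of $\mathbb R^2$, and $q$ is transported by it: $q(\cdot,t)=q^{in}\circ\eta(\cdot,t)^{-1}$. Hence, with $x(\sigma,t)=\eta(x^{in}(\sigma),t)$,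 the measure $q(\cdot,t)$ vanishes on every Borel set disjoint from the curve $\Sigma(t)=\{x(\sigma,t):\sigma\in I\}$, for every $t\in[0,T]$. 2. Call the curve nice at time $t$ if $x_\sigma(\sigma,t)$ exists for a.e. $\sigma\in I$ and is nonzero for a.e. $\sigma\in I$ with $\gamma^{in}(\sigma)|x^{in}_\sigma(\sigma)|\ne0$. There is a function $\gamma(\sigma,t)$ with $\gamma(\cdot,0)=\gamma^{in}$ such that, at every $t\in[0,T]$ at which the curve is nice, $q(\cdot,t)$ is carried by $x(\cdot,t)$ with density $\gamma(\cdot,t)\in L^1(|x_\sigma(\cdot,t)|\,d\sigma)$, $$\gamma(\sigma,t)|x_\sigma(\sigma,t)|\,d\sigma=\gamma^{in}(\sigma)|x^{in}_\sigma(\sigma)|\,d\sigma ,$$ and, for every $\sigma\in I$, $$\partial_t x(\sigma,t)=\int_{\sigma_0}^{\sigma_1}K^\alpha\big(x(\sigma,t)-x(\sigma',t)\big)\,\gamma(\sigma',t)\,|x_\sigma(\sigma',t)|\,d\sigma'$$ with an absolutely convergent integral. 3. Let $0<\tau\le T$, suppose that the curve is nice at every $t\in[0,\tau]$, fix a reference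 parameter $\sigma^*\in I$, and suppose that $\Gamma(\sigma,t)=\int_{\sigma^*}^{\sigma}\gamma(\sigma',t)|x_\sigma(\sigma',t)|\,d\sigma'$ is strictly increasing in $\sigma\in I$ for every $t\in[0,\tau]$. Then there are $-\infty<\Gamma_0<\Gamma_1<\infty$, independent of $t$, with $(\Gamma_0,\Gamma_1)\subset\Gamma(I,t)\subset[\Gamma_0,\Gamma_1]$, and the curve parametrized by its circulation, $x(\Gamma(\sigma,t),t)=x(\sigma,t)$, satisfies the Birkhoff–Rott-$\alpha$ equation $$\partial_t x(\Gamma,t)=\int_{\Gamma_0}^{\Gamma_1}K^\alpha\big(x(\Gamma,t)-x(\Gamma',t)\big)\,d\Gamma'\qquad(t\in[0,\tau],\ \Gamma\in\Gamma(I,t)).$$ Moreover $\gamma=1/|x_\Gamma|$ is the vorticity density along the curve: for every $t\in[0,\tau]$ and a.e. $\Gamma\in(\Gamma_0,\Gamma_1)$ the derivative $x_\Gamma(\Gamma,t)$ exists and is nonzero, and $\gamma(\sigma,t)=1/|x_\Gamma(\Gamma,t)|$ for $\Gamma=\Gamma(\sigma,t)$; and $q(\cdot,t)$ is carried by the curve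 $x(\cdot,t):(\Gamma_0,\Gamma_1)\to\mathbb R^2$ with density $1/|x_\Gamma(\cdot,t)|$. (Time derivatives at the end points of a time interval are one-sided.) -/

import Mathlib

open Set Filter Topology MeasureTheory
open scoped ContDiff

noncomputable section

namespace EulerAlpha

/-- The plane `ℝ²` with its Euclidean norm and inner product. -/
abbrev Plane : Type := EuclideanSpace ℝ (Fin 2)

/-- The rotation by a right angle `x^⊥ = (-x₂, x₁)`. -/
def perp (x : Plane) : Plane := !₂[-(x 1), x 0]

/-- The modified Bessel function of the second kind of order `ν`, for positive argument:
`K_ν(r) = ∫_0^∞ exp (-r cosh s) cosh (ν s) ds`. Only its values at `r > 0` matter. -/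
def besselK (ν r : ℝ) : ℝ :=
  ∫ s in Ioi (0 : ℝ), Real.exp (-r * Real.cosh s) * Real.cosh (ν * s)

/-- The radial derivative `DΨ^α(r) = (1 / 2π) (-(1 / α) K₁(r / α) + 1 / r)` of the stream function
`Ψ^α(r) = (1 / 2π) (K₀(r / α) + log r)`, for `r > 0`. -/
def DPsi (α r : ℝ) : ℝ :=
  1 / (2 * Real.pi) * (-(1 / α) * besselK 1 (r / α) + 1 / r)

/-- The smoothed Biot-Savart kernel `K^α(x) = (x^⊥ / |x|) DΨ^α(|x|)`. Its value at the origin is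
`0`, which is its continuous extension. -/
def kernelAlpha (α : ℝ) (x : Plane) : Plane := (DPsi α ‖x‖ / ‖x‖) • perp x

/-- The filtered velocity `u = K^α ∗ μ` generated by the vorticity `μ`. -/
def velocity (α : ℝ) (μ : SignedMeasure Plane) (x : Plane) : Plane :=
  ∫ᵛ y, kernelAlpha α (x - y) ∂<•μ

/-- The symmetrized kernel
`H^α_ψ(x,y,t) = (1/2) DΨ^α(|x-y|) (x-y)^⊥ ⋅ (∇ψ(x,t) - ∇ψ(y,t)) / |x-y|`. -/
def weakKernel (α : ℝ) (ψ : Plane × ℝ → ℝ) (x y : Plane) (t : ℝ) : ℝ :=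
  1 / 2 * (DPsi α ‖x - y‖ *
    (inner ℝ (perp (x - y))
      (gradient (fun z => ψ (z, t)) x - gradient (fun z => ψ (z, t)) y) / ‖x - y‖))

/-- `q` is a weak solution on `[0,T]` of the vorticity form of the Euler-α equations with initial
vorticity `qin`. Finite signed Borel measures on the plane are the finite Radon measures, and
`q ∈ C([0,T]; M(ℝ²))` refers to the weak-* topology of `M(ℝ²) = C₀(ℝ²)*`. -/
structure IsWeakSolution (α T : ℝ) (qin : SignedMeasure Plane)
    (q : ℝ → SignedMeasure Plane) : Prop where
  continuousOn : ∀ φ : ZeroAtInftyContinuousMap Plane ℝ,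
    ContinuousOn (fun t => ∫ᵛ x, φ x ∂<•(q t)) (Icc 0 T)
  initial : q 0 = qin
  weak : ∀ ψ : Plane × ℝ → ℝ, ContDiff ℝ ∞ ψ → HasCompactSupport ψ →
    tsupport ψ ⊆ univ ×ˢ Ioo 0 T →
    (∫ t in (0 : ℝ)..T, ∫ᵛ x, deriv (fun s => ψ (x, s)) t ∂<•(q t)) +
      (∫ t in (0 : ℝ)..T, ∫ᵛ y, (∫ᵛ x, weakKernel α ψ x y t ∂<•(q t)) ∂<•(q t)) = 0

/-- `η` is the Lagrangian flow map on `[0,T]` of the velocity generated by `q`: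
`∂_t η(x,t) = u(η(x,t),t)`, `u = K^α ∗ q`, and `η(x,0) = x`. -/
structure IsLagrangianFlow (α T : ℝ) (q : ℝ → SignedMeasure Plane)
    (η : ℝ → Plane → Plane) : Prop where
  initial : ∀ x, η 0 x = x
  hasDerivWithinAt : ∀ x, ∀ t ∈ Icc 0 T,
    HasDerivWithinAt (fun s => η s x) (velocity α (q t) (η t x)) (Icc 0 T) t

/-- The parameter interval `σ₀ ≤ σ ≤ σ₁`; the endpoints may be infinite. -/
def paramInterval (σ₀ σ₁ : EReal) : Set ℝ := {σ | σ₀ ≤ (σ : EReal) ∧ (σ : EReal) ≤ σ₁}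

/-- The measure `|x_σ| dσ` on the parameter interval `I` of the curve `x`. -/
def arcMeasure (I : Set ℝ) (x : ℝ → Plane) : Measure ℝ :=
  (volume.restrict I).withDensity fun σ => ‖deriv x σ‖ₑ

/-- The measure `μ` is carried by the curve `x : I → ℝ²`, whose tangent `x_σ` exists a.e., with a
density `γ ∈ L¹(|x_σ| dσ)`: `∫ φ dμ = ∫_I φ(x(σ)) γ(σ) |x_σ(σ)| dσ` for test functions `φ`. -/
structure HasSheetDensity (I : Set ℝ) (x : ℝ → Plane) (γ : ℝ → ℝ)
    (μ : SignedMeasure Plane) : Prop where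
  continuousOn : ContinuousOn x I
  differentiableAt : ∀ᵐ σ ∂(volume.restrict I), DifferentiableAt ℝ x σ
  integrable : Integrable γ (arcMeasure I x)
  integral_eq : ∀ φ : Plane → ℝ, ContDiff ℝ ∞ φ → HasCompactSupport φ →
    ∫ᵛ z, φ z ∂<•μ = ∫ σ in I, φ (x σ) * (γ σ * ‖deriv x σ‖)

/-- The curve `x` is still nice: its tangent `x_σ` exists a.e., and it does not vanish (a.e.) where
the initial sheet, the curve `xin` with density `γin`, carries vorticity. -/
def IsNice (I : Set ℝ) (xin : ℝ → Plane) (γin : ℝ → ℝ) (x : ℝ → Plane) : Prop :=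
  (∀ᵐ σ ∂(volume.restrict I), DifferentiableAt ℝ x σ) ∧
    ∀ᵐ σ ∂(volume.restrict I), γin σ * ‖deriv xin σ‖ ≠ 0 → deriv x σ ≠ 0

/-- The circulation `Γ(σ) = ∫_{σ*}^σ γ |x_σ| dσ'` along the curve `x` with density `γ`. -/
def circulation (x : ℝ → Plane) (γ : ℝ → ℝ) (σstar σ : ℝ) : ℝ :=
  ∫ σ' in σstar..σ, γ σ' * ‖deriv x σ'‖

/-- The curve `x(σ,t) = η(x^in(σ),t)` at time `t`, as a function of `σ`. -/
def evolvedCurve (η : ℝ → Plane ≃ₜ Plane) (xin : ℝ → Plane) (t σ : ℝ) : Plane :=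
  η t (xin σ)

end EulerAlpha

end

open EulerAlpha

/-! Everything rests on the modulus of continuity of `K^α`. The substitution w = r sinh s gives r
K₁(r) = ∫₀^∞ exp(-√(r² + w²)) dw, so that for α = 1 the kernel is, up to the factor 1/(2π), H(|x|)
x^⊥ with H(r) = (1 - r K₁(r)) / r². Here H decreases, r² H(r) increases, and H is at most
logarithmic at 0; hence `K^α` is bounded, vanishes at infinity and is log-Lipschitz
(`exists_logLipschitz_kernelAlpha`). A weak-* continuous family of measures has bounded mass on
[0,T] (`exists_mass_le`), so u = K^α ∗ q inherits these bounds uniformly in time.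

The modulus is used scale by scale: at scale ε the field behaves like a Lipschitz field with
constant L of order C (1 - log ε), up to an error of order C ε (1 - log ε). Over a time Δ, Gronwall
costs a factor exp(L Δ), a power of e/ε which is at most (e/ε)^(1/2) when Δ is short; the error
still wins as ε → 0 (`tendsto_log_exp_modulus`). Short times are then concatenated. This yields
stability of approximate solutions (`exists_stability`), hence existence, uniqueness and a flow of
homeomorphisms (`exists_flow`).

The same balance shows that q is transported by the flow. Testing with φ(x) χ(t) and using that
`K^α` is odd, t ↦ ∫ φ dq has derivative ∫ u ⋅ ∇φ dq. The transported test function φ ∘ η is not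
smooth, so the flow is replaced by explicit Euler steps of size h for a mollified field
(`euler_iterate`). The gradient of the test function grows by exp(L Δ) and multiplies the
mollification error; its second derivative depends badly on ε but multiplies only h². Letting h → 0
and afterwards ε → 0 gives q(t) = q^in ∘ η⁻¹ (`TransportSetting.eq_map`).

Consequently q(t) is the image of the fixed measure g dσ, g = γ^in |x^in_σ|, under x(·,t), and the
density must be γ = g / |x_σ|. The circulation is the primitive of g, the same at all times; its
inverse pushes Lebesgue measure to g dσ (`map_cumulInv`) and has derivative 1/g almost everywhere,
whence |x_Γ| = |x_σ| / g = 1/γ. -/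

namespace EulerAlpha

/-! ### The Bessel function K₁: integral representation and bounds on 1 - r K₁(r). -/

section Kernel

/-- The integrand of `1 - r K₁(r) = ∫₀^∞ (exp (-w) - exp (-√(r² + w²))) dw`, with `ρ = r²`. -/
noncomputable def defectIntegrand (ρ w : ℝ) : ℝ := Real.exp (-w) - Real.exp (-√(ρ + w ^ 2))

/-- `1 - r K₁(r)` as a function of `ρ = r²`. -/
noncomputable def besselDefect (ρ : ℝ) : ℝ := ∫ w in Ioi (0 : ℝ), defectIntegrand ρ w

lemma le_sqrt_add_sq {ρ w : ℝ} (hρ : 0 ≤ ρ) : w ≤ √(ρ + w ^ 2) :=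
  Real.le_sqrt_of_sq_le (by linarith)

lemma defectIntegrand_nonneg {ρ : ℝ} (hρ : 0 ≤ ρ) (w : ℝ) : 0 ≤ defectIntegrand ρ w :=
  sub_nonneg.2 (Real.exp_le_exp.2 (neg_le_neg (le_sqrt_add_sq hρ)))

/-- This is 1 - exp(-x) ≤ x for x = √(ρ + w²) - w. Of the two bounds on x used below, x ≤ r is
effective for w below r, and x ≤ r²/(2w) for w above r. -/
lemma defectIntegrand_le_mul (ρ w : ℝ) :
    defectIntegrand ρ w ≤ Real.exp (-w) * (√(ρ + w ^ 2) - w) := by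
  have h : Real.exp (-√(ρ + w ^ 2)) = Real.exp (-w) * Real.exp (-(√(ρ + w ^ 2) - w)) := by
    rw [← Real.exp_add]; congr 1; ring
  have h2 := Real.add_one_le_exp (-(√(ρ + w ^ 2) - w))
  have h3 := Real.exp_pos (-w)
  unfold defectIntegrand
  rw [h]
  nlinarith

lemma defectIntegrand_le_mul_left {r w : ℝ} (hr : 0 ≤ r) (hw : 0 ≤ w) :
    defectIntegrand (r ^ 2) w ≤ Real.exp (-w) * r := by
  refine (defectIntegrand_le_mul _ _).trans ?_
  have : √(r ^ 2 + w ^ 2) ≤ r + w := Real.sqrt_le_iff.2 ⟨by positivity, by nlinarith⟩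
  gcongr
  linarith

lemma defectIntegrand_le_div {r w : ℝ} (hw : 0 < w) :
    defectIntegrand (r ^ 2) w ≤ r ^ 2 / 2 * (Real.exp (-w) * w⁻¹) := by
  refine (defectIntegrand_le_mul _ _).trans ?_
  have : √(r ^ 2 + w ^ 2) ≤ w + r ^ 2 / (2 * w) := by
    refine Real.sqrt_le_iff.2 ⟨by positivity, ?_⟩
    have : (w + r ^ 2 / (2 * w)) ^ 2 = w ^ 2 + r ^ 2 + (r ^ 2 / (2 * w)) ^ 2 := by
      field_simp; ring
    rw [this]; nlinarith [sq_nonneg (r ^ 2 / (2 * w))]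
  calc Real.exp (-w) * (√(r ^ 2 + w ^ 2) - w) ≤ Real.exp (-w) * (r ^ 2 / (2 * w)) := by
        gcongr; linarith
    _ = _ := by field_simp

lemma defectIntegrand_mono {ρ₁ ρ₂ : ℝ} (h : ρ₁ ≤ ρ₂) (w : ℝ) :
    defectIntegrand ρ₁ w ≤ defectIntegrand ρ₂ w := by
  unfold defectIntegrand
  gcongr

/-- √(ρ + w²) is concave in ρ and at least w at ρ = 0, while exp(-·) is decreasing and convex. The
resulting decrease of the defect divided by ρ makes `kernelProfile` monotone without differentiating
a Bessel function. -/
lemma defectIntegrand_concave {ρ₁ ρ₂ w : ℝ} (h₁ : 0 < ρ₁) (h : ρ₁ ≤ ρ₂) :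
    ρ₁ * defectIntegrand ρ₂ w ≤ ρ₂ * defectIntegrand ρ₁ w := by
  have h₂ : 0 < ρ₂ := h₁.trans_le h
  set θ := ρ₁ / ρ₂ with hθ
  have hθ0 : 0 ≤ θ := by positivity
  have hθ1 : θ ≤ 1 := (div_le_one h₂).2 h
  have e1 : ρ₁ = θ * ρ₂ := by rw [hθ]; field_simp
  have hs : 0 ≤ √(ρ₂ + w ^ 2) := Real.sqrt_nonneg _
  have hsq : √(ρ₂ + w ^ 2) ^ 2 = ρ₂ + w ^ 2 := Real.sq_sqrt (by positivity)
  have key : (1 - θ) * w + θ * √(ρ₂ + w ^ 2) ≤ √(ρ₁ + w ^ 2) := by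
    apply Real.le_sqrt_of_sq_le
    nlinarith [mul_nonneg (mul_nonneg hθ0 (sub_nonneg.2 hθ1)) (sq_nonneg (w - √(ρ₂ + w ^ 2)))]
  have cv := convexOn_exp.2 (mem_univ (-w)) (mem_univ (-√(ρ₂ + w ^ 2))) (sub_nonneg.2 hθ1) hθ0
    (by ring)
  simp only [smul_eq_mul] at cv
  have : Real.exp (-√(ρ₁ + w ^ 2)) ≤ (1 - θ) * Real.exp (-w) + θ * Real.exp (-√(ρ₂ + w ^ 2)) :=
    (Real.exp_le_exp.2 (by linarith)).trans cv
  unfold defectIntegrand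
  have h4 : θ * (Real.exp (-w) - Real.exp (-√(ρ₂ + w ^ 2))) ≤
    Real.exp (-w) - Real.exp (-√(ρ₁ + w ^ 2)) := by linarith
  calc ρ₁ * (Real.exp (-w) - Real.exp (-√(ρ₂ + w ^ 2)))
      = ρ₂ * (θ * (Real.exp (-w) - Real.exp (-√(ρ₂ + w ^ 2)))) := by rw [e1]; ring
    _ ≤ _ := by gcongr

lemma integrableOn_exp_neg_sqrt {ρ : ℝ} (hρ : 0 ≤ ρ) :
    IntegrableOn (fun w => Real.exp (-√(ρ + w ^ 2))) (Ioi 0) := by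
  refine (integrableOn_exp_neg_Ioi 0).mono' (by fun_prop) ?_
  filter_upwards with w
  rw [Real.norm_of_nonneg (Real.exp_pos _).le]
  exact Real.exp_le_exp.2 (neg_le_neg (le_sqrt_add_sq hρ))

lemma integrableOn_defectIntegrand {ρ : ℝ} (hρ : 0 ≤ ρ) :
    IntegrableOn (defectIntegrand ρ) (Ioi 0) :=
  (integrableOn_exp_neg_Ioi 0).sub (integrableOn_exp_neg_sqrt hρ)

lemma besselDefect_eq {ρ : ℝ} (hρ : 0 ≤ ρ) :
    besselDefect ρ = 1 - ∫ w in Ioi (0 : ℝ), Real.exp (-√(ρ + w ^ 2)) := by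
  unfold besselDefect defectIntegrand
  rw [integral_sub (integrableOn_exp_neg_Ioi 0) (integrableOn_exp_neg_sqrt hρ)]
  rw [integral_exp_neg_Ioi_zero]

/-- Substitution w = r sinh s, for which r² + w² = (r cosh s)² and dw = r cosh s ds. -/
lemma mul_besselK_one {r : ℝ} (hr : 0 < r) :
    r * besselK 1 r = ∫ w in Ioi (0 : ℝ), Real.exp (-√(r ^ 2 + w ^ 2)) := by
  have himg : (fun s => r * Real.sinh s) '' Ioi 0 = Ioi 0 := by
    ext w
    constructor
    · rintro ⟨s, hs, rfl⟩
      exact mul_pos hr (Real.sinh_pos_iff.2 hs)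
    · intro hw
      refine ⟨Real.arsinh (w / r), Real.arsinh_pos_iff.2 (div_pos hw hr), ?_⟩
      simp only [Real.sinh_arsinh]; field_simp
  have := integral_image_eq_integral_abs_deriv_smul (s := Ioi (0 : ℝ))
    (f := fun s => r * Real.sinh s) (f' := fun s => r * Real.cosh s) measurableSet_Ioi
    (fun s _ => ((Real.hasDerivAt_sinh s).const_mul r).hasDerivWithinAt)
    (fun a _ b _ h => Real.sinh_injective (mul_left_cancel₀ hr.ne' h))
    (fun w => Real.exp (-√(r ^ 2 + w ^ 2)))
  rw [himg] at this
  rw [this, besselK, ← integral_const_mul]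
  refine integral_congr_ae (Eventually.of_forall fun s => ?_)
  have h1 : r ^ 2 + (r * Real.sinh s) ^ 2 = (r * Real.cosh s) ^ 2 := by
    rw [mul_pow, mul_pow, Real.cosh_sq]; ring
  have h2 : 0 ≤ r * Real.cosh s := mul_nonneg hr.le (Real.cosh_pos s).le
  simp only [h1, Real.sqrt_sq h2, abs_of_nonneg h2, smul_eq_mul, one_mul]
  rw [neg_mul]; ring

lemma besselDefect_nonneg {ρ : ℝ} (hρ : 0 ≤ ρ) : 0 ≤ besselDefect ρ :=
  setIntegral_nonneg measurableSet_Ioi fun w _ => defectIntegrand_nonneg hρ w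

lemma besselDefect_le_one {ρ : ℝ} (hρ : 0 ≤ ρ) : besselDefect ρ ≤ 1 := by
  rw [besselDefect_eq hρ]
  have : 0 ≤ ∫ w in Ioi (0 : ℝ), Real.exp (-√(ρ + w ^ 2)) :=
    integral_nonneg fun _ => (Real.exp_pos _).le
  linarith

lemma besselDefect_sq_le {r : ℝ} (hr : 0 ≤ r) : besselDefect (r ^ 2) ≤ r := by
  calc besselDefect (r ^ 2) ≤ ∫ w in Ioi (0 : ℝ), Real.exp (-w) * r :=
        setIntegral_mono_on (integrableOn_defectIntegrand (sq_nonneg r))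
          ((integrableOn_exp_neg_Ioi 0).mul_const r) measurableSet_Ioi
          fun w hw => defectIntegrand_le_mul_left hr (le_of_lt hw)
    _ = r := by rw [integral_mul_const, integral_exp_neg_Ioi_zero, one_mul]

lemma besselDefect_mono {ρ₁ ρ₂ : ℝ} (h₁ : 0 ≤ ρ₁) (h : ρ₁ ≤ ρ₂) :
    besselDefect ρ₁ ≤ besselDefect ρ₂ :=
  setIntegral_mono (integrableOn_defectIntegrand h₁) (integrableOn_defectIntegrand (h₁.trans h))
    fun w => defectIntegrand_mono h w

lemma besselDefect_concave {ρ₁ ρ₂ : ℝ} (h₁ : 0 < ρ₁) (h : ρ₁ ≤ ρ₂) :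
    ρ₁ * besselDefect ρ₂ ≤ ρ₂ * besselDefect ρ₁ := by
  unfold besselDefect
  rw [← integral_const_mul, ← integral_const_mul]
  exact setIntegral_mono_on ((integrableOn_defectIntegrand (h₁.le.trans h)).const_mul _)
    ((integrableOn_defectIntegrand h₁.le).const_mul _) measurableSet_Ioi
    fun w _ => defectIntegrand_concave h₁ h

/-- The integral is split at w = r and w = 1. The integrand is at most r on (0,r), which contributes
r²; it is at most r²/(2w) on (r,1), which produces the logarithm; beyond 1 the factor exp(-w) leaves
at most r²/2. -/
lemma besselDefect_sq_le_log {r : ℝ} (hr : 0 < r) (hr1 : r ≤ 1) :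
    besselDefect (r ^ 2) ≤ 2 * r ^ 2 * (1 - Real.log r) := by
  have hint := integrableOn_defectIntegrand (sq_nonneg r)
  have hI1 : ∫ w in (0 : ℝ)..r, defectIntegrand (r ^ 2) w ≤ r * r := by
    have hc : IntervalIntegrable (fun _ : ℝ => r) volume 0 r := intervalIntegrable_const
    have hi : IntervalIntegrable (defectIntegrand (r ^ 2)) volume 0 r :=
      (intervalIntegrable_iff_integrableOn_Ioc_of_le hr.le).2
        (hint.mono_set fun w hw => hw.1)
    calc ∫ w in (0 : ℝ)..r, defectIntegrand (r ^ 2) w ≤ ∫ _ in (0 : ℝ)..r, r :=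
          intervalIntegral.integral_mono_on hr.le hi hc fun w hw => by
            refine (defectIntegrand_le_mul_left hr.le hw.1).trans ?_
            have : Real.exp (-w) ≤ 1 := Real.exp_le_one_iff.2 (by linarith [hw.1])
            nlinarith
      _ = r * r := by simp
  have hI2 : ∫ w in r..1, defectIntegrand (r ^ 2) w ≤ r ^ 2 / 2 * (-Real.log r) := by
    have hi : IntervalIntegrable (defectIntegrand (r ^ 2)) volume r 1 :=
      (intervalIntegrable_iff_integrableOn_Ioc_of_le hr1).2
        (hint.mono_set fun w hw => hr.trans hw.1)
    have h0 : (0 : ℝ) ∉ uIcc r 1 := by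
      rw [uIcc_of_le hr1]; exact fun h => absurd h.1 (not_le.2 hr)
    have hc : IntervalIntegrable (fun w : ℝ => r ^ 2 / 2 * w⁻¹) volume r 1 :=
      (intervalIntegral.intervalIntegrable_inv (fun x hx => by
        rintro rfl; exact h0 hx) continuousOn_id).const_mul _
    calc ∫ w in r..1, defectIntegrand (r ^ 2) w ≤ ∫ w in r..1, r ^ 2 / 2 * w⁻¹ :=
          intervalIntegral.integral_mono_on hr1 hi hc fun w hw => by
            have hw0 : 0 < w := hr.trans_le hw.1
            refine (defectIntegrand_le_div hw0).trans ?_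
            have : Real.exp (-w) ≤ 1 := Real.exp_le_one_iff.2 (by linarith)
            have := inv_pos.2 hw0
            gcongr
            nlinarith
      _ = r ^ 2 / 2 * (-Real.log r) := by
          rw [intervalIntegral.integral_const_mul, integral_inv h0]
          simp
  have hI3 : ∫ w in Ioi (1 : ℝ), defectIntegrand (r ^ 2) w ≤ r ^ 2 / 2 := by
    calc ∫ w in Ioi (1 : ℝ), defectIntegrand (r ^ 2) w
        ≤ ∫ w in Ioi (1 : ℝ), r ^ 2 / 2 * Real.exp (-w) :=
          setIntegral_mono_on (hint.mono_set (Ioi_subset_Ioi zero_le_one))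
            ((integrableOn_exp_neg_Ioi 1).const_mul _) measurableSet_Ioi fun w hw => by
              have hw0 : 0 < w := zero_lt_one.trans hw
              refine (defectIntegrand_le_div hw0).trans ?_
              have h1 : w⁻¹ ≤ 1 := inv_le_one_of_one_le₀ (le_of_lt hw)
              have := Real.exp_pos (-w)
              gcongr
              nlinarith
      _ = r ^ 2 / 2 * Real.exp (-1) := by rw [integral_const_mul, integral_exp_neg_Ioi]
      _ ≤ r ^ 2 / 2 * 1 := by gcongr; exact Real.exp_le_one_iff.2 (by norm_num)
      _ = _ := mul_one _
  have split : besselDefect (r ^ 2) = (∫ w in (0 : ℝ)..r, defectIntegrand (r ^ 2) w) +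
      (∫ w in r..1, defectIntegrand (r ^ 2) w) + ∫ w in Ioi (1 : ℝ), defectIntegrand (r ^ 2) w := by
    unfold besselDefect
    rw [← intervalIntegral.integral_Ioi_sub_Ioi hint hr.le,
      ← intervalIntegral.integral_Ioi_sub_Ioi (hint.mono_set (Ioi_subset_Ioi hr.le)) hr1]
    ring
  have hl : 0 ≤ -Real.log r := neg_nonneg.2 (Real.log_nonpos hr.le hr1)
  rw [split]
  nlinarith [mul_nonneg (sq_nonneg r) hl]

end Kernel


/-! ### The kernel is bounded, vanishes at infinity and is log-Lipschitz. -/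

section LogLipschitzKernel

lemma norm_perp (x : Plane) : ‖perp x‖ = ‖x‖ := by
  simp [EuclideanSpace.norm_eq, perp, Fin.sum_univ_two, add_comm]

@[simp]
lemma perp_zero : perp (0 : Plane) = 0 := by
  ext i; fin_cases i <;> simp [perp]

lemma perp_sub (x y : Plane) : perp (x - y) = perp x - perp y := by
  ext i; fin_cases i <;> simp [perp]; ring

lemma perp_smul (c : ℝ) (x : Plane) : perp (c • x) = c • perp x := by
  ext i; fin_cases i <;> simp [perp]

lemma perp_neg (x : Plane) : perp (-x) = -perp x := by
  ext i; fin_cases i <;> simp [perp]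

/-- The profile `(1 - r K₁(r)) / r²`. -/
noncomputable def kernelProfile (r : ℝ) : ℝ := besselDefect (r ^ 2) / r ^ 2

/-- The kernel `K^α` for `α = 1`, without the factor `1 / 2π`. -/
noncomputable def unitKernel (x : Plane) : Plane := kernelProfile ‖x‖ • perp x

/-- Scaling reduces every estimate to α = 1. At the origin both sides vanish because `perp 0 = 0`,
whatever value `DPsi` takes there. -/
lemma kernelAlpha_eq_unitKernel {α : ℝ} (hα : 0 < α) (x : Plane) :
    kernelAlpha α x = (1 / (2 * Real.pi * α)) • unitKernel (α⁻¹ • x) := by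
  rcases eq_or_ne x 0 with rfl | hx
  · simp [kernelAlpha, unitKernel]
  have hx0 : 0 < ‖x‖ := norm_pos_iff.2 hx
  have hr : 0 < ‖x‖ / α := div_pos hx0 hα
  have h1 := mul_besselK_one hr
  have h2 := besselDefect_eq (sq_nonneg (‖x‖ / α))
  rw [← h1] at h2
  have hn : ‖α⁻¹ • x‖ = ‖x‖ / α := by
    rw [norm_smul, norm_inv, Real.norm_of_nonneg hα.le]; field_simp
  unfold kernelAlpha unitKernel kernelProfile DPsi
  rw [hn, h2, perp_smul, smul_smul, smul_smul]
  congr 1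
  have := Real.pi_pos
  field_simp
  ring

lemma kernelProfile_nonneg (r : ℝ) : 0 ≤ kernelProfile r :=
  div_nonneg (besselDefect_nonneg (sq_nonneg r)) (sq_nonneg r)

lemma kernelProfile_anti {r s : ℝ} (hr : 0 < r) (h : r ≤ s) :
    kernelProfile s ≤ kernelProfile r := by
  have hs := hr.trans_le h
  unfold kernelProfile
  rw [div_le_div_iff₀ (by positivity) (by positivity)]
  have := besselDefect_concave (ρ₁ := r ^ 2) (ρ₂ := s ^ 2) (by positivity) (by gcongr)
  linarith

/-- Since r² H(r) increases for H = `kernelProfile`, H decays no faster than r⁻². This is the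
difference form of r |H'(r)| ≤ 2 H(r). -/
lemma mul_kernelProfile_sub_le {r s : ℝ} (hr : 0 < r) (h : r ≤ s) :
    r * (kernelProfile r - kernelProfile s) ≤ 2 * kernelProfile r * (s - r) := by
  have hs := hr.trans_le h
  have h1 : r ^ 2 * kernelProfile r ≤ s ^ 2 * kernelProfile s := by
    have := besselDefect_mono (ρ₁ := r ^ 2) (ρ₂ := s ^ 2) (by positivity) (by gcongr)
    unfold kernelProfile
    field_simp
    exact this
  have h0 := kernelProfile_nonneg r
  have h2 : s ^ 2 * (kernelProfile r - kernelProfile s) ≤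
      kernelProfile r * ((s - r) * (s + r)) := by nlinarith
  refine le_of_mul_le_mul_left (a := s ^ 2) ?_ (by positivity)
  calc s ^ 2 * (r * (kernelProfile r - kernelProfile s))
      = r * (s ^ 2 * (kernelProfile r - kernelProfile s)) := by ring
    _ ≤ r * (kernelProfile r * ((s - r) * (s + r))) := by gcongr
    _ = (kernelProfile r * (s - r)) * (r * (s + r)) := by ring
    _ ≤ (kernelProfile r * (s - r)) * (2 * s ^ 2) := by
        have : 0 ≤ kernelProfile r * (s - r) := mul_nonneg h0 (sub_nonneg.2 h)
        refine mul_le_mul_of_nonneg_left ?_ this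
        nlinarith
    _ = _ := by ring

lemma kernelProfile_le {r : ℝ} (hr : 0 < r) (hr1 : r ≤ 1) :
    kernelProfile r ≤ 2 * (1 - Real.log r) := by
  unfold kernelProfile
  rw [div_le_iff₀ (by positivity)]
  have := besselDefect_sq_le_log hr hr1
  linarith

lemma one_le_one_sub_log {ε : ℝ} (h0 : 0 < ε) (h1 : ε ≤ 1) : 1 ≤ 1 - Real.log ε := by
  linarith [Real.log_nonpos h0.le h1]

lemma mul_one_sub_log_mono {r ε : ℝ} (hr : 0 < r) (h : r ≤ ε) (h1 : ε ≤ 1) :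
    r * (1 - Real.log r) ≤ ε * (1 - Real.log ε) := by
  have hε := hr.trans_le h
  have h2 : Real.log (ε / r) ≤ ε / r - 1 := Real.log_le_sub_one_of_pos (by positivity)
  rw [Real.log_div hε.ne' hr.ne'] at h2
  have h3 : r * (Real.log ε - Real.log r) ≤ ε - r := by
    calc r * (Real.log ε - Real.log r) ≤ r * (ε / r - 1) := by gcongr
      _ = _ := by field_simp
  have h4 := Real.log_nonpos hε.le h1
  nlinarith

lemma norm_unitKernel (x : Plane) : ‖unitKernel x‖ = ‖x‖ * kernelProfile ‖x‖ := by
  rw [unitKernel, norm_smul, norm_perp, Real.norm_of_nonneg (kernelProfile_nonneg _), mul_comm]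

lemma norm_unitKernel_le_one (x : Plane) : ‖unitKernel x‖ ≤ 1 := by
  rw [norm_unitKernel]
  rcases eq_or_ne x 0 with rfl | hx
  · simp
  have hx0 : 0 < ‖x‖ := norm_pos_iff.2 hx
  unfold kernelProfile
  rw [mul_div_assoc', div_le_one (by positivity)]
  nlinarith [besselDefect_sq_le hx0.le]

lemma norm_unitKernel_mul_le_one (x : Plane) : ‖unitKernel x‖ * ‖x‖ ≤ 1 := by
  rw [norm_unitKernel]
  rcases eq_or_ne x 0 with rfl | hx
  · simp
  have hx0 : 0 < ‖x‖ := norm_pos_iff.2 hx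
  unfold kernelProfile
  calc ‖x‖ * (besselDefect (‖x‖ ^ 2) / ‖x‖ ^ 2) * ‖x‖ = besselDefect (‖x‖ ^ 2) := by field_simp
    _ ≤ 1 := besselDefect_le_one (sq_nonneg _)

lemma norm_unitKernel_le_of_norm_le {ε : ℝ} (h0 : 0 < ε) (h1 : ε ≤ 1) {x : Plane}
    (hx : ‖x‖ ≤ ε) : ‖unitKernel x‖ ≤ 2 * (1 - Real.log ε) * ε := by
  have hl := one_le_one_sub_log h0 h1
  rcases eq_or_ne x 0 with rfl | hx'
  · simp only [unitKernel, norm_zero]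
    simp only [perp_zero, smul_zero, norm_zero]
    have : 0 ≤ 1 - Real.log ε := by linarith
    positivity
  have hx0 : 0 < ‖x‖ := norm_pos_iff.2 hx'
  rw [norm_unitKernel]
  calc ‖x‖ * kernelProfile ‖x‖ ≤ ‖x‖ * (2 * (1 - Real.log ‖x‖)) := by
        gcongr; exact kernelProfile_le hx0 (hx.trans h1)
    _ = 2 * (‖x‖ * (1 - Real.log ‖x‖)) := by ring
    _ ≤ 2 * (ε * (1 - Real.log ε)) := by
        gcongr 2 * ?_
        exact mul_one_sub_log_mono hx0 hx h1
    _ = _ := by ring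

/-- If |y| ≥ ε, the difference is H(|x|) (x - y)^⊥ - (H(|y|) - H(|x|)) y^⊥, and the decay bound on H
gives 3 H(|y|) |x - y| with H(|y|) ≤ H(ε) ≤ 2 (1 - log ε). If |y| < ε, there is no need for
cancellation: |x| ≤ |x - y| + ε, and each kernel value is estimated separately. -/
lemma norm_unitKernel_sub_le_aux {ε : ℝ} (h0 : 0 < ε) (h1 : ε ≤ 1) {x y : Plane}
    (hxy : ‖y‖ ≤ ‖x‖) :
    ‖unitKernel x - unitKernel y‖ ≤ 6 * (1 - Real.log ε) * (‖x - y‖ + ε) := by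
  have hl := one_le_one_sub_log h0 h1
  have hlp : 0 ≤ 1 - Real.log ε := by linarith
  have hn := norm_nonneg (x - y)
  have htri : ‖x‖ - ‖y‖ ≤ ‖x - y‖ := norm_sub_norm_le x y
  rcases le_or_gt ε ‖y‖ with hy | hy
  · have hy0 := h0.trans_le hy
    have hHy : kernelProfile ‖y‖ ≤ 2 * (1 - Real.log ε) :=
      (kernelProfile_anti h0 hy).trans (kernelProfile_le h0 h1)
    have hHx : kernelProfile ‖x‖ ≤ kernelProfile ‖y‖ := kernelProfile_anti hy0 hxy
    have e : unitKernel x - unitKernel y = kernelProfile ‖x‖ • perp (x - y) -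
        (kernelProfile ‖y‖ - kernelProfile ‖x‖) • perp y := by
      simp only [unitKernel, perp_sub]; module
    calc ‖unitKernel x - unitKernel y‖
        ≤ kernelProfile ‖x‖ * ‖x - y‖ + (kernelProfile ‖y‖ - kernelProfile ‖x‖) * ‖y‖ := by
          rw [e]
          refine (norm_sub_le _ _).trans (le_of_eq ?_)
          rw [norm_smul, norm_smul, norm_perp, norm_perp,
            Real.norm_of_nonneg (kernelProfile_nonneg _), Real.norm_of_nonneg (sub_nonneg.2 hHx)]
      _ ≤ kernelProfile ‖y‖ * ‖x - y‖ + 2 * kernelProfile ‖y‖ * (‖x‖ - ‖y‖) := by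
          have := mul_kernelProfile_sub_le hy0 hxy
          refine add_le_add (mul_le_mul_of_nonneg_right hHx hn) ?_
          linarith
      _ ≤ kernelProfile ‖y‖ * ‖x - y‖ + 2 * kernelProfile ‖y‖ * ‖x - y‖ := by
          have := kernelProfile_nonneg ‖y‖
          gcongr
      _ = 3 * kernelProfile ‖y‖ * ‖x - y‖ := by ring
      _ ≤ 3 * (2 * (1 - Real.log ε)) * (‖x - y‖ + ε) := by
          gcongr
          linarith
      _ = _ := by ring
  · have hKy := norm_unitKernel_le_of_norm_le h0 h1 hy.le
    have hKx : ‖unitKernel x‖ ≤ 2 * (1 - Real.log ε) * (‖x - y‖ + ε) := by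
      rcases le_or_gt ‖x‖ ε with hx | hx
      · refine (norm_unitKernel_le_of_norm_le h0 h1 hx).trans ?_
        gcongr
        linarith
      · rw [norm_unitKernel]
        have : kernelProfile ‖x‖ ≤ 2 * (1 - Real.log ε) :=
          (kernelProfile_anti h0 hx.le).trans (kernelProfile_le h0 h1)
        have h3 := kernelProfile_nonneg ‖x‖
        calc ‖x‖ * kernelProfile ‖x‖ ≤ (‖x - y‖ + ε) * (2 * (1 - Real.log ε)) := by
              gcongr
              linarith
          _ = _ := by ring
    refine (norm_sub_le _ _).trans ?_
    nlinarith [mul_nonneg hlp hn, mul_nonneg hlp h0.le]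

lemma norm_unitKernel_sub_le {ε : ℝ} (h0 : 0 < ε) (h1 : ε ≤ 1) (x y : Plane) :
    ‖unitKernel x - unitKernel y‖ ≤ 6 * (1 - Real.log ε) * (‖x - y‖ + ε) := by
  rcases le_total ‖y‖ ‖x‖ with h | h
  · exact norm_unitKernel_sub_le_aux h0 h1 h
  · rw [norm_sub_rev, norm_sub_rev x y]
    exact norm_unitKernel_sub_le_aux h0 h1 h

/-- `f` has the modulus of continuity `r (1 + log (1 / r))` up to the constant `C`: the inequality
is required at every scale `ε`. -/
def LogLipschitz {E F : Type*} [NormedAddCommGroup E] [NormedAddCommGroup F] (C : ℝ)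
    (f : E → F) : Prop :=
  ∀ ε, 0 < ε → ε ≤ 1 → ∀ x y, ‖f x - f y‖ ≤ C * (1 - Real.log ε) * (‖x - y‖ + ε)

lemma tendsto_mul_one_sub_log :
    Tendsto (fun ε : ℝ => ε * (1 - Real.log ε)) (𝓝[>] 0) (𝓝 0) := by
  have h : Continuous fun ε : ℝ => ε * (1 - Real.log ε) := by
    simpa only [mul_sub, mul_one, id] using! continuous_id.sub Real.continuous_mul_log
  simpa using (h.tendsto 0).mono_left nhdsWithin_le_nhds

lemma LogLipschitz.uniformContinuous {E F : Type*} [NormedAddCommGroup E] [NormedAddCommGroup F]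
    {C : ℝ} {f : E → F} (hf : LogLipschitz C f) : UniformContinuous f := by
  rw [Metric.uniformContinuous_iff]
  intro e he
  have h := (tendsto_mul_one_sub_log.const_mul (2 * C)).eventually_lt_const
    (show 2 * C * 0 < e by simpa using he)
  obtain ⟨ε, h3, h0, h1⟩ := (h.and (Ioc_mem_nhdsGT zero_lt_one)).exists
  refine ⟨ε, h0, fun {x y} hxy => ?_⟩
  rw [dist_eq_norm] at hxy ⊢
  have hC : 0 ≤ C * (1 - Real.log ε) := by
    have := (norm_nonneg _).trans (hf ε h0 h1 x y)
    exact nonneg_of_mul_nonneg_left this (by positivity)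
  calc ‖f x - f y‖ ≤ C * (1 - Real.log ε) * (‖x - y‖ + ε) := hf ε h0 h1 x y
    _ ≤ C * (1 - Real.log ε) * (ε + ε) := by gcongr
    _ = 2 * C * (ε * (1 - Real.log ε)) := by ring
    _ < e := h3

lemma exists_logLipschitz_kernelAlpha {α : ℝ} (hα : 0 < α) :
    ∃ C : ℝ, 1 ≤ C ∧ LogLipschitz C (kernelAlpha α) ∧ ∀ x, ‖kernelAlpha α x‖ ≤ C := by
  have hp : (0 : ℝ) ≤ 1 / (2 * Real.pi * α) := by have := Real.pi_pos; positivity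
  set c := 1 / (2 * Real.pi * α)
  -- The three nonnegative summands serve, in this order, 1 ≤ C, the sup bound, and the modulus of
  -- continuity after rescaling by α⁻¹.
  refine ⟨1 + c + c * (6 * (α⁻¹ + 1)), ?_, fun ε h0 h1 x y => ?_, fun x => ?_⟩
  · have := inv_pos.2 hα
    nlinarith [mul_nonneg hp this.le]
  · have hl := one_le_one_sub_log h0 h1
    have hi := inv_pos.2 hα
    rw [kernelAlpha_eq_unitKernel hα, kernelAlpha_eq_unitKernel hα, ← smul_sub, norm_smul,
      Real.norm_of_nonneg hp]
    have h2 := norm_unitKernel_sub_le h0 h1 (α⁻¹ • x) (α⁻¹ • y)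
    rw [← smul_sub, norm_smul, norm_inv, Real.norm_of_nonneg hα.le] at h2
    calc c * ‖unitKernel (α⁻¹ • x) - unitKernel (α⁻¹ • y)‖
        ≤ c * (6 * (1 - Real.log ε) * (α⁻¹ * ‖x - y‖ + ε)) := by gcongr
      _ ≤ c * (6 * (1 - Real.log ε) * ((α⁻¹ + 1) * (‖x - y‖ + ε))) := by
          have := norm_nonneg (x - y)
          gcongr
          nlinarith [mul_nonneg hi.le h0.le]
      _ = (0 + 0 + c * (6 * (α⁻¹ + 1))) * (1 - Real.log ε) * (‖x - y‖ + ε) := by ring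
      _ ≤ _ := by gcongr; exact zero_le_one
  · rw [kernelAlpha_eq_unitKernel hα, norm_smul, Real.norm_of_nonneg hp]
    have h1 := norm_unitKernel_le_one (α⁻¹ • x)
    have := inv_pos.2 hα
    have : 0 ≤ c * (6 * (α⁻¹ + 1)) := by positivity
    nlinarith

lemma continuous_kernelAlpha {α : ℝ} (hα : 0 < α) : Continuous (kernelAlpha α) :=
  let ⟨_, _, h, _⟩ := exists_logLipschitz_kernelAlpha hα
  h.uniformContinuous.continuous

lemma kernelAlpha_neg (α : ℝ) (x : Plane) : kernelAlpha α (-x) = -kernelAlpha α x := by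
  simp [kernelAlpha, perp_neg]

/-- |x| |K^α(x)| is bounded. Decay puts the components of y ↦ K^α(x - y) in C₀, where weak-*
continuity of q applies to them. -/
lemma tendsto_kernelAlpha_cocompact {α : ℝ} (hα : 0 < α) :
    Tendsto (kernelAlpha α) (cocompact Plane) (𝓝 0) := by
  rw [tendsto_zero_iff_norm_tendsto_zero]
  have hlim : Tendsto (fun x : Plane => (1 / (2 * Real.pi * α)) * α * ‖x‖⁻¹)
      (cocompact Plane) (𝓝 0) := by
    simpa using (tendsto_norm_cocompact_atTop (E := Plane)).inv_tendsto_atTop.const_mul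
      ((1 / (2 * Real.pi * α)) * α)
  refine squeeze_zero' (Eventually.of_forall fun _ => norm_nonneg _) ?_ hlim
  filter_upwards [tendsto_norm_cocompact_atTop.eventually_gt_atTop 0] with x hx
  have hp : (0 : ℝ) ≤ 1 / (2 * Real.pi * α) := by have := Real.pi_pos; positivity
  rw [kernelAlpha_eq_unitKernel hα, norm_smul, Real.norm_of_nonneg hp,
    mul_assoc (1 / (2 * Real.pi * α))]
  refine mul_le_mul_of_nonneg_left ?_ hp
  have h := norm_unitKernel_mul_le_one (α⁻¹ • x)
  rw [norm_smul α⁻¹ x, norm_inv, Real.norm_of_nonneg hα.le] at h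
  rw [← div_eq_mul_inv, le_div_iff₀ hx]
  calc _ = α * (‖unitKernel (α⁻¹ • x)‖ * (α⁻¹ * ‖x‖)) := by field_simp
    _ ≤ α * 1 := by gcongr
    _ = α := mul_one _

end LogLipschitzKernel


/-! ### Signed measures: mass, Fubini, determination by test functions. -/

section SignedMeasure

variable {X : Type*} [MeasurableSpace X]

instance isFiniteMeasure_variation (μ : SignedMeasure X) : IsFiniteMeasure μ.variation := by
  rw [← SignedMeasure.totalVariation_eq_variation, SignedMeasure.totalVariation]
  infer_instance

/-- The total mass `|μ|(X)` of a signed measure. -/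
noncomputable def mass (μ : SignedMeasure X) : ℝ := μ.variation.real univ

lemma mass_nonneg (μ : SignedMeasure X) : 0 ≤ mass μ := measureReal_nonneg

lemma norm_lsmul_flip_le (G : Type*) [NormedAddCommGroup G] [NormedSpace ℝ G] :
    ‖(ContinuousLinearMap.lsmul ℝ ℝ : ℝ →L[ℝ] G →L[ℝ] G).flip‖ ≤ 1 := by
  rw [ContinuousLinearMap.opNorm_flip]
  exact ContinuousLinearMap.opNorm_lsmul_le

lemma norm_integral_le_mass {G : Type*} [NormedAddCommGroup G] [NormedSpace ℝ G]
    (μ : SignedMeasure X) {f : X → G} {C : ℝ} (hC : 0 ≤ C) (h : ∀ x, ‖f x‖ ≤ C) :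
    ‖∫ᵛ x, f x ∂<•μ‖ ≤ C * mass μ := by
  refine (VectorMeasure.norm_integral_le_of_norm_le_const (Eventually.of_forall h)).trans ?_
  have := norm_lsmul_flip_le G
  have h2 := mass_nonneg μ
  calc _ ≤ C * 1 * mass μ := by unfold mass at *; gcongr
    _ = _ := by ring

lemma variation_eq_add (μ : SignedMeasure X) :
    μ.variation = μ.toJordanDecomposition.posPart + μ.toJordanDecomposition.negPart := by
  rw [← SignedMeasure.totalVariation_eq_variation, SignedMeasure.totalVariation]

lemma integrable_posPart {G : Type*} [NormedAddCommGroup G] {μ : SignedMeasure X} {f : X → G}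
    (hf : Integrable f μ.variation) : Integrable f μ.toJordanDecomposition.posPart := by
  rw [variation_eq_add] at hf
  exact hf.left_of_add_measure

lemma integrable_negPart {G : Type*} [NormedAddCommGroup G] {μ : SignedMeasure X} {f : X → G}
    (hf : Integrable f μ.variation) : Integrable f μ.toJordanDecomposition.negPart := by
  rw [variation_eq_add] at hf
  exact hf.right_of_add_measure

lemma integral_eq_sub {G : Type*} [NormedAddCommGroup G] [NormedSpace ℝ G]
    {μ : SignedMeasure X} {f : X → G} (hf : Integrable f μ.variation) :
    ∫ᵛ x, f x ∂<•μ = ∫ x, f x ∂μ.toJordanDecomposition.posPart -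
      ∫ x, f x ∂μ.toJordanDecomposition.negPart := by
  conv_lhs => rw [← SignedMeasure.toSignedMeasure_toJordanDecomposition μ]
  rw [JordanDecomposition.toSignedMeasure, VectorMeasure.integral_sub_vectorMeasure,
    VectorMeasure.integral_toSignedMeasure, VectorMeasure.integral_toSignedMeasure]
  · simpa [VectorMeasure.Integrable] using integrable_posPart hf
  · simpa [VectorMeasure.Integrable] using integrable_negPart hf

lemma _root_.ContinuousLinearMap.vectorMeasure_integral_comp_comm {G H : Type*}
    [NormedAddCommGroup G] [NormedSpace ℝ G] [NormedAddCommGroup H] [NormedSpace ℝ H]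
    [CompleteSpace G] [CompleteSpace H] (L : G →L[ℝ] H) {μ : SignedMeasure X} {f : X → G}
    (hf : Integrable f μ.variation) :
    ∫ᵛ x, L (f x) ∂<•μ = L (∫ᵛ x, f x ∂<•μ) := by
  rw [integral_eq_sub hf, integral_eq_sub (L.integrable_comp hf), map_sub,
    L.integral_comp_comm (integrable_posPart hf), L.integral_comp_comm (integrable_negPart hf)]

lemma integrable_variation_of_bound {G : Type*} [NormedAddCommGroup G] [TopologicalSpace X]
    [BorelSpace X] [SecondCountableTopologyEither X G] (μ : SignedMeasure X) {f : X → G} {C : ℝ}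
    (hc : Continuous f) (h : ∀ x, ‖f x‖ ≤ C) : Integrable f μ.variation :=
  Integrable.of_bound hc.aestronglyMeasurable C (Eventually.of_forall h)

/-- Fubini on each of the four products of the positive and negative parts of `μ`. -/
lemma integral_integral_swap_of_bound {X : Type*} [TopologicalSpace X] [MeasurableSpace X]
    [BorelSpace X] [SecondCountableTopology X] (μ : SignedMeasure X) {f : X → X → ℝ} {C : ℝ}
    (hf : Continuous (Function.uncurry f)) (h : ∀ x y, ‖f x y‖ ≤ C) :
    ∫ᵛ x, (∫ᵛ y, f x y ∂<•μ) ∂<•μ = ∫ᵛ y, (∫ᵛ x, f x y ∂<•μ) ∂<•μ := by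
  set p := μ.toJordanDecomposition.posPart
  set n := μ.toJordanDecomposition.negPart
  have key : ∀ (a b : Measure X) [IsFiniteMeasure a] [IsFiniteMeasure b],
      Integrable (Function.uncurry f) (a.prod b) := fun a b _ _ =>
    Integrable.of_bound hf.aestronglyMeasurable C (Eventually.of_forall fun z => h z.1 z.2)
  have key' : ∀ (a b : Measure X) [IsFiniteMeasure a] [IsFiniteMeasure b],
      Integrable (Function.uncurry fun y x => f x y) (a.prod b) := fun a b _ _ =>
    Integrable.of_bound (hf.comp continuous_swap).aestronglyMeasurable C
      (Eventually.of_forall fun z => h z.2 z.1)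
  have hx : ∀ x, Continuous fun y => f x y := fun x => hf.comp (by fun_prop : Continuous (x, ·))
  have hy : ∀ y, Continuous fun x => f x y := fun y => hf.comp (by fun_prop : Continuous (·, y))
  have e1 : ∀ x, ∫ᵛ y, f x y ∂<•μ = ∫ y, f x y ∂p - ∫ y, f x y ∂n := fun x =>
    integral_eq_sub (integrable_variation_of_bound μ (hx x) (h x))
  have e2 : ∀ y, ∫ᵛ x, f x y ∂<•μ = ∫ x, f x y ∂p - ∫ x, f x y ∂n := fun y =>
    integral_eq_sub (integrable_variation_of_bound μ (hy y) fun x => h x y)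
  simp only [e1, e2]
  have i1 : ∀ (a b : Measure X) [IsFiniteMeasure a] [IsFiniteMeasure b],
      Integrable (fun x => ∫ y, f x y ∂b) a := fun a b _ _ => (key a b).integral_prod_left
  have i2 : ∀ (a b : Measure X) [IsFiniteMeasure a] [IsFiniteMeasure b],
      Integrable (fun y => ∫ x, f x y ∂b) a := fun a b _ _ => (key' a b).integral_prod_left
  rw [integral_eq_sub (f := fun x => ∫ y, f x y ∂p - ∫ y, f x y ∂n) ((i1 _ p).sub (i1 _ n)),
    integral_eq_sub (f := fun y => ∫ x, f x y ∂p - ∫ x, f x y ∂n) ((i2 _ p).sub (i2 _ n)),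
    integral_sub (i1 _ p) (i1 _ n), integral_sub (i1 _ p) (i1 _ n),
    integral_sub (i2 _ p) (i2 _ n), integral_sub (i2 _ p) (i2 _ n),
    integral_integral_swap (key p p), integral_integral_swap (key p n),
    integral_integral_swap (key n p), integral_integral_swap (key n n)]
  ring

/-- The mass is the integral of the sign `g` of a Hahn decomposition. Approximating `g` in L¹(|μ|)
by a function in C_c and truncating the latter to [-1,1] does not increase the distance, because |g|
≤ 1. -/
lemma mass_le_of_forall_integral_le (μ : SignedMeasure Plane) {C : ℝ}
    (h : ∀ φ : Plane → ℝ, Continuous φ → HasCompactSupport φ → (∀ x, |φ x| ≤ 1) →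
      ∫ᵛ x, φ x ∂<•μ ≤ C) : mass μ ≤ C := by
  refine le_of_forall_pos_le_add fun e he => ?_
  set p := μ.toJordanDecomposition.posPart
  set n := μ.toJordanDecomposition.negPart
  obtain ⟨s, hs, hps, hns⟩ := μ.toJordanDecomposition.mutuallySingular
  classical
  set g : Plane → ℝ := sᶜ.indicator 1 - s.indicator 1 with hg
  have hgm : Measurable g :=
    (measurable_one.indicator hs.compl).sub (measurable_one.indicator hs)
  have hg1 : ∀ x, |g x| ≤ 1 := fun x => by
    by_cases hx : x ∈ s <;> simp [hg, hx]
  have hgi : Integrable g μ.variation :=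
    Integrable.of_bound hgm.aestronglyMeasurable 1 (Eventually.of_forall hg1)
  obtain ⟨φ, hφc, hφe, hφ, hφi⟩ := hgi.exists_hasCompactSupport_integral_sub_le he
  set ψ : Plane → ℝ := fun x => max (-1) (min 1 (φ x)) with hψ
  have hψc : Continuous ψ := continuous_const.max (continuous_const.min hφ)
  have hψ1 : ∀ x, |ψ x| ≤ 1 := fun x => abs_le.2
    ⟨le_max_left _ _, max_le (by norm_num) (min_le_left _ _)⟩
  have hψs : HasCompactSupport ψ := hφc.comp_left (g := fun r : ℝ => max (-1) (min 1 r)) (by simp)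
  have hψi := integrable_variation_of_bound μ hψc hψ1
  have hle : ∀ x, ‖g x - ψ x‖ ≤ ‖g x - φ x‖ := fun x => by
    have := abs_le.1 (hg1 x)
    have h1 : g x = max (-1) (min 1 (g x)) := by
      rw [min_eq_right this.2, max_eq_right this.1]
    rw [h1, Real.norm_eq_abs, Real.norm_eq_abs, ← h1]
    calc |g x - ψ x| = |max (-1) (min 1 (g x)) - max (-1) (min 1 (φ x))| := by rw [← h1]
      _ ≤ |min 1 (g x) - min 1 (φ x)| := by
          simpa using abs_max_sub_max_le_max (-1 : ℝ) (min 1 (g x)) (-1) (min 1 (φ x))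
      _ ≤ |g x - φ x| := by simpa using abs_min_sub_min_le_max (1 : ℝ) (g x) 1 (φ x)
  have hgψ : ∫ x, ‖g x - ψ x‖ ∂μ.variation ≤ e :=
    (integral_mono (hgi.sub hψi).norm (hgi.sub hφi).norm hle).trans hφe
  have hgμ : ∫ᵛ x, g x ∂<•μ = mass μ := by
    rw [integral_eq_sub hgi]
    have h1 : ∫ x, g x ∂p = p.real univ := by
      have : g =ᵐ[p] fun _ => 1 := by
        filter_upwards [measure_eq_zero_iff_ae_notMem.1 hps] with x hx
        simp [hg, hx]
      rw [integral_congr_ae this]; simp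
    have h2 : ∫ x, g x ∂n = -n.real univ := by
      have : g =ᵐ[n] fun _ => -1 := by
        filter_upwards [measure_eq_zero_iff_ae_notMem.1 hns] with x hx
        simp only [mem_compl_iff, not_not] at hx
        simp [hg, hx]
      rw [integral_congr_ae this]; simp
    rw [h1, h2, mass, variation_eq_add, measureReal_add_apply]; ring
  have hd : ∫ᵛ x, (g x - ψ x) ∂<•μ ≤ e := by
    refine (le_abs_self _).trans ?_
    rw [← Real.norm_eq_abs]
    refine VectorMeasure.norm_integral_le_integral_norm.trans ?_
    have h0 : 0 ≤ ∫ x, ‖g x - ψ x‖ ∂μ.variation := integral_nonneg fun _ => norm_nonneg _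
    calc _ ≤ 1 * ∫ x, ‖g x - ψ x‖ ∂μ.variation := by
          gcongr; exact norm_lsmul_flip_le ℝ
      _ ≤ e := by rwa [one_mul]
  rw [VectorMeasure.integral_fun_sub hgi hψi, hgμ] at hd
  linarith [h ψ hψc hψs hψ1]

lemma eq_zero_of_mass_le_zero {μ : SignedMeasure X} (h : mass μ ≤ 0) : μ = 0 := by
  have h0 : μ.variation univ = 0 := by
    have : μ.variation.real univ = 0 := le_antisymm h (mass_nonneg μ)
    simpa [measureReal_eq_zero_iff] using this
  ext i hi
  exact (VectorMeasure.variation_apply_eq_zero MeasurableSet.univ).1 h0 i (subset_univ _) hi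

/-- A continuous function with compact support is a uniform limit of test functions. -/
lemma exists_contDiff_approx {φ : Plane → ℝ} (hφ : Continuous φ) (hc : HasCompactSupport φ)
    {e : ℝ} (he : 0 < e) :
    ∃ ψ : Plane → ℝ, ContDiff ℝ ∞ ψ ∧ HasCompactSupport ψ ∧ ∀ x, |ψ x - φ x| ≤ e := by
  have huc := hc.uniformContinuous_of_continuous hφ
  obtain ⟨δ, hδ, h⟩ := Metric.uniformContinuous_iff.1 huc e he
  let b : ContDiffBump (0 : Plane) := ⟨δ / 2, δ, by linarith, by linarith⟩
  refine ⟨_, (b.hasCompactSupport_normed (μ := volume)).contDiff_convolution_left (μ := volume) (n := ⊤)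
    (ContinuousLinearMap.lsmul ℝ ℝ) b.contDiff_normed (hφ.locallyIntegrable),
    (b.hasCompactSupport_normed (μ := volume)).convolution _ hc, fun x => ?_⟩
  rw [← Real.dist_eq]
  exact b.dist_normed_convolution_le hφ.aestronglyMeasurable fun y hy => (h hy).le

/-- Test functions are uniformly dense in C_c, so `μ - ν` integrates every function of C_c to zero
and has no mass. -/
lemma signedMeasure_ext_of_testFunctions {μ ν : SignedMeasure Plane}
    (h : ∀ φ : Plane → ℝ, ContDiff ℝ ∞ φ → HasCompactSupport φ →
      ∫ᵛ x, φ x ∂<•μ = ∫ᵛ x, φ x ∂<•ν) : μ = ν := by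
  rw [← sub_eq_zero]
  refine eq_zero_of_mass_le_zero (mass_le_of_forall_integral_le _ fun φ hφ hc _ => ?_)
  refine le_of_forall_pos_le_add fun e he => ?_
  have hm := mass_nonneg (μ - ν)
  obtain ⟨ψ, hψ, hψc, hd⟩ := exists_contDiff_approx hφ hc
    (e := e / (mass (μ - ν) + 1)) (by positivity)
  obtain ⟨B, hB⟩ := hc.exists_bound_of_continuous hφ
  obtain ⟨B', hB'⟩ := hψc.exists_bound_of_continuous hψ.continuous
  have h1 : ∫ᵛ x, ψ x ∂<•(μ - ν) = 0 := by
    rw [VectorMeasure.integral_sub_vectorMeasure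
      (integrable_variation_of_bound μ hψ.continuous hB')
      (integrable_variation_of_bound ν hψ.continuous hB'), h ψ hψ hψc, sub_self]
  have h2 := norm_integral_le_mass (μ - ν) (f := fun x => ψ x - φ x) (by positivity) hd
  rw [VectorMeasure.integral_fun_sub (integrable_variation_of_bound _ hψ.continuous hB')
    (integrable_variation_of_bound _ hφ hB), h1, zero_sub, norm_neg] at h2
  have h3 : e / (mass (μ - ν) + 1) * mass (μ - ν) ≤ e := by
    rw [div_mul_eq_mul_div, div_le_iff₀ (by positivity)]; nlinarith
  linarith [le_abs_self (∫ᵛ x, φ x ∂<•(μ - ν)), Real.norm_eq_abs (∫ᵛ x, φ x ∂<•(μ - ν))]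

/-- A weak-* continuous family of signed measures on a compact set has bounded masses. -/
lemma exists_mass_le {S : Set ℝ} (hS : IsCompact S) {q : ℝ → SignedMeasure Plane}
    (hq : ∀ φ : ZeroAtInftyContinuousMap Plane ℝ, ContinuousOn (fun t => ∫ᵛ x, φ x ∂<•(q t)) S) :
    ∃ M : ℝ, 1 ≤ M ∧ ∀ t ∈ S, mass (q t) ≤ M := by
  have hb : ∀ φ : ZeroAtInftyContinuousMap Plane ℝ, ∀ x, ‖φ x‖ ≤ ‖φ‖ := fun φ x =>
    (ZeroAtInftyContinuousMap.norm_toBCF_eq_norm (f := φ)) ▸ φ.toBCF.norm_coe_le_norm x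
  have hi : ∀ (μ : SignedMeasure Plane) (φ : ZeroAtInftyContinuousMap Plane ℝ),
      Integrable φ μ.variation := fun μ φ => integrable_variation_of_bound μ φ.continuous (hb φ)
  let g : S → ZeroAtInftyContinuousMap Plane ℝ →L[ℝ] ℝ := fun t =>
    LinearMap.mkContinuous
      { toFun := fun φ => ∫ᵛ x, φ x ∂<•(q t)
        map_add' := fun φ ψ => VectorMeasure.integral_fun_add (hi _ φ) (hi _ ψ)
        map_smul' := fun c φ => VectorMeasure.integral_fun_smul _ _ c φ }
      (mass (q t)) fun φ => by
        rw [mul_comm]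
        exact norm_integral_le_mass _ (norm_nonneg _) (hb φ)
  -- Uniform boundedness on C₀: continuity on the compact `S` bounds the pairing with each single φ.
  obtain ⟨M, hM⟩ := banach_steinhaus (g := g) fun φ => by
    obtain ⟨C, hC⟩ := hS.exists_bound_of_continuousOn (hq φ)
    exact ⟨C, fun t => hC t t.2⟩
  refine ⟨max M 1, le_max_right _ _, fun t ht => ?_⟩
  refine mass_le_of_forall_integral_le _ fun φ hφ hc h1 => ?_
  let φ' : ZeroAtInftyContinuousMap Plane ℝ := ⟨⟨φ, hφ⟩, hc.is_zero_at_infty⟩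
  have hn : ‖φ'‖ ≤ 1 := by
    rw [← ZeroAtInftyContinuousMap.norm_toBCF_eq_norm]
    exact (BoundedContinuousFunction.norm_le zero_le_one).2 h1
  calc ∫ᵛ x, φ x ∂<•(q t) ≤ ‖g ⟨t, ht⟩ φ'‖ := le_abs_self _
    _ ≤ M * ‖φ'‖ := (g ⟨t, ht⟩).le_of_opNorm_le (hM _) φ'
    _ ≤ max M 1 * 1 := by gcongr; exact le_max_left _ _
    _ = _ := mul_one _

end SignedMeasure


/-! ### The velocity generated by a measure. -/

section Velocity

variable {α : ℝ}

lemma integrable_kernelAlpha (hα : 0 < α) (μ : SignedMeasure Plane) (x : Plane) :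
    Integrable (fun y => kernelAlpha α (x - y)) μ.variation := by
  obtain ⟨C, _, _, hb⟩ := exists_logLipschitz_kernelAlpha hα
  exact integrable_variation_of_bound μ
    ((continuous_kernelAlpha hα).comp (by fun_prop)) fun y => hb _

lemma logLipschitz_velocity (hα : 0 < α) {C : ℝ} (hK : LogLipschitz C (kernelAlpha α))
    (hC : 0 ≤ C) {M : ℝ} {μ : SignedMeasure Plane} (hM : mass μ ≤ M) :
    LogLipschitz (C * M) (velocity α μ) := fun ε h0 h1 x y => by
  have hl := one_le_one_sub_log h0 h1
  have hl' : 0 ≤ 1 - Real.log ε := zero_le_one.trans hl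
  rw [velocity, velocity, ← VectorMeasure.integral_fun_sub (integrable_kernelAlpha hα μ x)
    (integrable_kernelAlpha hα μ y)]
  have h : ∀ z, ‖kernelAlpha α (x - z) - kernelAlpha α (y - z)‖ ≤
      C * (1 - Real.log ε) * (‖x - y‖ + ε) := fun z => by
    simpa using hK ε h0 h1 (x - z) (y - z)
  calc _ ≤ C * (1 - Real.log ε) * (‖x - y‖ + ε) * mass μ :=
        norm_integral_le_mass μ (by positivity) h
    _ ≤ C * (1 - Real.log ε) * (‖x - y‖ + ε) * M := by gcongr
    _ = _ := by ring

lemma continuousOn_velocity (hα : 0 < α) {S : Set ℝ} {q : ℝ → SignedMeasure Plane}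
    (hq : ∀ φ : ZeroAtInftyContinuousMap Plane ℝ, ContinuousOn (fun t => ∫ᵛ x, φ x ∂<•(q t)) S)
    (x : Plane) : ContinuousOn (fun t => velocity α (q t) x) S := by
  rw [← (EuclideanSpace.equiv (Fin 2) ℝ).toHomeomorph.comp_continuousOn_iff, continuousOn_pi]
  intro i
  have hc : Continuous fun y => kernelAlpha α (x - y) :=
    (continuous_kernelAlpha hα).comp (by fun_prop)
  have hlim : Tendsto (fun y : Plane => x - y) (cocompact Plane) (cocompact Plane) :=
    (Homeomorph.subLeft x).isClosedEmbedding.tendsto_cocompact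
  let φ : ZeroAtInftyContinuousMap Plane ℝ :=
    ⟨⟨fun y => (EuclideanSpace.proj i : Plane →L[ℝ] ℝ) (kernelAlpha α (x - y)), by fun_prop⟩, by
      have := ((EuclideanSpace.proj i : Plane →L[ℝ] ℝ).continuous.tendsto 0).comp ((tendsto_kernelAlpha_cocompact hα).comp hlim)
      rw [map_zero] at this
      exact this⟩
  refine (hq φ).congr fun t _ => ?_
  exact ((EuclideanSpace.proj i : Plane →L[ℝ] ℝ).vectorMeasure_integral_comp_comm
    (integrable_kernelAlpha hα (q t) x)).symm

end Velocity

/-! ### Admissible fields: bounded, log-Lipschitz in space, continuous in time. -/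

section Field

/-- A bounded velocity field on `[0,T]` which is log-Lipschitz in space, uniformly in time, and
continuous in time. -/
structure AdmissibleField (T C : ℝ) (u : ℝ → Plane → Plane) : Prop where
  one_le : 1 ≤ C
  norm_le : ∀ t ∈ Icc 0 T, ∀ x, ‖u t x‖ ≤ C
  logLipschitz : ∀ t ∈ Icc 0 T, LogLipschitz C (u t)
  continuousOn : ∀ x, ContinuousOn (fun t => u t x) (Icc 0 T)

variable {T C : ℝ} {u : ℝ → Plane → Plane}

lemma AdmissibleField.continuous (hu : AdmissibleField T C u) {t : ℝ} (ht : t ∈ Icc 0 T) :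
    Continuous (u t) := (hu.logLipschitz t ht).uniformContinuous.continuous

lemma exists_admissibleField_velocity {α : ℝ} (hα : 0 < α) {T : ℝ}
    {q : ℝ → SignedMeasure Plane}
    (hq : ∀ φ : ZeroAtInftyContinuousMap Plane ℝ,
      ContinuousOn (fun t => ∫ᵛ x, φ x ∂<•(q t)) (Icc 0 T)) :
    ∃ C, AdmissibleField T C (fun t => velocity α (q t)) := by
  obtain ⟨C, hC, hK, hb⟩ := exists_logLipschitz_kernelAlpha hα
  obtain ⟨M, hM1, hM⟩ := exists_mass_le isCompact_Icc hq
  refine ⟨C * M, one_le_mul_of_one_le_of_one_le hC hM1, fun t ht x => ?_, fun t ht =>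
    logLipschitz_velocity hα hK (by linarith) (hM t ht), continuousOn_velocity hα hq⟩
  refine (norm_integral_le_mass (q t) (by linarith) fun y => hb (x - y)).trans ?_
  gcongr
  exact hM t ht

/-- The spatial modulus is uniform in time, which upgrades separate continuity to joint continuity.
-/
lemma AdmissibleField.continuousOn_uncurry (hu : AdmissibleField T C u) :
    ContinuousOn (Function.uncurry u) (Icc 0 T ×ˢ univ) := by
  rintro ⟨t, x⟩ ⟨ht, -⟩
  rw [Metric.continuousWithinAt_iff]
  intro e he
  have hC := hu.one_le
  have h := (tendsto_mul_one_sub_log.const_mul (2 * C)).eventually_lt_const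
    (show 2 * C * 0 < e / 2 by simpa using he)
  obtain ⟨ε, h3, h0, h1⟩ := (h.and (Ioc_mem_nhdsGT zero_lt_one)).exists
  obtain ⟨δ, hδ, h4⟩ := Metric.continuousWithinAt_iff.1 (hu.continuousOn x t ht) (e / 2) (by linarith)
  refine ⟨min ε δ, lt_min h0 hδ, ?_⟩
  rintro ⟨s, y⟩ ⟨hs, -⟩ hd
  rw [Prod.dist_eq, max_lt_iff] at hd
  have h5 := h4 hs (hd.1.trans_le (min_le_right _ _))
  have h6 := hu.logLipschitz s hs ε h0 h1 y x
  have hl := one_le_one_sub_log h0 h1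
  have h7 : ‖y - x‖ ≤ ε := by
    rw [← dist_eq_norm]; exact (hd.2.trans_le (min_le_left _ _)).le
  calc dist (u s y) (u t x) ≤ dist (u s y) (u s x) + dist (u s x) (u t x) := dist_triangle _ _ _
    _ ≤ C * (1 - Real.log ε) * (ε + ε) + dist (u s x) (u t x) := by
        rw [dist_eq_norm (u s y)]
        refine add_le_add_left (h6.trans ?_) _
        have : 0 ≤ C * (1 - Real.log ε) := by nlinarith
        gcongr
    _ = 2 * C * (ε * (1 - Real.log ε)) + dist (u s x) (u t x) := by ring
    _ < e / 2 + e / 2 := add_lt_add h3 h5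
    _ = e := by ring

/-- Uniform continuity on the compact set [0,T] × ball. It comes without a rate and only on balls;
hence the supports of test functions are tracked below, and the time step is sent to zero at a fixed
mollification scale. -/
lemma AdmissibleField.exists_time_modulus (hu : AdmissibleField T C u) (R : ℝ) {e : ℝ}
    (he : 0 < e) : ∃ δ > 0, ∀ s ∈ Icc 0 T, ∀ t ∈ Icc 0 T, |s - t| ≤ δ → ∀ x, ‖x‖ ≤ R →
      ‖u s x - u t x‖ ≤ e := by
  have hcomp : IsCompact (Icc 0 T ×ˢ Metric.closedBall (0 : Plane) R) :=
    isCompact_Icc.prod (isCompact_closedBall _ _)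
  have huc := hcomp.uniformContinuousOn_of_continuous
    (hu.continuousOn_uncurry.mono (prod_mono_right (subset_univ _)))
  obtain ⟨δ, hδ, h⟩ := Metric.uniformContinuousOn_iff.1 huc e he
  refine ⟨δ / 2, by positivity, fun s hs t ht hst x hx => ?_⟩
  have hx' : x ∈ Metric.closedBall (0 : Plane) R := by simpa using hx
  have := h (s, x) ⟨hs, hx'⟩ (t, x) ⟨ht, hx'⟩ (by
    rw [Prod.dist_eq, dist_self, max_eq_left dist_nonneg, Real.dist_eq]; linarith)
  rw [← dist_eq_norm]
  exact this.le

end Field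

/-! ### Mollification of a log-Lipschitz field. -/

section Mollify

open scoped Convolution

/-- The standard mollifier, supported in the unit ball. -/
noncomputable def unitBump : ContDiffBump (0 : Plane) := ⟨1 / 2, 1, by norm_num, by norm_num⟩

/-- The normalized standard mollifier. -/
noncomputable def unitMollifier : Plane → ℝ := unitBump.normed volume

/-- The mollification of `f` at scale `δ`. -/
noncomputable def mollify (δ : ℝ) (f : Plane → Plane) (x : Plane) : Plane :=
  (unitMollifier ⋆[ContinuousLinearMap.lsmul ℝ ℝ, volume] fun z => f (δ • z)) (δ⁻¹ • x)

lemma contDiff_unitMollifier {n : ℕ∞} : ContDiff ℝ n unitMollifier := unitBump.contDiff_normed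

lemma hasCompactSupport_unitMollifier : HasCompactSupport unitMollifier :=
  unitBump.hasCompactSupport_normed

lemma support_unitMollifier : Function.support unitMollifier = Metric.ball 0 1 :=
  unitBump.support_normed_eq

lemma support_fderiv_unitMollifier :
    Function.support (fderiv ℝ unitMollifier) ⊆ Metric.ball 0 2 := by
  refine (support_fderiv_subset ℝ).trans ?_
  rw [tsupport, support_unitMollifier]
  exact Metric.closure_ball_subset_closedBall.trans (Metric.closedBall_subset_ball (by norm_num))

lemma support_fderiv_fderiv_unitMollifier :
    Function.support (fderiv ℝ (fderiv ℝ unitMollifier)) ⊆ Metric.ball 0 2 := by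
  refine (support_fderiv_subset ℝ).trans ((tsupport_fderiv_subset ℝ).trans ?_)
  rw [tsupport, support_unitMollifier]
  exact Metric.closure_ball_subset_closedBall.trans (Metric.closedBall_subset_ball (by norm_num))

lemma norm_convolution_le {E F G : Type*} [NormedAddCommGroup E] [NormedSpace ℝ E]
    [NormedAddCommGroup F] [NormedSpace ℝ F] [NormedAddCommGroup G] [NormedSpace ℝ G]
    [CompleteSpace G] (L : E →L[ℝ] F →L[ℝ] G) {f : Plane → E} {g : Plane → F} {x : Plane}
    {R w : ℝ} (hw : 0 ≤ w) (hf : Continuous f) (hfc : HasCompactSupport f)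
    (hs : Function.support f ⊆ Metric.ball 0 R) (hg : AEStronglyMeasurable g)
    (h : ∀ y ∈ Metric.ball x R, ‖g y‖ ≤ w) :
    ‖(f ⋆[L, volume] g) x‖ ≤ ‖L‖ * (∫ y, ‖f y‖) * w := by
  have := dist_convolution_le' (L := L) (μ := volume) (z₀ := (0 : F)) hw
    (hf.integrable_of_hasCompactSupport hfc) hs hg (x₀ := x)
    (fun y hy => by simpa using h y hy)
  simpa [dist_eq_norm] using this

-- The derivative falls on f, so that A depends on f and L but not on g. Both the mollifier and its
-- derivative are used as f, for the first and the second derivative.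
set_option maxSynthPendingDepth 3 in
lemma exists_norm_fderiv_convolution_le {E G : Type*} [NormedAddCommGroup E] [NormedSpace ℝ E]
    [NormedAddCommGroup G] [NormedSpace ℝ G] [CompleteSpace G] (L : E →L[ℝ] Plane →L[ℝ] G)
    {f : Plane → E} {R : ℝ} (hf : ContDiff ℝ 1 f) (hc : HasCompactSupport f)
    (hs : Function.support (fderiv ℝ f) ⊆ Metric.ball 0 R) :
    ∃ A, 0 ≤ A ∧ ∀ g : Plane → Plane, Continuous g → ∀ x w, 0 ≤ w →
      (∀ y ∈ Metric.ball x R, ‖g y‖ ≤ w) → ‖fderiv ℝ (f ⋆[L, volume] g) x‖ ≤ A * w := by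
  refine ⟨‖L.precompL Plane‖ * ∫ y, ‖fderiv ℝ f y‖,
    mul_nonneg (norm_nonneg _) (integral_nonneg fun _ => norm_nonneg _),
    fun g hg x w hw h => ?_⟩
  rw [(hc.hasFDerivAt_convolution_left L hf hg.locallyIntegrable x).fderiv]
  exact norm_convolution_le _ hw (hf.continuous_fderiv one_ne_zero) (hc.fderiv (𝕜 := ℝ)) hs
    hg.aestronglyMeasurable h

-- Subtracting the constant `g x` changes the convolution by a constant, so the first derivative at
-- x sees only the oscillation of g near x. The second derivative needs no such precision: a bound
-- in terms of sup |g| suffices. Both estimates are at unit scale; `mollify` dilates them.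
set_option maxSynthPendingDepth 3 in
lemma exists_convolution_bounds : ∃ A : ℝ, 1 ≤ A ∧ ∀ g : Plane → Plane, Continuous g →
    (∀ w, 0 ≤ w → (∀ x y, ‖x - y‖ ≤ 2 → ‖g x - g y‖ ≤ w) → ∀ x,
      ‖fderiv ℝ (unitMollifier ⋆[ContinuousLinearMap.lsmul ℝ ℝ, volume] g) x‖ ≤ A * w) ∧
    (∀ C, 0 ≤ C → (∀ x, ‖g x‖ ≤ C) → ∀ x y,
      ‖fderiv ℝ (unitMollifier ⋆[ContinuousLinearMap.lsmul ℝ ℝ, volume] g) x -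
        fderiv ℝ (unitMollifier ⋆[ContinuousLinearMap.lsmul ℝ ℝ, volume] g) y‖ ≤
        A * C * ‖x - y‖) := by
  let L : ℝ →L[ℝ] Plane →L[ℝ] Plane := ContinuousLinearMap.lsmul ℝ ℝ
  have hd1 : ContDiff ℝ 1 (fderiv ℝ unitMollifier) :=
    (contDiff_unitMollifier (n := 2)).fderiv_right (by norm_num)
  have hs1 := hasCompactSupport_unitMollifier.fderiv (𝕜 := ℝ)
  obtain ⟨A₁, hA₁, h₁⟩ := exists_norm_fderiv_convolution_le L (contDiff_unitMollifier (n := 1))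
    hasCompactSupport_unitMollifier support_fderiv_unitMollifier
  obtain ⟨A₂, hA₂, h₂⟩ := exists_norm_fderiv_convolution_le (L.precompL Plane) hd1 hs1
    support_fderiv_fderiv_unitMollifier
  refine ⟨1 + A₁ + A₂, by linarith, fun g hg => ⟨fun w hw h x => ?_, fun C hC h x y => ?_⟩⟩
  · have hsub : (unitMollifier ⋆[L, volume] g) =
        fun y => (unitMollifier ⋆[L, volume] fun z => g z - g x) y + g x := by
      ext1 y
      have i1 : Integrable fun t => L (unitMollifier t) (g (y - t)) :=
        (hasCompactSupport_unitMollifier.convolutionExists_left L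
          (contDiff_unitMollifier (n := 0)).continuous hg.locallyIntegrable y)
      have i2 : Integrable fun t => L (unitMollifier t) (g x) :=
        (hasCompactSupport_unitMollifier.convolutionExists_left L
          (contDiff_unitMollifier (n := 0)).continuous
          (continuous_const (y := g x)).locallyIntegrable y)
      have i3 : ∫ t, L (unitMollifier t) (g x) = g x := by
        simp only [L, ContinuousLinearMap.lsmul_apply]
        rw [integral_smul_const, unitMollifier, unitBump.integral_normed, one_smul]
      rw [convolution_def, convolution_def]
      simp only [map_sub]
      rw [integral_sub i1 i2, i3]
      abel
    change ‖fderiv ℝ (unitMollifier ⋆[L, volume] g) x‖ ≤ _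
    rw [hsub, fderiv_add_const]
    calc _ ≤ A₁ * w := h₁ (fun z => g z - g x) (by fun_prop) x w hw fun y hy => h y x (by
            rw [← dist_eq_norm]; exact (Metric.mem_ball.1 hy).le)
      _ ≤ _ := by gcongr; linarith
  · have e : fderiv ℝ (unitMollifier ⋆[L, volume] g) =
        (fderiv ℝ unitMollifier ⋆[L.precompL Plane, volume] g) := by
      ext1 x
      exact (hasCompactSupport_unitMollifier.hasFDerivAt_convolution_left L
        (contDiff_unitMollifier (n := 1)) hg.locallyIntegrable x).fderiv
    change ‖fderiv ℝ (unitMollifier ⋆[L, volume] g) x -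
      fderiv ℝ (unitMollifier ⋆[L, volume] g) y‖ ≤ _
    rw [e]
    refine Convex.norm_image_sub_le_of_norm_fderiv_le (𝕜 := ℝ) (s := univ)
      (fun z _ => (hs1.hasFDerivAt_convolution_left _ hd1 hg.locallyIntegrable
        z).differentiableAt) (fun z _ => ?_) convex_univ (mem_univ y) (mem_univ x)
    calc _ ≤ A₂ * C := h₂ g hg z C hC fun y _ => h y
      _ ≤ _ := by gcongr; linarith

lemma contDiff_mollify (δ : ℝ) {f : Plane → Plane} (hf : Continuous f) :
    ContDiff ℝ ∞ (mollify δ f) := by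
  have h := hasCompactSupport_unitMollifier.contDiff_convolution_left (μ := volume) (n := ⊤)
    (ContinuousLinearMap.lsmul ℝ ℝ) contDiff_unitMollifier
    (hf.comp (continuous_const_smul δ)).locallyIntegrable
  exact h.comp (contDiff_const_smul δ⁻¹)

lemma norm_mollify_sub_le {δ w : ℝ} (hδ : 0 < δ) {f : Plane → Plane} (hf : Continuous f)
    (h : ∀ x y, ‖x - y‖ ≤ δ → ‖f x - f y‖ ≤ w) (x : Plane) : ‖mollify δ f x - f x‖ ≤ w := by
  have := unitBump.dist_normed_convolution_le (μ := volume) (g := fun z => f (δ • z))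
    (x₀ := δ⁻¹ • x) (ε := w) (hf.comp (continuous_const_smul δ)).aestronglyMeasurable
    fun y hy => by
      rw [dist_eq_norm]
      refine h _ _ ?_
      rw [← smul_sub, norm_smul, Real.norm_of_nonneg hδ.le, ← dist_eq_norm]
      have : dist y (δ⁻¹ • x) < 1 := hy
      nlinarith
  rw [smul_inv_smul₀ hδ.ne', dist_eq_norm] at this
  exact this

lemma norm_mollify_le {δ C : ℝ} (hC : 0 ≤ C) {f : Plane → Plane} (hf : Continuous f)
    (h : ∀ x, ‖f x‖ ≤ C) (x : Plane) : ‖mollify δ f x‖ ≤ C := by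
  have h1 := dist_convolution_le' (L := ContinuousLinearMap.lsmul ℝ ℝ) (μ := volume)
    (f := unitMollifier) (g := fun z => f (δ • z)) (z₀ := (0 : Plane)) (x₀ := δ⁻¹ • x) hC
    unitBump.integrable_normed support_unitMollifier.subset
    (hf.comp (continuous_const_smul δ)).aestronglyMeasurable
    (fun y _ => by simpa using h (δ • y))
  have h2 : ∫ y, ‖unitMollifier y‖ = 1 := by
    rw [← unitBump.integral_normed (μ := volume)]
    exact integral_congr_ae (Eventually.of_forall fun y =>
      Real.norm_of_nonneg (unitBump.nonneg_normed y))
  have h3 : ‖(ContinuousLinearMap.lsmul ℝ ℝ : ℝ →L[ℝ] Plane →L[ℝ] Plane)‖ ≤ 1 :=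
    ContinuousLinearMap.opNorm_lsmul_le
  simp only [map_zero, integral_zero, dist_zero_right, h2, mul_one] at h1
  exact h1.trans (by nlinarith)

lemma fderiv_mollify (δ : ℝ) (f : Plane → Plane) (x : Plane) :
    fderiv ℝ (mollify δ f) x = δ⁻¹ • fderiv ℝ
      (unitMollifier ⋆[ContinuousLinearMap.lsmul ℝ ℝ, volume] fun z => f (δ • z)) (δ⁻¹ • x) := by
  exact fderiv_comp_smul (f := unitMollifier ⋆[ContinuousLinearMap.lsmul ℝ ℝ, volume]
    fun z => f (δ • z)) _

lemma continuousOn_mollify {S : Set ℝ} {u : ℝ → Plane → Plane} {C δ : ℝ}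
    (hc : ∀ t ∈ S, Continuous (u t)) (hb : ∀ t ∈ S, ∀ x, ‖u t x‖ ≤ C)
    (hu : ∀ x, ContinuousOn (fun t => u t x) S) (x : Plane) :
    ContinuousOn (fun t => mollify δ (u t) x) S := by
  simp only [mollify, convolution_def, ContinuousLinearMap.lsmul_apply]
  refine continuousOn_of_dominated (bound := fun z => ‖unitMollifier z‖ * C) (fun t ht => ?_)
    (fun t ht => Eventually.of_forall fun z => ?_) ?_ (Eventually.of_forall fun z => ?_)
  · have := hc t ht
    have h2 := (contDiff_unitMollifier (n := 0)).continuous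
    have h3 : Continuous fun z => δ • (δ⁻¹ • x - z) := by fun_prop
    exact (h2.smul (this.comp h3)).aestronglyMeasurable
  · rw [norm_smul]
    gcongr
    exact hb t ht _
  · exact unitBump.integrable_normed.norm.mul_const C
  · have h := hu (δ • (δ⁻¹ • x - z))
    exact h.const_smul (unitMollifier z)

lemma norm_smul_sub_smul_le {E : Type*} [NormedAddCommGroup E] [NormedSpace ℝ E] {ε : ℝ}
    (h : 0 < ε) (a b : E) : ‖ε⁻¹ • a - ε⁻¹ • b‖ ≤ ε⁻¹ * ‖a - b‖ := by
  rw [← smul_sub, norm_smul, norm_inv, Real.norm_of_nonneg h.le]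

/-- Mollification in space of an admissible field, with the bounds that follow from its modulus of
continuity. -/
lemma exists_smooth_approx : ∃ A : ℝ, 1 ≤ A ∧ ∀ (T C : ℝ) (u : ℝ → Plane → Plane),
    AdmissibleField T C u → ∀ ε, 0 < ε → ε ≤ 1 → ∃ (v : ℝ → Plane → Plane) (B : ℝ), 0 ≤ B ∧
      (∀ x, ContinuousOn (fun t => v t x) (Icc 0 T)) ∧
      ∀ t ∈ Icc 0 T, ContDiff ℝ ∞ (v t) ∧ (∀ x, ‖v t x‖ ≤ C) ∧
        (∀ x, ‖v t x - u t x‖ ≤ 2 * C * (ε * (1 - Real.log ε))) ∧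
        (∀ x, ‖fderiv ℝ (v t) x‖ ≤ A * C * (1 - Real.log ε)) ∧
        ∀ x y, ‖fderiv ℝ (v t) x - fderiv ℝ (v t) y‖ ≤ B * ‖x - y‖ := by
  obtain ⟨A, hA, hAb⟩ := exists_convolution_bounds
  refine ⟨3 * A, by linarith, fun T C u hu ε h0 h1 => ?_⟩
  have hl := one_le_one_sub_log h0 h1
  have hl' : 0 ≤ 1 - Real.log ε := zero_le_one.trans hl
  have hC0 : 0 ≤ C := zero_le_one.trans hu.one_le
  refine ⟨fun t => mollify ε (u t), ε⁻¹ * (A * C * ε⁻¹), by positivity,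
    continuousOn_mollify (fun t ht => hu.continuous ht) hu.norm_le hu.continuousOn,
    fun t ht => ?_⟩
  have hc := hu.continuous ht
  have hg : Continuous fun z => u t (ε • z) := hc.comp (continuous_const_smul ε)
  obtain ⟨hA1, hA2⟩ := hAb _ hg
  have hmod : ∀ k : ℝ, 0 ≤ k → ∀ x y, ‖x - y‖ ≤ k * ε →
      ‖u t x - u t y‖ ≤ C * (1 - Real.log ε) * ((k + 1) * ε) := fun k hk x y hxy => by
    refine (hu.logLipschitz t ht ε h0 h1 x y).trans ?_
    gcongr
    linarith
  refine ⟨contDiff_mollify ε hc, norm_mollify_le hC0 hc (hu.norm_le t ht), fun x => ?_,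
    fun x => ?_, fun x y => ?_⟩
  · refine norm_mollify_sub_le h0 hc (fun x y hxy => ?_) x
    refine (hmod 1 zero_le_one x y (by linarith)).trans (le_of_eq (by ring))
  · rw [fderiv_mollify, norm_smul, norm_inv, Real.norm_of_nonneg h0.le]
    -- Points at distance 2 are at distance 2ε after dilation, where the modulus at scale ε gives
    -- the factor 2ε + ε = 3ε. The ε cancels the ε⁻¹ of the dilation, and the gradient is only
    -- logarithmic in ε.
    have := hA1 (C * (1 - Real.log ε) * (3 * ε)) (by positivity) (fun x y hxy => by
      have := hmod 2 zero_le_two (ε • x) (ε • y) (by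
        rw [← smul_sub, norm_smul, Real.norm_of_nonneg h0.le]; nlinarith)
      exact this.trans (le_of_eq (by ring))) (ε⁻¹ • x)
    calc _ ≤ ε⁻¹ * (A * (C * (1 - Real.log ε) * (3 * ε))) := by gcongr
      _ = _ := by field_simp
  · simp only [fderiv_mollify]
    refine (norm_smul_sub_smul_le h0 _ _).trans ?_
    rw [mul_assoc]
    gcongr
    refine (hA2 C hC0 (fun z => hu.norm_le t ht _) _ _).trans (le_of_eq ?_)
    rw [← smul_sub, norm_smul, norm_inv, Real.norm_of_nonneg h0.le]
    ring

end Mollify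


/-! ### Gronwall estimates forward and backward in time. -/

section Gronwall

lemma gronwallBound_le {δ K ε x : ℝ} (hK : 1 ≤ K) (hε : 0 ≤ ε) (hx : 0 ≤ x) :
    gronwallBound δ K ε x ≤ (δ + ε) * Real.exp (K * x) := by
  have hK0 : 0 < K := by linarith
  rw [gronwallBound_of_K_ne_0 hK0.ne']
  have h1 : 1 ≤ Real.exp (K * x) := Real.one_le_exp (by positivity)
  have h2 : ε / K ≤ ε := div_le_self hε hK
  have h3 : 0 ≤ ε / K := by positivity
  nlinarith

lemma norm_le_of_hasDerivWithinAt {E : Type*} [NormedAddCommGroup E] [NormedSpace ℝ E]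
    {f : ℝ → E} {a b K ε : ℝ} (hK : 1 ≤ K) (hε : 0 ≤ ε)
    (h : ∀ t ∈ Icc a b, ∃ f', HasDerivWithinAt f f' (Icc a b) t ∧ ‖f'‖ ≤ K * ‖f t‖ + ε)
    {s t : ℝ} (hs : a ≤ s) (hst : s ≤ t) (ht : t ≤ b) :
    ‖f t‖ ≤ (‖f s‖ + ε) * Real.exp (K * (t - s)) := by
  choose! f' hf' hb using h
  have hsub : Icc s t ⊆ Icc a b := Icc_subset_Icc hs ht
  have := norm_le_gronwallBound_of_norm_deriv_right_le (f := f) (f' := f') (δ := ‖f s‖) (K := K)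
    (ε := ε) (a := s) (b := t)
    (fun r hr => ((hf' r (hsub hr)).continuousWithinAt).mono hsub)
    (fun r hr => (hf' r (hsub (Ico_subset_Icc_self hr))).mono_of_mem_nhdsWithin
      (mem_of_superset (Icc_mem_nhdsGE hr.2)
        (Icc_subset_Icc (hs.trans hr.1) ht))) le_rfl
    (fun r hr => hb r (hsub (Ico_subset_Icc_self hr))) t (right_mem_Icc.2 hst)
  exact this.trans (gronwallBound_le hK hε (sub_nonneg.2 hst))

/-- For t ≤ s, time is reversed. The two-sided form is needed because the flow is inverted by
solving backward. -/
lemma norm_le_of_hasDerivWithinAt_abs {E : Type*} [NormedAddCommGroup E] [NormedSpace ℝ E]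
    {f : ℝ → E} {a b K ε : ℝ} (hK : 1 ≤ K) (hε : 0 ≤ ε)
    (h : ∀ t ∈ Icc a b, ∃ f', HasDerivWithinAt f f' (Icc a b) t ∧ ‖f'‖ ≤ K * ‖f t‖ + ε)
    {s t : ℝ} (hs : s ∈ Icc a b) (ht : t ∈ Icc a b) :
    ‖f t‖ ≤ (‖f s‖ + ε) * Real.exp (K * |t - s|) := by
  rcases le_total s t with hst | hst
  · rw [abs_of_nonneg (sub_nonneg.2 hst)]
    exact norm_le_of_hasDerivWithinAt hK hε h hs.1 hst ht.2
  · rw [abs_of_nonpos (sub_nonpos.2 hst)]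
    have h' : ∀ r ∈ Icc (-b) (-a), ∃ g', HasDerivWithinAt (fun r => f (-r)) g' (Icc (-b) (-a)) r ∧
        ‖g'‖ ≤ K * ‖f (-r)‖ + ε := fun r hr => by
      obtain ⟨f', h1, h2⟩ := h (-r) ⟨by linarith [hr.2], by linarith [hr.1]⟩
      refine ⟨-f', ?_, by rwa [norm_neg]⟩
      have := h1.scomp r (hasDerivWithinAt_id r (Icc (-b) (-a))).neg
        (fun x hx => ⟨le_neg.1 hx.2, neg_le.1 hx.1⟩)
      simpa [Function.comp_def] using this
    have := norm_le_of_hasDerivWithinAt hK hε h' (neg_le_neg hs.2) (neg_le_neg hst)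
      (neg_le_neg ht.1)
    simp only [neg_neg] at this
    convert this using 3
    ring

end Gronwall

/-! ### Existence, uniqueness and stability of trajectories. -/

section Flow

variable {T C : ℝ} {u : ℝ → Plane → Plane}

/-- `x` solves `x' = u(t, x)` on `[0,T]` up to an error of size `d`. -/
def ApproxSol (T : ℝ) (u : ℝ → Plane → Plane) (d : ℝ) (x : ℝ → Plane) : Prop :=
  ∀ t ∈ Icc 0 T, ∃ x', HasDerivWithinAt x x' (Icc 0 T) t ∧ ‖x' - u t (x t)‖ ≤ d

/-- `x` solves `x' = u(t, x)` on `[0,T]`. -/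
def IsSol (T : ℝ) (u : ℝ → Plane → Plane) (x : ℝ → Plane) : Prop :=
  ∀ t ∈ Icc 0 T, HasDerivWithinAt x (u t (x t)) (Icc 0 T) t

lemma IsSol.approxSol {x : ℝ → Plane} (hx : IsSol T u x) {d : ℝ} (hd : 0 ≤ d) :
    ApproxSol T u d x := fun t ht => ⟨_, hx t ht, by simpa using hd⟩

lemma ApproxSol.mono {x : ℝ → Plane} {d d' : ℝ} (hx : ApproxSol T u d x) (h : d ≤ d') :
    ApproxSol T u d' x := fun t ht =>
  let ⟨x', h1, h2⟩ := hx t ht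
  ⟨x', h1, h2.trans h⟩

/-- The log-Lipschitz bound is taken at scale ε = d and has Lipschitz constant K = C (1 - log d) ≥
1. The two errors d and the remainder K d add up to at most 3 K d, and the initial distance raises
this to 4 K d. -/
lemma ApproxSol.norm_sub_apply_le {x y : ℝ → Plane} {d : ℝ} (hu : AdmissibleField T C u) (hd : 0 < d)
    (hd1 : d ≤ 1) (hx : ApproxSol T u d x) (hy : ApproxSol T u d y) {s t : ℝ} (hs : s ∈ Icc 0 T)
    (ht : t ∈ Icc 0 T) (h : ‖x s - y s‖ ≤ d) :
    ‖x t - y t‖ ≤ 4 * C * (d * (1 - Real.log d)) *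
      Real.exp (C * (1 - Real.log d) * |t - s|) := by
  have hl := one_le_one_sub_log hd hd1
  have hC := hu.one_le
  set K := C * (1 - Real.log d) with hK
  have hK1 : 1 ≤ K := one_le_mul_of_one_le_of_one_le hC hl
  have := norm_le_of_hasDerivWithinAt_abs (f := fun r => x r - y r) (K := K) (ε := 3 * (K * d))
    hK1 (by positivity) (fun r hr => by
      obtain ⟨x', hx1, hx2⟩ := hx r hr
      obtain ⟨y', hy1, hy2⟩ := hy r hr
      refine ⟨x' - y', hx1.sub hy1, ?_⟩
      have e : x' - y' = (x' - u r (x r)) - (y' - u r (y r)) + (u r (x r) - u r (y r)) := by abel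
      have h3 := hu.logLipschitz r hr d hd hd1 (x r) (y r)
      rw [e]
      refine (norm_add_le _ _).trans ?_
      have := norm_sub_le (x' - u r (x r)) (y' - u r (y r))
      nlinarith) hs ht
  refine this.trans ?_
  gcongr
  nlinarith

/-- The exponential equals e^(1/2) ε^(-1/2), so the product is e^(1/2) √ε (1 - log ε). The 1/2 in
the exponent is what limits the length of a time step, both here and in the transport argument. -/
lemma tendsto_log_exp_modulus : Tendsto (fun ε : ℝ => ε * (1 - Real.log ε) *
    Real.exp ((1 - Real.log ε) / 2)) (𝓝[>] 0) (𝓝 0) := by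
  have h1 : Tendsto (fun ε : ℝ => √ε) (𝓝[>] 0) (𝓝[>] 0) := by
    refine tendsto_nhdsWithin_iff.2 ⟨?_, ?_⟩
    · have := (Real.continuous_sqrt.tendsto 0).mono_left (nhdsWithin_le_nhds (s := Ioi 0))
      simpa using this
    · filter_upwards [self_mem_nhdsWithin] with ε hε using Real.sqrt_pos.2 hε
  have h2 := (tendsto_mul_one_sub_log.comp h1).const_mul (2 * Real.exp (1 / 2))
  have h3 := (h1.mono_right nhdsWithin_le_nhds).const_mul (Real.exp (1 / 2))
  have h4 := h2.sub h3
  simp only [mul_zero, sub_zero] at h4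
  refine h4.congr' ?_
  filter_upwards [self_mem_nhdsWithin] with ε hε
  have hε : 0 < ε := hε
  have hs := Real.sqrt_pos.2 hε
  have e1 : Real.exp ((1 - Real.log ε) / 2) = Real.exp (1 / 2) * (√ε)⁻¹ := by
    rw [sub_div, Real.exp_sub, ← Real.log_sqrt hε.le, Real.exp_log hs, div_eq_mul_inv]
  have e2 : Real.log ε = 2 * Real.log √ε := by rw [Real.log_sqrt hε.le]; ring
  rw [e1]
  simp only [Function.comp_apply]
  rw [e2]
  have e3 : ε = √ε * √ε := (Real.mul_self_sqrt hε.le).symm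
  nth_rewrite 4 [e3]
  field_simp
  ring

/-- Continuous dependence of approximate solutions on the initial data and on the error. -/
lemma exists_stability (hu : AdmissibleField T C u) {e : ℝ} (he : 0 < e) :
    ∃ d, 0 < d ∧ d ≤ 1 ∧ ∀ x y, ApproxSol T u d x → ApproxSol T u d y →
      ∀ s ∈ Icc 0 T, ∀ t ∈ Icc 0 T, ‖x s - y s‖ ≤ d → ‖x t - y t‖ ≤ e := by
  have hC := hu.one_le
  -- Over a time 1/(2C), Gronwall's factor is at most exp((1 - log d)/2). Induction on the number of
  -- such steps: the last N steps ask for some `d₁`, and `d₂` is chosen so that one step starting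
  -- from distance `d₂` stays within `d₁`.
  have main : ∀ N : ℕ, ∀ e > 0, ∃ d, 0 < d ∧ d ≤ 1 ∧ ∀ x y, ApproxSol T u d x →
      ApproxSol T u d y → ∀ s ∈ Icc 0 T, ∀ t ∈ Icc 0 T, |t - s| ≤ N / (2 * C) →
      ‖x s - y s‖ ≤ d → ‖x t - y t‖ ≤ e := by
    intro N
    induction N with
    | zero =>
      intro e he
      refine ⟨min e 1, lt_min he one_pos, min_le_right _ _, fun x y _ _ s _ t _ hst h => ?_⟩
      have : t = s := by
        simp only [Nat.cast_zero, zero_div] at hst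
        exact sub_eq_zero.1 (abs_nonpos_iff.1 hst)
      rw [this]
      exact h.trans (min_le_left _ _)
    | succ N ih =>
      intro e he
      obtain ⟨d₁, hd₁, hd₁1, h₁⟩ := ih e he
      obtain ⟨d₂, hG, hd₂, hd₂1⟩ := (((tendsto_log_exp_modulus.const_mul
        (4 * C)).eventually_lt_const (show 4 * C * 0 < d₁ by simpa using hd₁)).and
        (Ioc_mem_nhdsGT zero_lt_one)).exists
      refine ⟨min d₁ d₂, lt_min hd₁ hd₂, (min_le_left _ _).trans hd₁1,
        fun x y hx hy s hs t ht hst h => ?_⟩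
      set r := s + (t - s) / (N + 1) with hr
      have hN : (0 : ℝ) < N + 1 := by positivity
      have hrI : r ∈ Icc 0 T := by
        have := (convex_Icc (0 : ℝ) T) hs ht (a := 1 - 1 / ((N : ℝ) + 1)) (b := 1 / ((N : ℝ) + 1))
          (by rw [sub_nonneg, div_le_one hN]; linarith [(Nat.cast_nonneg N : (0 : ℝ) ≤ N)])
          (by positivity) (by ring)
        convert this using 1
        rw [hr]; simp only [smul_eq_mul]; ring
      push_cast at hst
      have hrs : |r - s| ≤ 1 / (2 * C) := by
        have : r - s = (t - s) / (N + 1) := by rw [hr]; ring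
        rw [this, abs_div, abs_of_pos hN, div_le_iff₀ hN]
        calc |t - s| ≤ _ := hst
          _ = _ := by ring
      have htr : |t - r| ≤ N / (2 * C) := by
        have : t - r = (t - s) * (N / (N + 1)) := by rw [hr]; field_simp; ring
        rw [this, abs_mul, abs_of_nonneg (by positivity : (0 : ℝ) ≤ N / (N + 1))]
        calc |t - s| * (N / (N + 1)) ≤ (N + 1) / (2 * C) * (N / (N + 1)) := by gcongr
          _ = _ := by field_simp
      refine h₁ x y (hx.mono (min_le_left _ _)) (hy.mono (min_le_left _ _)) r hrI t ht htr ?_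
      have := (hx.mono (min_le_right _ _)).norm_sub_apply_le hu hd₂ hd₂1 (hy.mono (min_le_right _ _))
        hs hrI (h.trans (min_le_right _ _))
      refine this.trans (le_trans ?_ hG.le)
      have hl := one_le_one_sub_log hd₂ hd₂1
      rw [mul_assoc (4 * C)]
      gcongr
      calc C * (1 - Real.log d₂) * |r - s| ≤ C * (1 - Real.log d₂) * (1 / (2 * C)) := by
            have : 0 ≤ C * (1 - Real.log d₂) := by nlinarith
            gcongr
        _ = _ := by field_simp
  obtain ⟨N, hN⟩ := exists_nat_ge (T * (2 * C))
  obtain ⟨d, hd, hd1, h⟩ := main N e he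
  refine ⟨d, hd, hd1, fun x y hx hy s hs t ht => h x y hx hy s hs t ht ?_⟩
  rw [le_div_iff₀ (by positivity)]
  refine le_trans ?_ hN
  gcongr
  exact abs_sub_le_iff.2 ⟨by linarith [hs.1, ht.2], by linarith [ht.1, hs.2]⟩

/-- Exact solutions are d-approximate for every d ≥ 0, so stability places them within every e > 0
of each other. -/
lemma IsSol.eq_of_eq (hu : AdmissibleField T C u) {x y : ℝ → Plane} (hx : IsSol T u x)
    (hy : IsSol T u y) {s t : ℝ} (hs : s ∈ Icc 0 T) (ht : t ∈ Icc 0 T) (h : x s = y s) :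
    x t = y t := by
  rw [← sub_eq_zero, ← norm_le_zero_iff]
  refine le_of_forall_pos_le_add fun e he => ?_
  obtain ⟨d, hd, _, H⟩ := exists_stability hu he
  rw [zero_add]
  exact H x y (hx.approxSol hd.le) (hy.approxSol hd.le) s hs t ht (by simpa [h] using hd.le)

/-- Picard–Lindelöf for the mollified field at a scale where it is within d of u. The bound C holds
on the whole plane, so a ball of radius C T confines the solution on all of [0,T] and existence is
global. -/
lemma exists_approxSol (hu : AdmissibleField T C u) {d : ℝ} (hd : 0 < d) {s : ℝ}
    (hs : s ∈ Icc 0 T) (p : Plane) : ∃ x, x s = p ∧ ApproxSol T u d x := by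
  obtain ⟨A, hA, hAb⟩ := exists_smooth_approx
  have hC := hu.one_le
  obtain ⟨ε, h3, h0, h1⟩ := (((tendsto_mul_one_sub_log.const_mul
    (2 * C)).eventually_lt_const (show 2 * C * 0 < d by simpa using hd)).and
    (Ioc_mem_nhdsGT zero_lt_one)).exists
  obtain ⟨v, B, hB, hvc, hv⟩ := hAb T C u hu ε h0 h1
  have hl := one_le_one_sub_log h0 h1
  have hT : 0 ≤ T := hs.1.trans hs.2
  let K : NNReal := ⟨A * C * (1 - Real.log ε), by positivity⟩
  let L : NNReal := ⟨C, by positivity⟩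
  let a : NNReal := ⟨C * T, by positivity⟩
  have hPL : IsPicardLindelof v (tmin := 0) (tmax := T) ⟨s, hs⟩ p a 0 L K :=
    { lipschitzOnWith := fun t ht => by
        refine (lipschitzWith_of_nnnorm_fderiv_le ((hv t ht).1.differentiable (by simp))
          fun x => ?_).lipschitzOnWith
        exact (hv t ht).2.2.2.1 x
      continuousOn := fun x _ => hvc x
      norm_le := fun t ht x _ => (hv t ht).2.1 x
      mul_max_le := by
        simp only [NNReal.coe_zero, sub_zero]
        change C * max (T - s) s ≤ C * T
        gcongr
        exact max_le (by linarith [hs.1]) hs.2 }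
  obtain ⟨x, hx0, hx⟩ := hPL.exists_eq_forall_mem_Icc_hasDerivWithinAt (x := p) (by simp)
  exact ⟨x, hx0, fun t ht => ⟨_, hx t ht, ((hv t ht).2.2.1 _).trans h3.le⟩⟩

lemma ApproxSol.continuousOn {x : ℝ → Plane} {d : ℝ} (hx : ApproxSol T u d x) :
    ContinuousOn x (Icc 0 T) := fun t ht =>
  let ⟨_, h, _⟩ := hx t ht
  h.continuousWithinAt

lemma AdmissibleField.continuousOn_comp (hu : AdmissibleField T C u) {x : ℝ → Plane}
    (hx : ContinuousOn x (Icc 0 T)) : ContinuousOn (fun t => u t (x t)) (Icc 0 T) :=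
  hu.continuousOn_uncurry.comp (continuousOn_id.prodMk hx) fun _ ht => ⟨ht, mem_univ _⟩

/-- The mean value inequality is applied to x minus the primitive of u(x), since x' itself is not
known to be integrable. -/
lemma ApproxSol.norm_sub_sub_integral_le (hu : AdmissibleField T C u) {x : ℝ → Plane} {d : ℝ}
    (hx : ApproxSol T u d x) {s t : ℝ} (hs : s ∈ Icc 0 T) (ht : t ∈ Icc 0 T) :
    ‖x t - x s - ∫ r in s..t, u r (x r)‖ ≤ d * |t - s| := by
  have hc := hu.continuousOn_comp hx.continuousOn
  have hT : 0 ≤ T := hs.1.trans hs.2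
  have hint : ∀ a ∈ Icc 0 T, ∀ b ∈ Icc 0 T,
      IntervalIntegrable (fun r => u r (x r)) volume a b := fun a ha b hb =>
    (hc.mono (uIcc_subset_Icc ha hb)).intervalIntegrable
  have h0 : (0 : ℝ) ∈ Icc 0 T := left_mem_Icc.2 hT
  set g : ℝ → Plane := fun t => x t - ∫ r in (0 : ℝ)..t, u r (x r) with hg
  choose! x' hx' hxd using hx
  have hder : ∀ r ∈ Icc 0 T, HasDerivWithinAt g (x' r - u r (x r)) (Icc 0 T) r := fun r hr => by
    refine (hx' r hr).sub ?_
    have : Fact (r ∈ Icc 0 T) := ⟨hr⟩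
    exact intervalIntegral.integral_hasDerivWithinAt_right (hint 0 h0 r hr)
      (hc.stronglyMeasurableAtFilter_nhdsWithin measurableSet_Icc r) (hc r hr)
  have := (convex_Icc (0 : ℝ) T).norm_image_sub_le_of_norm_hasDerivWithin_le hder hxd hs ht
  have e : g t - g s = x t - x s - ∫ r in s..t, u r (x r) := by
    simp only [hg]
    rw [← intervalIntegral.integral_interval_sub_left (hint 0 h0 t ht) (hint 0 h0 s hs)]
    abel
  rwa [e, Real.norm_eq_abs] at this

lemma isSol_of_eq_integral (hu : AdmissibleField T C u) {x : ℝ → Plane}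
    (hc : ContinuousOn x (Icc 0 T)) {s : ℝ} (hs : s ∈ Icc 0 T)
    (h : ∀ t ∈ Icc 0 T, x t = x s + ∫ r in s..t, u r (x r)) : IsSol T u x := fun t ht => by
  have hc' := hu.continuousOn_comp hc
  have : Fact (t ∈ Icc 0 T) := ⟨ht⟩
  have := intervalIntegral.integral_hasDerivWithinAt_right (s := Icc 0 T) (t := Icc 0 T)
    ((hc'.mono (uIcc_subset_Icc hs ht)).intervalIntegrable)
    (hc'.stronglyMeasurableAtFilter_nhdsWithin measurableSet_Icc t) (hc' t ht)
  exact (this.const_add (x s)).congr h (h t ht)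

/-- By stability, approximate solutions through p with errors 1/(n+1) are uniformly Cauchy. Their
limit solves the integral equation, and hence the differential equation. -/
lemma exists_isSol (hu : AdmissibleField T C u) {s : ℝ} (hs : s ∈ Icc 0 T) (p : Plane) :
    ∃ x, x s = p ∧ IsSol T u x := by
  choose X hXs hX using fun n : ℕ => exists_approxSol hu (Nat.one_div_pos_of_nat (n := n)) hs p
  have hcau : UniformCauchySeqOn X atTop (Icc 0 T) := by
    rw [Metric.uniformCauchySeqOn_iff]
    intro e he
    obtain ⟨d, hd, _, H⟩ := exists_stability hu (half_pos he)
    obtain ⟨N, hN⟩ := exists_nat_one_div_lt hd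
    refine ⟨N, fun m hm n hn t ht => ?_⟩
    rw [dist_eq_norm]
    have hle : ∀ k ≥ N, 1 / ((k : ℝ) + 1) ≤ d := fun k hk =>
      (Nat.one_div_le_one_div hk).trans hN.le
    refine (H _ _ ((hX m).mono (hle m hm)) ((hX n).mono (hle n hn)) s hs t ht ?_).trans_lt
      (half_lt_self he)
    rw [hXs, hXs, sub_self, norm_zero]
    exact hd.le
  have hptw : ∀ t ∈ Icc 0 T, ∃ y, Tendsto (fun n => X n t) atTop (𝓝 y) := fun _ ht =>
    cauchySeq_tendsto_of_complete (hcau.cauchySeq ht)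
  choose! x hx using hptw
  have hunif := hcau.tendstoUniformlyOn_of_tendsto hx
  have hxc : ContinuousOn x (Icc 0 T) :=
    hunif.continuousOn (Frequently.of_forall fun n => (hX n).continuousOn)
  have hxs : x s = p := tendsto_nhds_unique (hx s hs) (by simp [hXs])
  refine ⟨x, hxs, isSol_of_eq_integral hu hxc hs fun t ht => ?_⟩
  have hsub := uIcc_subset_Icc hs ht
  have hlim : Tendsto (fun n => ∫ r in s..t, u r (X n r)) atTop (𝓝 (∫ r in s..t, u r (x r))) := by
    refine intervalIntegral.tendsto_integral_filter_of_dominated_convergence (fun _ => C)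
      (Eventually.of_forall fun n => ?_) (Eventually.of_forall fun n => ?_)
      intervalIntegrable_const (Eventually.of_forall fun r hr => ?_)
    · exact ((hu.continuousOn_comp (hX n).continuousOn).mono
        (uIoc_subset_uIcc.trans hsub)).aestronglyMeasurable measurableSet_uIoc
    · exact Eventually.of_forall fun r hr =>
        hu.norm_le r (hsub (uIoc_subset_uIcc hr)) _
    · have hr' := hsub (uIoc_subset_uIcc hr)
      exact ((hu.continuous hr').tendsto _).comp (hx r hr')
  have hlim2 : Tendsto (fun n => X n t - X n s - ∫ r in s..t, u r (X n r)) atTop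
      (𝓝 (x t - x s - ∫ r in s..t, u r (x r))) := ((hx t ht).sub (hx s hs)).sub hlim
  have hlim3 : Tendsto (fun n => X n t - X n s - ∫ r in s..t, u r (X n r)) atTop (𝓝 0) := by
    refine squeeze_zero_norm (fun n => (hX n).norm_sub_sub_integral_le hu hs ht) ?_
    simpa using tendsto_one_div_add_atTop_nhds_zero_nat.mul_const |t - s|
  have := tendsto_nhds_unique hlim2 hlim3
  rw [sub_sub, sub_eq_zero] at this
  exact this

/-- The flow of an admissible field, from time `s` to time `t`. -/
lemma exists_flow (hu : AdmissibleField T C u) (hT : 0 ≤ T) :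
    ∃ η : ℝ → Plane ≃ₜ Plane, (∀ x, η 0 x = x) ∧ (∀ x, IsSol T u fun t => η t x) := by
  have h0 : (0 : ℝ) ∈ Icc 0 T := left_mem_Icc.2 hT
  have hex : ∀ s ∈ Icc 0 T, ∀ p, ∃ x, x s = p ∧ IsSol T u x := fun s hs p => exists_isSol hu hs p
  choose! F hF0 hF using hex
  have hcont : ∀ s ∈ Icc 0 T, ∀ t ∈ Icc 0 T, Continuous fun p => F s p t := fun s hs t ht => by
    rw [Metric.continuous_iff]
    intro p e he
    obtain ⟨d, hd, _, H⟩ := exists_stability hu (half_pos he)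
    refine ⟨d, hd, fun p' hp' => ?_⟩
    rw [dist_eq_norm] at hp' ⊢
    refine (H _ _ ((hF s hs p').approxSol hd.le) ((hF s hs p).approxSol hd.le) s hs t ht
      ?_).trans_lt (half_lt_self he)
    rw [hF0 s hs, hF0 s hs]
    exact hp'.le
  -- Uniqueness gives the composition law; for r = s, solving back from t to s inverts the map from
  -- s to t.
  have hcomp : ∀ s ∈ Icc 0 T, ∀ t ∈ Icc 0 T, ∀ r ∈ Icc 0 T, ∀ p, F t (F s p t) r = F s p r :=
    fun s hs t ht r hr p => (hF t ht _).eq_of_eq hu (hF s hs p) ht hr (hF0 t ht _)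
  classical
  let η : ℝ → Plane ≃ₜ Plane := fun t =>
    if ht : t ∈ Icc 0 T then
      { toFun := fun p => F 0 p t
        invFun := fun p => F t p 0
        left_inv := fun p => by beta_reduce; rw [hcomp 0 h0 t ht 0 h0, hF0 0 h0]
        right_inv := fun p => by beta_reduce; rw [hcomp t ht 0 h0 t ht, hF0 t ht]
        continuous_toFun := hcont 0 h0 t ht
        continuous_invFun := hcont t ht 0 h0 }
    else Homeomorph.refl _
  have hη : ∀ t ∈ Icc 0 T, ∀ p, η t p = F 0 p t := fun t ht p => by
    simp only [η, dif_pos ht]; rfl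
  refine ⟨η, fun x => by rw [hη 0 h0, hF0 0 h0], fun p t ht => ?_⟩
  have := hF 0 h0 p t ht
  rw [← hη t ht p] at this
  exact this.congr (fun r hr => hη r hr p) (hη t ht p)

end Flow


/-! ### A continuous function with continuous weak derivative is its primitive. -/

section WeakDerivative

open scoped Convolution

/-- Du Bois-Reymond: the translate r ↦ ρ(t - r) of a narrow bump is an admissible test function for
t in [a,b], so the mollification of H has zero derivative there. It converges to H as the bump
shrinks. -/
lemma eq_of_weakDeriv_eq_zero {T : ℝ} {H : ℝ → ℝ} (hH : Continuous H)
    (h : ∀ χ : ℝ → ℝ, ContDiff ℝ ∞ χ → HasCompactSupport χ → tsupport χ ⊆ Ioo 0 T →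
      ∫ t in (0 : ℝ)..T, deriv χ t * H t = 0) {a b : ℝ} (ha : 0 < a) (hab : a ≤ b) (hb : b < T) :
    H a = H b := by
  set δ := min a (T - b) with hδ
  have hδ0 : 0 < δ := lt_min ha (by linarith)
  let β : ℕ → ContDiffBump (0 : ℝ) := fun n =>
    ⟨δ / (n + 2) / 2, δ / (n + 2), by positivity, half_lt_self (by positivity)⟩
  have hβ : Tendsto (fun n => (β n).rOut) atTop (𝓝 0) := by
    have := (tendsto_const_div_atTop_nhds_zero_nat δ).comp (tendsto_add_atTop_nat 2)
    refine this.congr fun n => ?_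
    simp [β]
  have key : ∀ n, ((β n).normed volume ⋆[ContinuousLinearMap.lsmul ℝ ℝ, volume] H) a =
      ((β n).normed volume ⋆[ContinuousLinearMap.lsmul ℝ ℝ, volume] H) b := fun n => by
    set ρ := (β n).normed volume with hρ
    have hρc : HasCompactSupport ρ := (β n).hasCompactSupport_normed
    have hρd : ∀ m : ℕ∞, ContDiff ℝ m ρ := fun m => (β n).contDiff_normed
    have hder : ∀ t, HasDerivAt (ρ ⋆[ContinuousLinearMap.lsmul ℝ ℝ, volume] H)
        ((deriv ρ ⋆[ContinuousLinearMap.lsmul ℝ ℝ, volume] H) t) t := fun t =>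
      hρc.hasDerivAt_convolution_left _ (hρd 1) hH.locallyIntegrable t
    have hzero : ∀ t ∈ Icc a b,
        (deriv ρ ⋆[ContinuousLinearMap.lsmul ℝ ℝ, volume] H) t = 0 := fun t ht => by
      have hχd : ContDiff ℝ ∞ fun r => ρ (t - r) := (hρd ⊤).comp (by fun_prop)
      have hts : tsupport (fun r => ρ (t - r)) ⊆ Ioo 0 T := by
        have h1 : tsupport (fun r => ρ (t - r)) ⊆ Metric.closedBall t (δ / (n + 2)) := by
          refine closure_minimal (fun r hr => ?_) Metric.isClosed_closedBall
          have : t - r ∈ Function.support ρ := hr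
          rw [hρ, (β n).support_normed_eq] at this
          have h3 : |t - r| < δ / (n + 2) := by simpa [β] using this
          rw [Metric.mem_closedBall, Real.dist_eq, abs_sub_comm]
          exact h3.le
        refine h1.trans fun r hr => ?_
        rw [Metric.mem_closedBall, Real.dist_eq] at hr
        have h4 : δ / (n + 2) < δ := div_lt_self hδ0 (by linarith [(n.cast_nonneg : (0 : ℝ) ≤ n)])
        have h5 := abs_le.1 hr
        have h6 : δ ≤ a := min_le_left _ _
        have h7 : δ ≤ T - b := min_le_right _ _
        exact ⟨by linarith [ht.1], by linarith [ht.2]⟩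
      have hχc : HasCompactSupport fun r => ρ (t - r) :=
        hρc.comp_homeomorph (Homeomorph.subLeft t)
      have h0 := h _ hχd hχc hts
      have hdχ : ∀ r, deriv (fun r => ρ (t - r)) r = -deriv ρ (t - r) := fun r =>
        deriv_comp_const_sub _ _ _
      rw [convolution_def]
      have e1 : ∫ s, (ContinuousLinearMap.lsmul ℝ ℝ) (deriv ρ s) (H (t - s)) =
          ∫ r, deriv ρ (t - r) * H r := by
        rw [← integral_sub_left_eq_self _ _ t]
        simp
      have hT : 0 ≤ T := by linarith
      have e2 : ∫ r in (0 : ℝ)..T, deriv (fun r => ρ (t - r)) r * H r =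
          ∫ r, deriv (fun r => ρ (t - r)) r * H r := by
        rw [intervalIntegral.integral_of_le hT]
        refine setIntegral_eq_integral_of_forall_compl_eq_zero fun r hr => ?_
        have : r ∉ tsupport (deriv fun r => ρ (t - r)) := fun h' =>
          hr (Ioo_subset_Ioc_self (hts (tsupport_deriv_subset h')))
        rw [image_eq_zero_of_notMem_tsupport this, zero_mul]
      rw [e1]
      rw [e2] at h0
      simp only [hdχ, neg_mul, integral_neg, neg_eq_zero] at h0
      exact h0
    have := (convex_Icc a b).norm_image_sub_le_of_norm_hasDerivWithin_le (C := 0)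
      (fun t _ => (hder t).hasDerivWithinAt) (fun t ht => by rw [hzero t ht, norm_zero])
      (right_mem_Icc.2 hab) (left_mem_Icc.2 hab)
    rw [zero_mul, norm_le_zero_iff, sub_eq_zero] at this
    exact this
  have h1 := ContDiffBump.convolution_tendsto_right_of_continuous (μ := volume) hβ hH a
  have h2 := ContDiffBump.convolution_tendsto_right_of_continuous (μ := volume) hβ hH b
  exact tendsto_nhds_unique (h1.congr key) h2

/-- F minus a primitive of G has zero weak derivative, hence is constant on (0,T) and by continuity
up to the end points. -/
lemma sub_eq_integral_of_weakDeriv {T : ℝ} (hT : 0 < T) {F G : ℝ → ℝ}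
    (hF : ContinuousOn F (Icc 0 T)) (hG : ContinuousOn G (Icc 0 T))
    (h : ∀ χ : ℝ → ℝ, ContDiff ℝ ∞ χ → HasCompactSupport χ → tsupport χ ⊆ Ioo 0 T →
      (∫ t in (0 : ℝ)..T, deriv χ t * F t) + ∫ t in (0 : ℝ)..T, χ t * G t = 0)
    {s t : ℝ} (hs : s ∈ Icc 0 T) (ht : t ∈ Icc 0 T) : F t - F s = ∫ r in s..t, G r := by
  set Fe := IccExtend hT.le ((Icc 0 T).domRestrict F)
  set Ge := IccExtend hT.le ((Icc 0 T).domRestrict G)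
  have hFe : Continuous Fe := hF.domRestrict.Icc_extend'
  have hGe : Continuous Ge := hG.domRestrict.Icc_extend'
  have eF : ∀ r ∈ Icc 0 T, Fe r = F r := fun r hr => IccExtend_of_mem _ _ hr
  have eG : ∀ r ∈ Icc 0 T, Ge r = G r := fun r hr => IccExtend_of_mem _ _ hr
  set P : ℝ → ℝ := fun t => ∫ r in (0 : ℝ)..t, Ge r
  have hP : ∀ t, HasDerivAt P (Ge t) t := fun t =>
    intervalIntegral.integral_hasDerivAt_right (hGe.intervalIntegrable _ _)
      (hGe.stronglyMeasurableAtFilter _ _) hGe.continuousAt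
  have hPc : Continuous P := continuous_iff_continuousAt.2 fun t => (hP t).continuousAt
  set H : ℝ → ℝ := fun t => Fe t - P t
  have hH : Continuous H := hFe.sub hPc
  have hweak : ∀ χ : ℝ → ℝ, ContDiff ℝ ∞ χ → HasCompactSupport χ → tsupport χ ⊆ Ioo 0 T →
      ∫ t in (0 : ℝ)..T, deriv χ t * H t = 0 := fun χ hχ hχc hχs => by
    have hd : Continuous (deriv χ) := hχ.continuous_deriv (by simp)
    have h0 : χ 0 = 0 := image_eq_zero_of_notMem_tsupport fun h => lt_irrefl _ (hχs h).1
    have h1 : χ T = 0 := image_eq_zero_of_notMem_tsupport fun h => lt_irrefl _ (hχs h).2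
    have ibp := intervalIntegral.integral_mul_deriv_eq_deriv_mul (a := 0) (b := T) (u := χ)
      (v := P) (u' := deriv χ) (v' := Ge)
      (fun x _ => ((hχ.differentiable (by simp)) x).hasDerivAt) (fun x _ => hP x)
      (hd.intervalIntegrable _ _) (hGe.intervalIntegrable _ _)
    rw [h0, h1, zero_mul, zero_mul, sub_zero, zero_sub] at ibp
    have := h χ hχ hχc hχs
    have c1 : ∫ t in (0 : ℝ)..T, deriv χ t * F t = ∫ t in (0 : ℝ)..T, deriv χ t * Fe t :=
      intervalIntegral.integral_congr fun r hr => by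
        rw [uIcc_of_le hT.le] at hr; simp only [eF r hr]
    have c2 : ∫ t in (0 : ℝ)..T, χ t * G t = ∫ t in (0 : ℝ)..T, χ t * Ge t :=
      intervalIntegral.integral_congr fun r hr => by
        rw [uIcc_of_le hT.le] at hr; simp only [eG r hr]
    rw [c1, c2, ibp, ← sub_eq_add_neg, ← intervalIntegral.integral_sub
      (f := fun t => deriv χ t * Fe t) (g := fun t => deriv χ t * P t)
      ((hd.mul hFe).intervalIntegrable _ _) ((hd.mul hPc).intervalIntegrable _ _)] at this
    refine Eq.trans ?_ this
    exact intervalIntegral.integral_congr fun r _ => by simp only [H, mul_sub]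
  have hconst : ∀ r ∈ Ioo 0 T, H r = H (T / 2) := fun r hr => by
    rcases le_total r (T / 2) with h' | h'
    · exact eq_of_weakDeriv_eq_zero hH hweak hr.1 h' (by linarith)
    · exact (eq_of_weakDeriv_eq_zero hH hweak (by linarith) h' hr.2).symm
  have hconst' : ∀ r ∈ Icc 0 T, H r = H (T / 2) := fun r hr => by
    have hcl : r ∈ closure (Ioo 0 T) := by rwa [closure_Ioo hT.ne]
    exact closure_minimal (s := Ioo 0 T) (t := {r | H r = H (T / 2)}) hconst
      (isClosed_eq hH continuous_const) hcl
  have e : H t = H s := (hconst' t ht).trans (hconst' s hs).symm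
  simp only [H, eF t ht, eF s hs] at e
  have e2 : ∫ r in s..t, G r = P t - P s := by
    rw [← intervalIntegral.integral_interval_sub_left (hGe.intervalIntegrable 0 t)
      (hGe.intervalIntegrable 0 s) |>.symm]
    exact intervalIntegral.integral_congr fun r hr => (eG r (uIcc_subset_Icc hs ht hr)).symm
  rw [e2]
  linarith

end WeakDerivative

/-! ### The weak formulation as an evolution equation for ∫ φ dq. -/

section TransportIdentity

variable {α T : ℝ} {qin : SignedMeasure Plane} {q : ℝ → SignedMeasure Plane}

/-- `∫ u ⋅ ∇φ dμ` with `u = K^α ∗ μ`. -/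
noncomputable def fluxPairing (α : ℝ) (μ : SignedMeasure Plane) (φ : Plane → ℝ) : ℝ :=
  ∫ᵛ x, fderiv ℝ φ x (velocity α μ x) ∂<•μ

lemma weakKernel_mul {φ : Plane → ℝ} (hφ : Differentiable ℝ φ) (χ : ℝ → ℝ) (x y : Plane) (t : ℝ) :
    weakKernel α (fun z => φ z.1 * χ z.2) x y t =
      χ t / 2 * (fderiv ℝ φ x (kernelAlpha α (x - y)) - fderiv ℝ φ y (kernelAlpha α (x - y))) := by
  have hg : ∀ z v, inner ℝ v (gradient (fun z => φ z * χ t) z) = χ t * fderiv ℝ φ z v := by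
    intro z v
    rw [real_inner_comm, gradient, InnerProductSpace.toDual_symm_apply, fderiv_mul_const (hφ z)]
    simp
  simp only [weakKernel, inner_sub_right, hg, kernelAlpha, map_smul, smul_eq_mul]
  ring

lemma continuous_fderiv_of_contDiff {φ : Plane → ℝ} (hφ : ContDiff ℝ ∞ φ) :
    Continuous (fderiv ℝ φ) := hφ.continuous_fderiv (by simp)

lemma exists_fderiv_bound {φ : Plane → ℝ} (hφ : ContDiff ℝ ∞ φ) (hc : HasCompactSupport φ) :
    ∃ A, 0 ≤ A ∧ ∀ x, ‖fderiv ℝ φ x‖ ≤ A := by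
  obtain ⟨A, hA⟩ := (hc.fderiv (𝕜 := ℝ)).exists_bound_of_continuous
    (continuous_fderiv_of_contDiff hφ)
  exact ⟨A, (norm_nonneg _).trans (hA 0), hA⟩

/-- The symmetrization is undone: as `K^α` is odd, the terms with ∇φ(x) and with ∇φ(y) contribute
equally, after Fubini, and the factor 1/2 disappears. -/
lemma integral_integral_weakKernel (hα : 0 < α) (μ : SignedMeasure Plane) {φ : Plane → ℝ}
    (hφ : ContDiff ℝ ∞ φ) (hc : HasCompactSupport φ) (χ : ℝ → ℝ) (t : ℝ) :
    ∫ᵛ y, (∫ᵛ x, weakKernel α (fun z => φ z.1 * χ z.2) x y t ∂<•μ) ∂<•μ =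
      χ t * fluxPairing α μ φ := by
  obtain ⟨A, hA0, hA⟩ := exists_fderiv_bound hφ hc
  obtain ⟨C, hC, _, hK⟩ := exists_logLipschitz_kernelAlpha hα
  have hKc := continuous_kernelAlpha hα
  have hDc := continuous_fderiv_of_contDiff hφ
  have hb : ∀ x y z : Plane, ‖fderiv ℝ φ z (kernelAlpha α (x - y))‖ ≤ A * C := fun x y z =>
    (ContinuousLinearMap.le_opNorm _ _).trans (by gcongr; exacts [hA z, hK _])
  have hu : ∀ x, ‖velocity α μ x‖ ≤ C * mass μ := fun x =>
    norm_integral_le_mass μ (by linarith) fun y => hK (x - y)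
  have huc : Continuous (velocity α μ) := by
    obtain ⟨C', h1, h2, _⟩ := exists_logLipschitz_kernelAlpha hα
    exact (logLipschitz_velocity hα h2 (by linarith) le_rfl).uniformContinuous.continuous
  have ca : Continuous (Function.uncurry fun y x : Plane =>
      fderiv ℝ φ x (kernelAlpha α (x - y))) :=
    (hDc.comp continuous_snd).clm_apply (hKc.comp (continuous_snd.sub continuous_fst))
  have ia : ∀ y, Integrable (fun x => fderiv ℝ φ x (kernelAlpha α (x - y))) μ.variation :=
    fun y => integrable_variation_of_bound μ
      (hDc.clm_apply (hKc.comp (continuous_id.sub continuous_const))) fun x => hb x y x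
  have iK : ∀ y, Integrable (fun x => kernelAlpha α (x - y)) μ.variation := fun y =>
    integrable_variation_of_bound μ (hKc.comp (continuous_id.sub continuous_const)) fun x => hK _
  have ib : ∀ y, Integrable (fun x => fderiv ℝ φ y (kernelAlpha α (x - y))) μ.variation :=
    fun y => (fderiv ℝ φ y).integrable_comp (iK y)
  have eb : ∀ y, ∫ᵛ x, fderiv ℝ φ y (kernelAlpha α (x - y)) ∂<•μ =
      -fderiv ℝ φ y (velocity α μ y) := fun y => by
    rw [ContinuousLinearMap.vectorMeasure_integral_comp_comm _ (iK y), ← map_neg, velocity,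
      ← VectorMeasure.integral_fun_neg]
    simp only [← kernelAlpha_neg, neg_sub]
  have iu : Integrable (fun y => fderiv ℝ φ y (velocity α μ y)) μ.variation :=
    integrable_variation_of_bound μ (hDc.clm_apply huc) (C := A * (C * mass μ)) fun y =>
      (ContinuousLinearMap.le_opNorm _ _).trans (by gcongr; exacts [hA y, hu y])
  have ea : ∫ᵛ y, (∫ᵛ x, fderiv ℝ φ x (kernelAlpha α (x - y)) ∂<•μ) ∂<•μ =
      fluxPairing α μ φ := by
    rw [integral_integral_swap_of_bound μ ca fun y x => hb x y x]
    simp only [fluxPairing]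
    congr 1
    ext1 x
    exact ContinuousLinearMap.vectorMeasure_integral_comp_comm _ (integrable_kernelAlpha hα μ x)
  have iA : Integrable (fun y => ∫ᵛ x, fderiv ℝ φ x (kernelAlpha α (x - y)) ∂<•μ)
      μ.variation := by
    refine Integrable.of_bound ?_ (A * C * mass μ) (Eventually.of_forall fun y =>
      norm_integral_le_mass μ (by positivity) fun x => hb x y x)
    refine (VectorMeasure.continuous_of_dominated (bound := fun _ => A * C) (fun y => ?_)
      (fun y => Eventually.of_forall fun x => hb x y x) (integrable_const _)
      (Eventually.of_forall fun x => ?_)).aestronglyMeasurable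
    · exact (ia y).aestronglyMeasurable
    · exact ca.comp (by fun_prop : Continuous fun y : Plane => (y, x))
  have e : ∀ y, ∫ᵛ x, weakKernel α (fun z => φ z.1 * χ z.2) x y t ∂<•μ =
      (χ t / 2) • ((∫ᵛ x, fderiv ℝ φ x (kernelAlpha α (x - y)) ∂<•μ) +
        fderiv ℝ φ y (velocity α μ y)) := fun y => by
    simp only [weakKernel_mul (hφ.differentiable (by simp))]
    simp only [← smul_eq_mul (χ t / 2)]
    rw [VectorMeasure.integral_fun_smul, VectorMeasure.integral_fun_sub (ia y) (ib y), eb]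
    ring_nf
  simp only [e]
  rw [VectorMeasure.integral_fun_smul, VectorMeasure.integral_fun_add iA iu, ea, smul_eq_mul]
  change χ t / 2 * (fluxPairing α μ φ + fluxPairing α μ φ) = _
  ring

/-- A continuous function with compact support, as an element of `C₀`. -/
def zeroAtInfty {φ : Plane → ℝ} (hφ : Continuous φ) (hc : HasCompactSupport φ) :
    ZeroAtInftyContinuousMap Plane ℝ := ⟨⟨φ, hφ⟩, hc.is_zero_at_infty⟩

lemma hasCompactSupport_fderiv_apply {φ : Plane → ℝ} (hc : HasCompactSupport φ)
    (v : Plane → Plane) : HasCompactSupport fun x => fderiv ℝ φ x (v x) :=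
  (hc.fderiv (𝕜 := ℝ)).mono fun x hx => by
    simp only [Function.mem_support] at hx ⊢
    exact fun h => hx (by rw [h]; simp)

/-- Both the measure and the integrand depend on time. The change of u is uniformly small on the
compact support of ∇φ and is paired with bounded mass; with u frozen at t, the integrand is a fixed
function in C_c and weak-* continuity applies. -/
lemma continuousOn_fluxPairing (hα : 0 < α)
    (hq : ∀ φ : ZeroAtInftyContinuousMap Plane ℝ,
      ContinuousOn (fun t => ∫ᵛ x, φ x ∂<•(q t)) (Icc 0 T)) {φ : Plane → ℝ}
    (hφ : ContDiff ℝ ∞ φ) (hc : HasCompactSupport φ) :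
    ContinuousOn (fun t => fluxPairing α (q t) φ) (Icc 0 T) := by
  obtain ⟨C, hu⟩ := exists_admissibleField_velocity hα hq
  obtain ⟨M, hM1, hM⟩ := exists_mass_le isCompact_Icc hq
  obtain ⟨A, hA0, hA⟩ := exists_fderiv_bound hφ hc
  have hDc := continuous_fderiv_of_contDiff hφ
  obtain ⟨R, hR⟩ := (hc.fderiv (𝕜 := ℝ)).isCompact.isBounded.exists_norm_le
  intro t ht
  rw [Metric.continuousWithinAt_iff]
  intro e he
  have hcont : ∀ s ∈ Icc 0 T, Continuous fun x => fderiv ℝ φ x (velocity α (q s) x) :=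
    fun s hs => hDc.clm_apply (hu.continuous hs)
  have hbd : ∀ s ∈ Icc 0 T, ∀ x, ‖fderiv ℝ φ x (velocity α (q s) x)‖ ≤ A * C := fun s hs x =>
    (ContinuousLinearMap.le_opNorm _ _).trans (by gcongr; exacts [hA x, hu.norm_le s hs x])
  obtain ⟨δ₁, hδ₁, h₁⟩ := hu.exists_time_modulus R (e := e / (2 * ((A + 1) * M))) (by positivity)
  let g := zeroAtInfty (hcont t ht) (hasCompactSupport_fderiv_apply hc _)
  obtain ⟨δ₂, hδ₂, h₂⟩ := Metric.continuousWithinAt_iff.1 (hq g t ht) (e / 2) (by linarith)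
  refine ⟨min δ₁ δ₂, lt_min hδ₁ hδ₂, fun s hs hd => ?_⟩
  have i1 := integrable_variation_of_bound (q s) (hcont s hs) (hbd s hs)
  have i2 := integrable_variation_of_bound (q s) (hcont t ht) (hbd t ht)
  have b1 : ‖fluxPairing α (q s) φ - ∫ᵛ x, g x ∂<•(q s)‖ ≤ e / 2 := by
    have : fluxPairing α (q s) φ - ∫ᵛ x, g x ∂<•(q s) =
        ∫ᵛ x, (fderiv ℝ φ x (velocity α (q s) x) - fderiv ℝ φ x (velocity α (q t) x)) ∂<•(q s) :=
      (VectorMeasure.integral_fun_sub i1 i2).symm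
    rw [this]
    refine (norm_integral_le_mass (q s) (C := A * (e / (2 * ((A + 1) * M)))) (by positivity)
      fun x => ?_).trans ?_
    · rw [← map_sub]
      by_cases hx : x ∈ tsupport (fderiv ℝ φ)
      · refine (ContinuousLinearMap.le_opNorm _ _).trans ?_
        gcongr
        · exact hA x
        · exact h₁ s hs t ht (by rw [← Real.dist_eq]; exact (hd.trans_le (min_le_left _ _)).le) x
            (hR x hx)
      · rw [image_eq_zero_of_notMem_tsupport hx]
        simp only [zero_apply, norm_zero]
        positivity
    · have hms := hM s hs
      have hm0 := mass_nonneg (q s)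
      calc A * (e / (2 * ((A + 1) * M))) * mass (q s)
          ≤ (A + 1) * (e / (2 * ((A + 1) * M))) * M := by gcongr; linarith
        _ = e / 2 := by field_simp
  have b2 := h₂ hs (hd.trans_le (min_le_right _ _))
  rw [dist_eq_norm] at b2 ⊢
  have e3 : fluxPairing α (q s) φ - fluxPairing α (q t) φ =
      (fluxPairing α (q s) φ - ∫ᵛ x, g x ∂<•(q s)) +
        (∫ᵛ x, g x ∂<•(q s) - ∫ᵛ x, g x ∂<•(q t)) := by
    have : ∫ᵛ x, g x ∂<•(q t) = fluxPairing α (q t) φ := rfl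
    rw [this]; ring
  rw [e3]
  exact (norm_add_le _ _).trans_lt (by linarith)

lemma IsWeakSolution.integral_sub_eq (hα : 0 < α) (hT : 0 < T) (hq : IsWeakSolution α T qin q)
    {φ : Plane → ℝ} (hφ : ContDiff ℝ ∞ φ) (hc : HasCompactSupport φ) {s t : ℝ}
    (hs : s ∈ Icc 0 T) (ht : t ∈ Icc 0 T) :
    ∫ᵛ x, φ x ∂<•(q t) - ∫ᵛ x, φ x ∂<•(q s) = ∫ r in s..t, fluxPairing α (q r) φ := by
  refine sub_eq_integral_of_weakDeriv hT (hq.continuousOn (zeroAtInfty hφ.continuous hc))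
    (continuousOn_fluxPairing hα hq.continuousOn hφ hc) (fun χ hχ hχc hχs => ?_) hs ht
  have hsupp : tsupport (fun z : Plane × ℝ => φ z.1 * χ z.2) ⊆ tsupport φ ×ˢ tsupport χ := by
    refine closure_minimal (fun z hz => ?_)
      ((isClosed_tsupport φ).prod (isClosed_tsupport χ))
    have := mul_ne_zero_iff.1 (Function.mem_support.1 hz)
    exact ⟨subset_tsupport _ this.1, subset_tsupport _ this.2⟩
  have h := hq.weak (fun z => φ z.1 * χ z.2)
    ((hφ.comp contDiff_fst).mul (hχ.comp contDiff_snd))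
    (HasCompactSupport.of_support_subset_isCompact (hc.isCompact.prod hχc.isCompact)
      ((subset_tsupport _).trans hsupp))
    (hsupp.trans (prod_mono (subset_univ _) hχs))
  refine Eq.trans ?_ h
  congr 1
  · refine intervalIntegral.integral_congr fun r _ => ?_
    have hd : ∀ x : Plane, deriv (fun s => φ x * χ s) r = deriv χ r • φ x := fun x => by
      rw [deriv_const_mul _ ((hχ.differentiable (by simp)) r), smul_eq_mul, mul_comm]
    simp only [hd]
    rw [VectorMeasure.integral_fun_smul]
    rfl
  · refine intervalIntegral.integral_congr fun r _ => ?_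
    exact (integral_integral_weakKernel hα (q r) hφ hc χ r).symm

end TransportIdentity


/-! ### Test functions under one Euler step. -/

section TestFunctions

/-- A test function with `|∇φ| ≤ A`, `Lip ∇φ ≤ S`, supported in the ball of radius `R`. -/
structure IsTestFunction (A S R : ℝ) (φ : Plane → ℝ) : Prop where
  contDiff : ContDiff ℝ ∞ φ
  nonneg : 0 ≤ A
  le : A ≤ S
  norm_fderiv_le : ∀ x, ‖fderiv ℝ φ x‖ ≤ A
  norm_fderiv_sub_le : ∀ x y, ‖fderiv ℝ φ x - fderiv ℝ φ y‖ ≤ S * ‖x - y‖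
  eq_zero : ∀ x, R < ‖x‖ → φ x = 0

/-- A smooth vector field with bounds on its values and its first two derivatives. -/
structure IsSmoothField (C L B : ℝ) (v : Plane → Plane) : Prop where
  contDiff : ContDiff ℝ ∞ v
  norm_le : ∀ x, ‖v x‖ ≤ C
  norm_fderiv_le : ∀ x, ‖fderiv ℝ v x‖ ≤ L
  norm_fderiv_sub_le : ∀ x y, ‖fderiv ℝ v x - fderiv ℝ v y‖ ≤ B * ‖x - y‖

variable {A S R C L B : ℝ} {φ : Plane → ℝ} {v : Plane → Plane}

lemma IsTestFunction.hasCompactSupport (hφ : IsTestFunction A S R φ) : HasCompactSupport φ :=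
  HasCompactSupport.of_support_subset_isCompact (isCompact_closedBall (0 : Plane) R) fun x hx => by
    rw [mem_closedBall_zero_iff]
    by_contra h
    exact hx (hφ.eq_zero x (not_le.1 h))

lemma exists_isTestFunction (hφ : ContDiff ℝ ∞ φ) (hc : HasCompactSupport φ) :
    ∃ A S R, IsTestFunction A S R φ := by
  obtain ⟨A, hA0, hA⟩ := exists_fderiv_bound hφ hc
  have h1 : ContDiff ℝ 1 (fderiv ℝ φ) :=
    (hφ.fderiv_right (m := ∞) (by simp)).of_le (by simp)
  obtain ⟨K, hK⟩ := h1.lipschitzWith_of_hasCompactSupport (hc.fderiv (𝕜 := ℝ)) one_ne_zero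
  obtain ⟨R, hR⟩ := hc.isCompact.isBounded.exists_norm_le
  refine ⟨A, max A K, R, hφ, hA0, le_max_left _ _, hA, fun x y => ?_, fun x hx => ?_⟩
  · rw [← dist_eq_norm, ← dist_eq_norm]
    exact (hK.dist_le_mul x y).trans (by gcongr; exact le_max_right _ _)
  · by_contra h
    exact absurd (hR x (subset_tsupport _ h)) (not_le.2 hx)

lemma IsTestFunction.abs_sub_le (hφ : IsTestFunction A S R φ) (x y : Plane) :
    |φ x - φ y| ≤ A * ‖x - y‖ :=
  convex_univ.norm_image_sub_le_of_norm_fderiv_le (𝕜 := ℝ)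
    (fun z _ => hφ.contDiff.differentiable (by simp) z) (fun z _ => hφ.norm_fderiv_le z)
    (mem_univ y) (mem_univ x)

lemma IsSmoothField.norm_sub_le (hv : IsSmoothField C L B v) (x y : Plane) :
    ‖v x - v y‖ ≤ L * ‖x - y‖ :=
  convex_univ.norm_image_sub_le_of_norm_fderiv_le (𝕜 := ℝ)
    (fun z _ => hv.contDiff.differentiable (by simp) z) (fun z _ => hv.norm_fderiv_le z)
    (mem_univ y) (mem_univ x)

lemma IsTestFunction.taylor (hφ : IsTestFunction A S R φ) (x w : Plane) :
    |φ (x + w) - φ x - fderiv ℝ φ x w| ≤ S * ‖w‖ ^ 2 := by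
  have hS : 0 ≤ S := hφ.nonneg.trans hφ.le
  have := (convex_segment (𝕜 := ℝ) x (x + w)).norm_image_sub_le_of_norm_fderiv_le' (𝕜 := ℝ)
    (f := φ) (φ := fderiv ℝ φ x) (C := S * ‖w‖)
    (fun z _ => hφ.contDiff.differentiable (by simp) z) (fun z hz => by
      refine (hφ.norm_fderiv_sub_le z x).trans ?_
      gcongr
      have := norm_sub_le_of_mem_segment hz
      simpa using this) (left_mem_segment ℝ _ _) (right_mem_segment ℝ _ _)
  rw [add_sub_cancel_left] at this
  rw [← Real.norm_eq_abs]
  calc _ ≤ _ := this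
    _ = _ := by ring

/-- The gradient bound grows by a factor involving L alone; the second-derivative bound B of the
field enters only in S. This separation is what the limit h → 0 at fixed ε exploits. The factor for
S is (1 + hL)² + hB, simplified by h ≤ 1 and using A ≤ S. -/
lemma IsTestFunction.comp_step (hφ : IsTestFunction A S R φ) (hv : IsSmoothField C L B v)
    {h : ℝ} (h0 : 0 ≤ h) (h1 : h ≤ 1) :
    IsTestFunction (A * (1 + h * L)) (S * (1 + h * (2 * L + L ^ 2 + B))) (R + h * C)
      fun x => φ (x + h • v x) := by
  have hA := hφ.nonneg
  have hS : 0 ≤ S := hA.trans hφ.le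
  have hL : 0 ≤ L := (norm_nonneg _).trans (hv.norm_fderiv_le 0)
  obtain ⟨e, he⟩ := exists_ne (0 : Plane)
  have hB : 0 ≤ B := by
    have := (norm_nonneg _).trans (hv.norm_fderiv_sub_le e 0)
    rw [sub_zero] at this
    exact nonneg_of_mul_nonneg_left this (norm_pos_iff.2 he)
  have hφd := hφ.contDiff.differentiable (by simp)
  have hvd := hv.contDiff.differentiable (by simp)
  set Φ : Plane → Plane := fun x => x + h • v x with hΦ
  have hΦd : ∀ x, HasFDerivAt Φ (ContinuousLinearMap.id ℝ Plane + h • fderiv ℝ v x) x := fun x =>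
    (hasFDerivAt_id x).add ((hvd x).hasFDerivAt.const_smul h)
  have hder : ∀ x, fderiv ℝ (fun x => φ (Φ x)) x =
      (fderiv ℝ φ (Φ x)).comp (ContinuousLinearMap.id ℝ Plane + h • fderiv ℝ v x) := fun x =>
    ((hφd (Φ x)).hasFDerivAt.comp x (hΦd x)).fderiv
  have hN : ∀ x, ‖ContinuousLinearMap.id ℝ Plane + h • fderiv ℝ v x‖ ≤ 1 + h * L := fun x => by
    refine (norm_add_le _ _).trans (add_le_add ContinuousLinearMap.norm_id_le ?_)
    rw [norm_smul, Real.norm_of_nonneg h0]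
    gcongr
    exact hv.norm_fderiv_le x
  have hΦL : ∀ x y, ‖Φ x - Φ y‖ ≤ (1 + h * L) * ‖x - y‖ := fun x y => by
    have e : Φ x - Φ y = (x - y) + h • (v x - v y) := by simp only [hΦ]; module
    rw [e]
    refine (norm_add_le _ _).trans ?_
    rw [norm_smul, Real.norm_of_nonneg h0]
    have := hv.norm_sub_le x y
    nlinarith
  refine ⟨hφ.contDiff.comp (contDiff_id.add (hv.contDiff.const_smul h)), by positivity, ?_,
    fun x => ?_, fun x y => ?_, fun x hx => ?_⟩
  · refine mul_le_mul hφ.le ?_ (by positivity) hS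
    nlinarith [mul_nonneg h0 hL, mul_nonneg h0 hB, mul_nonneg h0 (sq_nonneg L)]
  · rw [hder]
    refine (ContinuousLinearMap.opNorm_comp_le _ _).trans ?_
    gcongr
    exacts [hφ.norm_fderiv_le _, hN x]
  · rw [hder, hder]
    set P := ContinuousLinearMap.id ℝ Plane + h • fderiv ℝ v x
    set Q := ContinuousLinearMap.id ℝ Plane + h • fderiv ℝ v y
    have e : (fderiv ℝ φ (Φ x)).comp P - (fderiv ℝ φ (Φ y)).comp Q =
        (fderiv ℝ φ (Φ x) - fderiv ℝ φ (Φ y)).comp P + (fderiv ℝ φ (Φ y)).comp (P - Q) := by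
      rw [ContinuousLinearMap.sub_comp, ContinuousLinearMap.comp_sub]; abel
    have hPQ : ‖P - Q‖ ≤ h * (B * ‖x - y‖) := by
      have : P - Q = h • (fderiv ℝ v x - fderiv ℝ v y) := by simp only [P, Q]; module
      rw [this, norm_smul, Real.norm_of_nonneg h0]
      gcongr
      exact hv.norm_fderiv_sub_le x y
    rw [e]
    have b1 : ‖(fderiv ℝ φ (Φ x) - fderiv ℝ φ (Φ y)).comp P‖ ≤
        S * ((1 + h * L) * ‖x - y‖) * (1 + h * L) := by
      refine (ContinuousLinearMap.opNorm_comp_le _ _).trans ?_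
      gcongr
      · exact (hφ.norm_fderiv_sub_le _ _).trans (by gcongr; exact hΦL x y)
      · exact hN x
    have b2 : ‖(fderiv ℝ φ (Φ y)).comp (P - Q)‖ ≤ S * (h * (B * ‖x - y‖)) := by
      refine (ContinuousLinearMap.opNorm_comp_le _ _).trans ?_
      gcongr
      exact (hφ.norm_fderiv_le _).trans hφ.le
    refine (norm_add_le _ _).trans ((add_le_add b1 b2).trans ?_)
    have hh : h ^ 2 * L ^ 2 ≤ h * L ^ 2 := by
      have : h ^ 2 ≤ h := by nlinarith
      gcongr
    calc _ = S * (1 + 2 * h * L + h ^ 2 * L ^ 2 + h * B) * ‖x - y‖ := by ring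
      _ ≤ S * (1 + 2 * h * L + h * L ^ 2 + h * B) * ‖x - y‖ := by gcongr
      _ = _ := by ring
  · refine hφ.eq_zero _ ?_
    have h2 : ‖h • v x‖ ≤ h * C := by
      rw [norm_smul, Real.norm_of_nonneg h0]; gcongr; exact hv.norm_le x
    have h3 := norm_sub_le (x + h • v x) (h • v x)
    rw [add_sub_cancel_right] at h3
    linarith

end TestFunctions

/-! ### One Euler step for the measure. -/

section Transport

variable {α T C M : ℝ} {q : ℝ → SignedMeasure Plane}

/-- The flow of the velocity generated by `q`, together with the bounds and the weak form of the
transport equation satisfied by `q`. -/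
structure TransportSetting (α T C M : ℝ) (q : ℝ → SignedMeasure Plane) : Prop where
  pos : 0 < T
  field : AdmissibleField T C fun t => velocity α (q t)
  mass_le : ∀ t ∈ Icc 0 T, mass (q t) ≤ M
  continuousOn_flux : ∀ φ : Plane → ℝ, ContDiff ℝ ∞ φ → HasCompactSupport φ →
    ContinuousOn (fun t => fluxPairing α (q t) φ) (Icc 0 T)
  integral_sub_eq : ∀ φ : Plane → ℝ, ContDiff ℝ ∞ φ → HasCompactSupport φ →
    ∀ s ∈ Icc 0 T, ∀ t ∈ Icc 0 T,
      ∫ᵛ x, φ x ∂<•(q t) - ∫ᵛ x, φ x ∂<•(q s) = ∫ r in s..t, fluxPairing α (q r) φ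

lemma IsWeakSolution.exists_transportSetting (hα : 0 < α) (hT : 0 < T)
    {qin : SignedMeasure Plane} (hq : IsWeakSolution α T qin q) :
    ∃ C M, TransportSetting α T C M q := by
  obtain ⟨C, hu⟩ := exists_admissibleField_velocity hα hq.continuousOn
  obtain ⟨M, -, hM⟩ := exists_mass_le isCompact_Icc hq.continuousOn
  exact ⟨C, M, hT, hu, hM, fun φ h1 h2 => continuousOn_fluxPairing hα hq.continuousOn h1 h2,
    fun φ h1 h2 s hs t ht => hq.integral_sub_eq hα hT h1 h2 hs ht⟩

lemma TransportSetting.mass_nonneg (H : TransportSetting α T C M q) : 0 ≤ M :=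
  (EulerAlpha.mass_nonneg (q 0)).trans (H.mass_le 0 (left_mem_Icc.2 H.pos.le))

lemma TransportSetting.norm_integral_le {E : Type*} [NormedAddCommGroup E] [NormedSpace ℝ E]
    (H : TransportSetting α T C M q) {t : ℝ} (ht : t ∈ Icc 0 T) {f : Plane → E} {c : ℝ}
    (hc : 0 ≤ c) (h : ∀ x, ‖f x‖ ≤ c) : ‖∫ᵛ x, f x ∂<•(q t)‖ ≤ c * M :=
  (norm_integral_le_mass (q t) hc h).trans (by gcongr; exact H.mass_le t ht)

lemma TransportSetting.norm_fluxPairing_le (H : TransportSetting α T C M q) {t : ℝ}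
    (ht : t ∈ Icc 0 T) {φ : Plane → ℝ} {A : ℝ} (hA0 : 0 ≤ A) (hA : ∀ x, ‖fderiv ℝ φ x‖ ≤ A) :
    ‖fluxPairing α (q t) φ‖ ≤ A * C * M := by
  have hC := H.field.one_le
  refine H.norm_integral_le ht (by positivity) fun x => ?_
  refine (ContinuousLinearMap.le_opNorm _ _).trans ?_
  gcongr
  exacts [hA x, H.field.norm_le t ht x]

lemma integrable_of_isTestFunction {A S R : ℝ} {φ : Plane → ℝ} (hφ : IsTestFunction A S R φ)
    (μ : SignedMeasure Plane) {f : Plane → Plane} (hf : Continuous f) :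
    Integrable (fun x => φ (f x)) μ.variation := by
  obtain ⟨B, hB⟩ := hφ.hasCompactSupport.exists_bound_of_continuous hφ.contDiff.continuous
  exact integrable_variation_of_bound μ (hφ.contDiff.continuous.comp hf) fun x => hB (f x)

/-- One explicit Euler step for a smooth field `v` close to the velocity. -/
lemma TransportSetting.euler_step (H : TransportSetting α T C M q) {A S R L B : ℝ}
    {φ : Plane → ℝ} {v : Plane → Plane} (hφ : IsTestFunction A S R φ)
    (hv : IsSmoothField C L B v) {s h κ : ℝ} (h0 : 0 ≤ h) (hs : s ∈ Icc 0 T)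
    (hsh : s + h ∈ Icc 0 T) (hκ0 : 0 ≤ κ)
    (hκ : ∀ r ∈ Icc s (s + h), ∀ x, ‖x‖ ≤ R → ‖velocity α (q r) x - v x‖ ≤ κ) :
    |∫ᵛ x, φ x ∂<•(q (s + h)) - ∫ᵛ x, φ (x + h • v x) ∂<•(q s)| ≤
      A * (M * h * κ) + S * (M * C * (2 * C + L) * h ^ 2) := by
  have hC := H.field.one_le
  have hC0 : 0 ≤ C := by linarith
  have hM := H.mass_nonneg
  have hA := hφ.nonneg
  have hS : 0 ≤ S := hA.trans hφ.le
  have hL : 0 ≤ L := (norm_nonneg _).trans (hv.norm_fderiv_le 0)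
  have hcs := hφ.hasCompactSupport
  have hDc := continuous_fderiv_of_contDiff hφ.contDiff
  set g : Plane → ℝ := fun x => fderiv ℝ φ x (v x) with hg
  have hgd : ContDiff ℝ ∞ g :=
    (hφ.contDiff.fderiv_right (m := ∞) (by simp)).clm_apply hv.contDiff
  have hgc : HasCompactSupport g := hasCompactSupport_fderiv_apply hcs v
  have hgL : ∀ x, ‖fderiv ℝ g x‖ ≤ S * (C + L) := fun x => by
    refine norm_fderiv_le_of_lip' ℝ (by positivity) (Eventually.of_forall fun y => ?_)
    have e : g y - g x = (fderiv ℝ φ y - fderiv ℝ φ x) (v y) + fderiv ℝ φ x (v y - v x) := by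
      simp [hg]
    rw [e]
    refine (norm_add_le _ _).trans ?_
    have b1 : ‖(fderiv ℝ φ y - fderiv ℝ φ x) (v y)‖ ≤ S * ‖y - x‖ * C :=
      (ContinuousLinearMap.le_opNorm _ _).trans (by
        gcongr; exacts [hφ.norm_fderiv_sub_le y x, hv.norm_le y])
    have b2 : ‖fderiv ℝ φ x (v y - v x)‖ ≤ S * (L * ‖y - x‖) :=
      (ContinuousLinearMap.le_opNorm _ _).trans (by
        gcongr; exacts [(hφ.norm_fderiv_le x).trans hφ.le, hv.norm_sub_le y x])
    linarith
  have hsub : Icc s (s + h) ⊆ Icc 0 T := Icc_subset_Icc hs.1 hsh.2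
  have hle : s ≤ s + h := by linarith
  have igv : ∀ r, Integrable g (q r).variation := fun r => by
    obtain ⟨b, hb⟩ := hgc.exists_bound_of_continuous hgd.continuous
    exact integrable_variation_of_bound _ hgd.continuous hb
  have hflux : ∀ r ∈ Icc s (s + h),
      ‖fluxPairing α (q r) φ - ∫ᵛ x, g x ∂<•(q s)‖ ≤
        A * κ * M + S * (C + L) * C * M * h := fun r hr => by
    have hr' := hsub hr
    have c1 : ‖fluxPairing α (q r) φ - ∫ᵛ x, g x ∂<•(q r)‖ ≤ A * κ * M := by
      have iu : Integrable (fun x => fderiv ℝ φ x (velocity α (q r) x)) (q r).variation :=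
        integrable_variation_of_bound (q r) (hDc.clm_apply (H.field.continuous hr'))
          (C := A * C) fun x => (ContinuousLinearMap.le_opNorm _ _).trans
            (by gcongr; exacts [hφ.norm_fderiv_le x, H.field.norm_le r hr' x])
      have e : fluxPairing α (q r) φ - ∫ᵛ x, g x ∂<•(q r) =
          ∫ᵛ x, (fderiv ℝ φ x (velocity α (q r) x) - fderiv ℝ φ x (v x)) ∂<•(q r) :=
        (VectorMeasure.integral_fun_sub iu (igv r)).symm
      rw [e]
      refine H.norm_integral_le hr' (by positivity) fun x => ?_
      rw [← map_sub]
      by_cases hx : ‖x‖ ≤ R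
      · refine (ContinuousLinearMap.le_opNorm _ _).trans ?_
        gcongr
        exacts [hφ.norm_fderiv_le x, hκ r hr x hx]
      · have : fderiv ℝ φ x = 0 := by
          have hz : φ =ᶠ[𝓝 x] fun _ => 0 := by
            filter_upwards [(isOpen_lt continuous_const continuous_norm).mem_nhds
              (not_le.1 hx)] with y hy using hφ.eq_zero y hy
          rw [hz.fderiv_eq]; simp
        rw [this]
        simp only [zero_apply, norm_zero]
        positivity
    -- `g` = v ⋅ ∇φ is itself a test function, so the evolution equation makes its pairing with q
    -- Lipschitz in time.
    have c2 : ‖∫ᵛ x, g x ∂<•(q r) - ∫ᵛ x, g x ∂<•(q s)‖ ≤ S * (C + L) * C * M * h := by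
      rw [H.integral_sub_eq g hgd hgc s hs r hr']
      refine (intervalIntegral.norm_integral_le_of_norm_le_const
        (C := S * (C + L) * C * M) fun ρ hρ => ?_).trans ?_
      · rw [uIoc_of_le hr.1] at hρ
        exact H.norm_fluxPairing_le (hsub ⟨hρ.1.le, hρ.2.trans hr.2⟩) (by positivity) hgL
      · rw [abs_of_nonneg (sub_nonneg.2 hr.1)]
        gcongr
        linarith [hr.2]
    calc _ = ‖(fluxPairing α (q r) φ - ∫ᵛ x, g x ∂<•(q r)) +
          (∫ᵛ x, g x ∂<•(q r) - ∫ᵛ x, g x ∂<•(q s))‖ := by congr 1; ring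
      _ ≤ _ := (norm_add_le _ _).trans (add_le_add c1 c2)
  have d1 : |∫ᵛ x, φ x ∂<•(q (s + h)) - ∫ᵛ x, φ x ∂<•(q s) - h * ∫ᵛ x, g x ∂<•(q s)| ≤
      (A * κ * M + S * (C + L) * C * M * h) * h := by
    have hi : IntervalIntegrable (fun r => fluxPairing α (q r) φ) volume s (s + h) :=
      ((H.continuousOn_flux φ hφ.contDiff hcs).mono
        (uIcc_subset_Icc hs hsh)).intervalIntegrable
    have e : ∫ᵛ x, φ x ∂<•(q (s + h)) - ∫ᵛ x, φ x ∂<•(q s) - h * ∫ᵛ x, g x ∂<•(q s) =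
        ∫ r in s..(s + h), (fluxPairing α (q r) φ - ∫ᵛ x, g x ∂<•(q s)) := by
      rw [intervalIntegral.integral_sub hi intervalIntegrable_const,
        H.integral_sub_eq φ hφ.contDiff hcs s hs _ hsh, intervalIntegral.integral_const]
      simp
    rw [e, ← Real.norm_eq_abs]
    refine (intervalIntegral.norm_integral_le_of_norm_le_const fun r hr => ?_).trans
      (le_of_eq (by rw [add_sub_cancel_left, abs_of_nonneg h0]))
    rw [uIoc_of_le hle] at hr
    exact hflux r ⟨hr.1.le, hr.2⟩
  have d2 : |∫ᵛ x, φ (x + h • v x) ∂<•(q s) - ∫ᵛ x, φ x ∂<•(q s) - h * ∫ᵛ x, g x ∂<•(q s)| ≤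
      S * (h * C) ^ 2 * M := by
    have hvc := hv.contDiff.continuous
    have i1 := integrable_of_isTestFunction hφ (q s) (f := fun x => x + h • v x) (by fun_prop)
    have i2 : Integrable (fun x => φ x) (q s).variation :=
      integrable_of_isTestFunction hφ (q s) continuous_id
    have e : ∫ᵛ x, φ (x + h • v x) ∂<•(q s) - ∫ᵛ x, φ x ∂<•(q s) - h * ∫ᵛ x, g x ∂<•(q s) =
        ∫ᵛ x, (φ (x + h • v x) - φ x - h • g x) ∂<•(q s) := by
      rw [VectorMeasure.integral_fun_sub (f := fun x => φ (x + h • v x) - φ x)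
        (g := fun x => h • g x) (i1.sub i2) ((igv s).smul h),
        VectorMeasure.integral_fun_sub i1 i2, VectorMeasure.integral_fun_smul, smul_eq_mul]
    rw [e, ← Real.norm_eq_abs]
    refine H.norm_integral_le hs (by positivity) fun x => ?_
    have := hφ.taylor x (h • v x)
    rw [map_smul] at this
    refine this.trans ?_
    have hn : ‖h • v x‖ ≤ h * C := by
      rw [norm_smul, Real.norm_of_nonneg h0]; gcongr; exact hv.norm_le x
    gcongr
  -- `d1` expands the measure and `d2` the test function to first order in h, with the same linear
  -- term. The h² contributions S (C + L) C M and S C² M add up to S M C (2C + L).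
  rw [abs_le] at d1 d2 ⊢
  constructor <;> nlinarith [d1.1, d1.2, d2.1, d2.2]

end Transport


/-! ### The vorticity is transported by the flow. -/

section TransportByFlow

variable {α T C M : ℝ} {q : ℝ → SignedMeasure Plane} {η : ℝ → Plane ≃ₜ Plane}

lemma IsSol.norm_sub_le {u : ℝ → Plane → Plane} {x : ℝ → Plane} (hx : IsSol T u x)
    {s t c : ℝ} (hs : s ∈ Icc 0 T) (ht : t ∈ Icc 0 T) (hst : s ≤ t) {w : Plane}
    (h : ∀ r ∈ Icc s t, ‖u r (x r) - w‖ ≤ c) : ‖x t - x s - (t - s) • w‖ ≤ c * (t - s) := by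
  have hsub : Icc s t ⊆ Icc 0 T := Icc_subset_Icc hs.1 ht.2
  have := (convex_Icc s t).norm_image_sub_le_of_norm_hasDerivWithin_le
    (f := fun r => x r - r • w) (f' := fun r => u r (x r) - w) (C := c)
    (fun r hr => ((hx r (hsub hr)).mono hsub).sub (by
      simpa using (hasDerivWithinAt_id r (Icc s t)).smul_const w)) h
    (left_mem_Icc.2 hst) (right_mem_Icc.2 hst)
  rw [Real.norm_of_nonneg (sub_nonneg.2 hst)] at this
  refine le_trans (le_of_eq ?_) this
  congr 1
  module

lemma IsSol.norm_sub_le_mul {u : ℝ → Plane → Plane} {x : ℝ → Plane} (hx : IsSol T u x)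
    {c : ℝ} (h : ∀ r ∈ Icc 0 T, ∀ y, ‖u r y‖ ≤ c)
    {s t : ℝ} (hs : s ∈ Icc 0 T) (ht : t ∈ Icc 0 T) (hst : s ≤ t) :
    ‖x t - x s‖ ≤ c * (t - s) := by
  have := hx.norm_sub_le hs ht hst (w := 0) (c := c) fun r hr => by
    rw [sub_zero]; exact h r (Icc_subset_Icc hs.1 ht.2 hr) _
  simpa using this

/-- Iterated Euler steps, compared with the exact flow. -/
lemma TransportSetting.euler_iterate (H : TransportSetting α T C M q)
    (hη : ∀ x, IsSol T (fun t => velocity α (q t)) fun t => η t x)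
    {ε L B h R' κ : ℝ} {v : ℝ → Plane → Plane} (hε0 : 0 < ε) (hε1 : ε ≤ 1) (h0 : 0 ≤ h)
    (h1 : h ≤ 1) (hε : C * h ≤ ε) (hB : 0 ≤ B)
    (hv : ∀ t ∈ Icc 0 T, IsSmoothField C L B (v t))
    (hκ : κ = 2 * C * (ε * (1 - Real.log ε)))
    (hvu : ∀ t ∈ Icc 0 T, ∀ x, ‖v t x - velocity α (q t) x‖ ≤ κ)
    (hmod : ∀ s ∈ Icc 0 T, ∀ t ∈ Icc 0 T, |s - t| ≤ h → ∀ x, ‖x‖ ≤ R' →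
      ‖velocity α (q s) x - velocity α (q t) x‖ ≤ κ) {s : ℝ} (hs : s ∈ Icc 0 T) (n : ℕ) :
    s + n * h ∈ Icc 0 T → ∀ (A S R : ℝ) (φ : Plane → ℝ), IsTestFunction A S R φ →
      R + n * h * C ≤ R' →
      |∫ᵛ x, φ x ∂<•(q (s + n * h)) - ∫ᵛ x, φ (η (s + n * h) ((η s).symm x)) ∂<•(q s)| ≤
        n * (A * (1 + h * L) ^ n * (5 * (M * h * κ)) +
          S * (1 + h * (2 * L + L ^ 2 + B)) ^ n * (M * C * (2 * C + L) * h ^ 2)) := by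
  have hC := H.field.one_le
  have hC0 : 0 ≤ C := by linarith
  have hM := H.mass_nonneg
  have hL : 0 ≤ L := (norm_nonneg _).trans ((hv s hs).norm_fderiv_le 0)
  have hl := one_le_one_sub_log hε0 hε1
  have hκ0 : 0 ≤ κ := by
    have : 0 ≤ 1 - Real.log ε := by linarith
    rw [hκ]; positivity
  induction n with
  | zero =>
    intro _ A S R φ _ _
    simp
  | succ n ih =>
    intro hsn A S R φ hφ hR
    have hA := hφ.nonneg
    have hS : 0 ≤ S := hA.trans hφ.le
    set s' := s + n * h with hs'
    have hnh : 0 ≤ (n : ℝ) * h := by positivity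
    have e1 : s + ((n + 1 : ℕ) : ℝ) * h = s' + h := by rw [hs']; push_cast; ring
    rw [e1] at hsn ⊢
    have hs'I : s' ∈ Icc 0 T := ⟨by linarith [hs.1], by linarith [hsn.2]⟩
    have hv' := hv s' hs'I
    have hR' : R + h * C + n * h * C ≤ R' := by push_cast at hR; linarith
    have hRle : R + h * C ≤ R' := by
      have : 0 ≤ n * h * C := by positivity
      linarith
    have hRle' : R ≤ R' := by
      have : 0 ≤ h * C := by positivity
      linarith
    set Φ : Plane → Plane := fun x => x + h • v s' x with hΦ
    have hψ := hφ.comp_step hv' h0 h1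
    -- One κ for freezing time at `s'`, one for mollifying.
    have step1 := H.euler_step hφ hv' (κ := 2 * κ) h0 hs'I hsn (by positivity)
      fun r hr x hx => by
        have hrI : r ∈ Icc 0 T := ⟨hs'I.1.trans hr.1, hr.2.trans hsn.2⟩
        have a1 := hmod r hrI s' hs'I (by
          rw [abs_of_nonneg (sub_nonneg.2 hr.1)]; linarith [hr.2]) x (hx.trans hRle')
        have a2 := hvu s' hs'I x
        rw [norm_sub_rev] at a2
        calc _ ≤ ‖velocity α (q r) x - velocity α (q s') x‖ + ‖velocity α (q s') x - v s' x‖ :=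
              norm_sub_le_norm_sub_add_norm_sub _ _ _
          _ ≤ 2 * κ := by linarith
    -- The last Euler step has been moved onto the test function, so the induction hypothesis is
    -- applied to φ ∘ Φ, with its larger constants and support.
    have step2 := ih hs'I _ _ _ _ hψ hR'
    -- Here the Euler step is compared with the exact flow on [s', s' + h]. The three κ come from
    -- the displacement of the particle, at most C h ≤ ε, from freezing time, and from mollifying.
    -- With the 2κ of `step1` they make up the 5 in the statement.
    have step3 : |∫ᵛ x, φ (Φ (η s' ((η s).symm x))) ∂<•(q s) -
        ∫ᵛ x, φ (η (s' + h) ((η s).symm x)) ∂<•(q s)| ≤ A * (3 * κ * h) * M := by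
      have hvc := hv'.contDiff.continuous
      have i1 := integrable_of_isTestFunction hφ (q s)
        (f := fun x => Φ (η s' ((η s).symm x))) (by fun_prop)
      have i2 := integrable_of_isTestFunction hφ (q s)
        (f := fun x => η (s' + h) ((η s).symm x)) (by fun_prop)
      rw [← VectorMeasure.integral_fun_sub i1 i2, ← Real.norm_eq_abs]
      refine H.norm_integral_le hs (by positivity) fun x => ?_
      set z := (η s).symm x
      have hsol := hη z
      have hmv : ∀ r ∈ Icc s' (s' + h), ‖η r z - η s' z‖ ≤ C * h := fun r hr => by
        have := hsol.norm_sub_le_mul H.field.norm_le hs'I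
          ⟨hs'I.1.trans hr.1, hr.2.trans hsn.2⟩ hr.1
        exact this.trans (by gcongr; linarith [hr.2])
      rcases le_or_gt ‖η s' z‖ R' with hz | hz
      · have hd := hsol.norm_sub_le hs'I hsn (by linarith) (w := v s' (η s' z)) (c := 3 * κ)
          fun r hr => by
            have hrI : r ∈ Icc 0 T := ⟨hs'I.1.trans hr.1, hr.2.trans hsn.2⟩
            have a1 := hmod r hrI s' hs'I (by
              rw [abs_of_nonneg (sub_nonneg.2 hr.1)]; linarith [hr.2]) _ hz
            have a2 := hvu s' hs'I (η s' z)
            rw [norm_sub_rev] at a2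
            have a3 : ‖velocity α (q r) (η r z) - velocity α (q r) (η s' z)‖ ≤ κ := by
              refine (H.field.logLipschitz r hrI ε hε0 hε1 _ _).trans ?_
              have : 0 ≤ C * (1 - Real.log ε) := by nlinarith
              calc _ ≤ C * (1 - Real.log ε) * (ε + ε) := by
                    gcongr; exact (hmv r hr).trans hε
                _ = κ := by rw [hκ]; ring
            calc _ = ‖(velocity α (q r) (η r z) - velocity α (q r) (η s' z)) +
                  (velocity α (q r) (η s' z) - velocity α (q s') (η s' z)) +
                  (velocity α (q s') (η s' z) - v s' (η s' z))‖ := by congr 1; abel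
              _ ≤ _ := norm_add₃_le
              _ ≤ 3 * κ := by linarith
        rw [add_sub_cancel_left] at hd
        refine (hφ.abs_sub_le _ _).trans ?_
        gcongr
        rw [norm_sub_rev]
        refine le_trans (le_of_eq ?_) hd
        congr 1
        simp only [hΦ]; abel
      -- A particle starting outside radius R' ≥ R + h C cannot reach the support of φ in one step,
      -- by either motion.
      · have b1 : R < ‖η (s' + h) z‖ := by
          have := hmv (s' + h) (right_mem_Icc.2 (by linarith))
          have h3 := norm_sub_norm_le (η s' z) (η (s' + h) z)
          rw [norm_sub_rev] at h3
          linarith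
        have b2 : R < ‖Φ (η s' z)‖ := by
          have h2 : ‖h • v s' (η s' z)‖ ≤ h * C := by
            rw [norm_smul, Real.norm_of_nonneg h0]; gcongr; exact hv'.norm_le _
          have h3 := _root_.norm_sub_le (η s' z + h • v s' (η s' z)) (h • v s' (η s' z))
          rw [add_sub_cancel_right] at h3
          simp only [hΦ]
          linarith
        rw [hφ.eq_zero _ b1, hφ.eq_zero _ b2, sub_zero, norm_zero]
        positivity
    set D := 2 * L + L ^ 2 + B
    set b := M * C * (2 * C + L) * h ^ 2
    have hD : 0 ≤ D := by positivity
    have hb : 0 ≤ b := by positivity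
    have p1 : 1 ≤ (1 + h * L) ^ (n + 1) := one_le_pow₀ (by nlinarith)
    have p2 : 1 ≤ (1 + h * D) ^ (n + 1) := one_le_pow₀ (by nlinarith)
    have tri := (abs_sub_le (∫ᵛ x, φ x ∂<•(q (s' + h))) (∫ᵛ x, φ (Φ x) ∂<•(q s'))
      (∫ᵛ x, φ (η (s' + h) ((η s).symm x)) ∂<•(q s))).trans
      (add_le_add_right (abs_sub_le (∫ᵛ x, φ (Φ x) ∂<•(q s'))
        (∫ᵛ x, φ (Φ (η s' ((η s).symm x))) ∂<•(q s)) _) _)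
    have f1 : A * (5 * (M * h * κ)) ≤ A * (1 + h * L) ^ (n + 1) * (5 * (M * h * κ)) := by
      have : A * 1 ≤ A * (1 + h * L) ^ (n + 1) := by gcongr
      rw [mul_one] at this
      gcongr
    have f2 : S * b ≤ S * (1 + h * D) ^ (n + 1) * b := by
      have : S * 1 ≤ S * (1 + h * D) ^ (n + 1) := by gcongr
      rw [mul_one] at this
      gcongr
    calc _ ≤ _ := tri
      _ ≤ (A * (M * h * (2 * κ)) + S * b) + (n * (A * (1 + h * L) * (1 + h * L) ^ n *
            (5 * (M * h * κ)) + S * (1 + h * D) * (1 + h * D) ^ n * b) +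
            A * (3 * κ * h) * M) := by gcongr
      _ = (A * (5 * (M * h * κ)) + S * b) + n * (A * (1 + h * L) ^ (n + 1) *
            (5 * (M * h * κ)) + S * (1 + h * D) ^ (n + 1) * b) := by ring
      _ ≤ (A * (1 + h * L) ^ (n + 1) * (5 * (M * h * κ)) + S * (1 + h * D) ^ (n + 1) * b) +
            n * (A * (1 + h * L) ^ (n + 1) *
            (5 * (M * h * κ)) + S * (1 + h * D) ^ (n + 1) * b) := by gcongr
      _ = _ := by push_cast; ring

lemma one_add_pow_le_exp {h L t : ℝ} (hL : 0 ≤ L) (h0 : 0 ≤ h) {n : ℕ} (hn : n * h = t) :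
    (1 + h * L) ^ n ≤ Real.exp (L * t) := by
  have h1 : 1 + h * L ≤ Real.exp (h * L) := by linarith [Real.add_one_le_exp (h * L)]
  calc (1 + h * L) ^ n ≤ Real.exp (h * L) ^ n := pow_le_pow_left₀ (by positivity) h1 n
    _ = Real.exp (L * t) := by rw [← Real.exp_nat_mul, ← hn]; ring_nf

/-- The number of steps tends to infinity at fixed ε, which removes the term with S and the
uncontrolled constant B. What remains is ε (1 - log ε) times exp(L Δ), and it vanishes as ε → 0 for
Δ ≤ τ. The length τ does not depend on φ or s, so the result can be iterated. -/
lemma TransportSetting.exists_short_time (H : TransportSetting α T C M q)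
    (hη : ∀ x, IsSol T (fun t => velocity α (q t)) fun t => η t x) :
    ∃ τ > 0, ∀ s ∈ Icc 0 T, ∀ t ∈ Icc 0 T, s ≤ t → t - s ≤ τ → ∀ φ : Plane → ℝ,
      ContDiff ℝ ∞ φ → HasCompactSupport φ →
      ∫ᵛ x, φ x ∂<•(q t) = ∫ᵛ x, φ (η t ((η s).symm x)) ∂<•(q s) := by
  obtain ⟨A₀, hA₀, hsm⟩ := exists_smooth_approx
  have hC := H.field.one_le
  have hM := H.mass_nonneg
  -- With L = A₀ C (1 - log ε), this τ is exactly what makes L Δ ≤ (1 - log ε)/2.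
  refine ⟨1 / (2 * (A₀ * C)), by positivity, fun s hs t ht hst hτ φ hφd hφc => ?_⟩
  obtain ⟨A, S, R, hφ⟩ := exists_isTestFunction hφd hφc
  have hA := hφ.nonneg
  have hS : 0 ≤ S := hA.trans hφ.le
  rw [← sub_eq_zero, ← abs_nonpos_iff]
  set Δ := t - s with hΔ
  have hΔ0 : 0 ≤ Δ := sub_nonneg.2 hst
  have main : ∀ ε, 0 < ε → ε ≤ 1 →
      |∫ᵛ x, φ x ∂<•(q t) - ∫ᵛ x, φ (η t ((η s).symm x)) ∂<•(q s)| ≤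
      A * (10 * M * Δ * C) *
        (ε * (1 - Real.log ε) * Real.exp ((1 - Real.log ε) / 2)) := fun ε hε0 hε1 => by
    have hl := one_le_one_sub_log hε0 hε1
    have hl0 : 0 < 1 - Real.log ε := by linarith
    obtain ⟨v, B, hB, -, hv⟩ := hsm T C _ H.field ε hε0 hε1
    set κ := 2 * C * (ε * (1 - Real.log ε)) with hκ
    have hκ0 : 0 < κ := by positivity
    set L := A₀ * C * (1 - Real.log ε) with hL
    have hL0 : 0 ≤ L := by positivity
    set D := 2 * L + L ^ 2 + B with hD
    have hD0 : 0 ≤ D := by positivity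
    obtain ⟨δ, hδ, hmod⟩ := H.field.exists_time_modulus (R + Δ * C) hκ0
    have hlim : Tendsto (fun n : ℕ => Δ / ((n : ℝ) + 1)) atTop (𝓝 0) := by
      simpa [div_eq_mul_inv] using tendsto_one_div_add_atTop_nhds_zero_nat.const_mul Δ
    have hev : ∀ᶠ n : ℕ in atTop,
        |∫ᵛ x, φ x ∂<•(q t) - ∫ᵛ x, φ (η t ((η s).symm x)) ∂<•(q s)| ≤
          A * Real.exp (L * Δ) * (5 * (M * Δ * κ)) +
            S * Real.exp (D * Δ) * (M * C * (2 * C + L) * Δ * (Δ / (n + 1))) := by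
      filter_upwards [hlim.eventually_le_const hδ, hlim.eventually_le_const one_pos,
        hlim.eventually_le_const (show 0 < ε / C by positivity)] with n h1 h2 h3
      set h := Δ / ((n : ℝ) + 1) with hh
      have h0 : 0 ≤ h := by positivity
      have hn : ((n + 1 : ℕ) : ℝ) * h = Δ := by rw [hh]; push_cast; field_simp
      have hst' : s + ((n + 1 : ℕ) : ℝ) * h = t := by rw [hn, hΔ]; ring
      have := H.euler_iterate hη (v := v) hε0 hε1 h0 h2 (by
          rw [le_div_iff₀ (by positivity)] at h3; linarith) hB
        (fun r hr => ⟨(hv r hr).1, (hv r hr).2.1, (hv r hr).2.2.2.1, (hv r hr).2.2.2.2⟩) hκ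
        (fun r hr => (hv r hr).2.2.1)
        (fun a ha b hb hab => hmod a ha b hb (hab.trans h1)) hs (n + 1) (by rwa [hst'])
        A S R φ hφ (by rw [hn])
      rw [hst'] at this
      refine this.trans ?_
      have x1 := one_add_pow_le_exp hL0 h0 hn
      have x2 := one_add_pow_le_exp hD0 h0 hn
      have y1 : ((n + 1 : ℕ) : ℝ) * (A * (1 + h * L) ^ (n + 1) * (5 * (M * h * κ))) ≤
          A * Real.exp (L * Δ) * (5 * (M * Δ * κ)) := by
        calc _ = A * (1 + h * L) ^ (n + 1) * (5 * (M * (((n + 1 : ℕ) : ℝ) * h) * κ)) := by ring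
          _ ≤ _ := by rw [hn]; gcongr
      have y2 : ((n + 1 : ℕ) : ℝ) * (S * (1 + h * D) ^ (n + 1) *
          (M * C * (2 * C + L) * h ^ 2)) ≤
          S * Real.exp (D * Δ) * (M * C * (2 * C + L) * Δ * h) := by
        calc _ = S * (1 + h * D) ^ (n + 1) *
              (M * C * (2 * C + L) * (((n + 1 : ℕ) : ℝ) * h) * h) := by ring
          _ ≤ _ := by rw [hn]; gcongr
      rw [mul_add]
      exact add_le_add y1 y2
    have hlim2 := ge_of_tendsto ((tendsto_const_nhds (x := A * Real.exp (L * Δ) *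
      (5 * (M * Δ * κ)))).add ((hlim.const_mul (M * C * (2 * C + L) * Δ)).const_mul
        (S * Real.exp (D * Δ)))) hev
    rw [mul_zero, mul_zero, add_zero] at hlim2
    have hexp : Real.exp (L * Δ) ≤ Real.exp ((1 - Real.log ε) / 2) := by
      apply Real.exp_le_exp.2
      calc L * Δ ≤ L * (1 / (2 * (A₀ * C))) := by gcongr
        _ = _ := by rw [hL]; field_simp
    calc _ ≤ A * Real.exp (L * Δ) * (5 * (M * Δ * κ)) := hlim2
      _ ≤ A * Real.exp ((1 - Real.log ε) / 2) * (5 * (M * Δ * κ)) := by gcongr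
      _ = _ := by rw [hκ]; ring
  have hlim := tendsto_log_exp_modulus.const_mul (A * (10 * M * Δ * C))
  rw [mul_zero] at hlim
  refine ge_of_tendsto hlim ?_
  filter_upwards [Ioc_mem_nhdsGT zero_lt_one] with ε hε using main ε hε.1 hε.2

lemma integral_map_homeomorph (μ : SignedMeasure Plane) (e : Plane ≃ₜ Plane) (φ : Plane → ℝ) :
    ∫ᵛ x, φ x ∂<•(μ.map e) = ∫ᵛ x, φ (e x) ∂<•μ :=
  e.isClosedEmbedding.integral_map_vectorMeasure

/-- Induction over time steps of length τ, the short-time identity being applied from max(0, t - τ)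
to t. -/
lemma TransportSetting.eq_map (H : TransportSetting α T C M q)
    (hη0 : ∀ x, η 0 x = x)
    (hη : ∀ x, IsSol T (fun t => velocity α (q t)) fun t => η t x) :
    ∀ t ∈ Icc 0 T, q t = (q 0).map (η t) := by
  obtain ⟨τ, hτ, hshort⟩ := H.exists_short_time hη
  have main : ∀ n : ℕ, ∀ t ∈ Icc 0 T, t ≤ n * τ → q t = (q 0).map (η t) := by
    intro n
    induction n with
    | zero =>
      intro t ht h
      have : t = 0 := le_antisymm (by simpa using h) ht.1
      subst this
      ext A hA
      rw [VectorMeasure.map_apply _ (η 0).continuous.measurable hA]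
      congr 1
      ext x
      simp [hη0]
    | succ n ih =>
      intro t ht h
      set s := max 0 (t - τ) with hs
      have hsI : s ∈ Icc 0 T := ⟨le_max_left _ _, max_le (ht.1.trans ht.2) (by linarith [ht.2])⟩
      have hst : s ≤ t := max_le ht.1 (by linarith)
      have hsτ : t - s ≤ τ := by linarith [le_max_right 0 (t - τ)]
      have hq := ih s hsI (max_le (by positivity) (by push_cast at h; linarith))
      refine signedMeasure_ext_of_testFunctions fun φ hφ hc => ?_
      rw [hshort s hsI t ht hst hsτ φ hφ hc, hq,
        integral_map_homeomorph _ (η s) (fun x => φ (η t ((η s).symm x))),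
        integral_map_homeomorph]
      simp
  intro t ht
  obtain ⟨n, hn⟩ := exists_nat_ge (t / τ)
  exact main n t ht ((div_le_iff₀ hτ).1 hn)

end TransportByFlow


/-! ### Measures carried by a curve. -/

section Sheet

variable {I : Set ℝ} {y : ℝ → Plane} {g γ : ℝ → ℝ} {μ : SignedMeasure Plane}

/-- g is split into its positive and negative parts. Each is g times a factor bounded by one, so
integrability of g f passes to both pieces. -/
lemma integral_eq_integral_withDensity_sub {G : Type*} [NormedAddCommGroup G] [NormedSpace ℝ G]
    {m : Measure ℝ} (hg : Integrable g m) {f : ℝ → G}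
    (hf : Integrable (fun σ => g σ • f σ) m) :
    ∫ σ, g σ • f σ ∂m = ∫ σ, f σ ∂(m.withDensity fun σ => ENNReal.ofReal (g σ)) -
      ∫ σ, f σ ∂(m.withDensity fun σ => ENNReal.ofReal (-g σ)) := by
  have hm := hg.1.aemeasurable
  have hn : AEMeasurable (fun σ => -g σ) m := hm.neg
  rw [integral_withDensity_eq_integral_toReal_smul₀ hm.ennreal_ofReal (by simp),
    integral_withDensity_eq_integral_toReal_smul₀ hn.ennreal_ofReal (by simp)]
  have hab : ∀ {h : ℝ → ℝ}, AEStronglyMeasurable h m → (∀ σ, |h σ| ≤ |g σ|) →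
      (∀ σ, h σ = 0 ∨ h σ = g σ ∨ h σ = -g σ) → Integrable (fun σ => h σ • f σ) m := by
    intro h h1 h2 h3
    have e : ∀ σ, h σ • f σ = (h σ / g σ) • (g σ • f σ) := by
      intro σ
      rw [smul_smul]
      by_cases h0 : g σ = 0
      · have : h σ = 0 := by simpa [h0] using h2 σ
        simp [this, h0]
      · rw [div_mul_cancel₀ _ h0]
    simp_rw [e]
    refine hf.bdd_smul 1 (h1.aemeasurable.div hm).aestronglyMeasurable
      (Eventually.of_forall fun σ => ?_)
    rw [norm_div]
    exact div_le_one_of_le₀ (h2 σ) (norm_nonneg _)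
  rw [← integral_sub]
  · congr with σ
    rw [← sub_smul]
    congr 1
    simp only [ENNReal.toReal_ofReal']
    rcases le_total 0 (g σ) with h | h <;> simp [h]
  · simp only [ENNReal.toReal_ofReal']
    refine hab (hm.max aemeasurable_const).aestronglyMeasurable (fun σ => ?_) fun σ => ?_
    · rcases le_total 0 (g σ) with h | h <;> simp [h]
    · rcases le_total 0 (g σ) with h | h <;> simp [h]
  · simp only [ENNReal.toReal_ofReal']
    refine hab (hn.max aemeasurable_const).aestronglyMeasurable (fun σ => ?_) fun σ => ?_
    · rcases le_total 0 (g σ) with h | h <;> simp [h]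
    · rcases le_total 0 (g σ) with h | h <;> simp [h]

lemma integrableOn_smul_of_bound {G : Type*} [NormedAddCommGroup G] [NormedSpace ℝ G]
    (hI : MeasurableSet I) (hy : ContinuousOn y I) (hg : IntegrableOn g I) {f : Plane → G} {C : ℝ}
    (hf : Continuous f) (hC : ∀ x, ‖f x‖ ≤ C) : IntegrableOn (fun σ => g σ • f (y σ)) I :=
  Integrable.smul_bdd (C := C) hg
    ((hf.comp_continuousOn hy).aestronglyMeasurable hI)
    (Eventually.of_forall fun _ => hC _)

/-- A finite signed measure supported on the curve `y` with circulation density `g`. -/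
lemma exists_curveMeasure (hI : MeasurableSet I) (hy : ContinuousOn y I) (hg : IntegrableOn g I) :
    ∃ ν : SignedMeasure Plane,
      (∀ (G : Type) [NormedAddCommGroup G] [NormedSpace ℝ G] (f : Plane → G) (C : ℝ),
        Continuous f → (∀ x, ‖f x‖ ≤ C) → ∫ᵛ x, f x ∂<•ν = ∫ σ in I, g σ • f (y σ)) ∧
      ∀ A, MeasurableSet A → Disjoint A (y '' I) → ν A = 0 := by
  classical
  -- The curve is only continuous on I; extending it by 0 gives a measurable map without affecting
  -- measures concentrated on I.
  set z : ℝ → Plane := I.piecewise y fun _ => 0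
  have hz : Measurable z := hy.measurable_piecewise continuousOn_const hI
  have hzy : ∀ σ ∈ I, z σ = y σ := fun σ hσ => piecewise_eq_of_mem _ _ _ hσ
  set m := volume.restrict I
  set p := m.withDensity fun σ => ENNReal.ofReal (g σ)
  set n := m.withDensity fun σ => ENNReal.ofReal (-g σ)
  have : IsFiniteMeasure p := isFiniteMeasure_withDensity_ofReal hg.2
  have : IsFiniteMeasure n := isFiniteMeasure_withDensity_ofReal hg.neg.2
  refine ⟨(p.map z).toSignedMeasure - (n.map z).toSignedMeasure, ?_, ?_⟩
  · intro G _ _ f C hf hC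
    have hi : ∀ k : Measure Plane, [IsFiniteMeasure k] → Integrable f k := fun k _ =>
      Integrable.of_bound hf.aestronglyMeasurable C (Eventually.of_forall hC)
    rw [VectorMeasure.integral_sub_vectorMeasure, VectorMeasure.integral_toSignedMeasure,
      VectorMeasure.integral_toSignedMeasure, integral_map hz.aemeasurable hf.aestronglyMeasurable,
      integral_map hz.aemeasurable hf.aestronglyMeasurable]
    · have e : ∫ σ in I, g σ • f (y σ) = ∫ σ in I, g σ • f (z σ) :=
        setIntegral_congr_fun hI fun σ hσ => by simp only [hzy σ hσ]
      rw [e, integral_eq_integral_withDensity_sub hg]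
      exact (integrableOn_smul_of_bound hI hy hg hf hC).congr_fun
        (fun σ hσ => by simp only [hzy σ hσ]) hI
    · simpa [VectorMeasure.Integrable] using hi _
    · simpa [VectorMeasure.Integrable] using hi _
  · intro A hA hd
    have h0 : m (z ⁻¹' A) = 0 := by
      rw [Measure.restrict_apply (hz hA)]
      convert measure_empty (μ := volume)
      ext σ
      simp only [mem_inter_iff, mem_preimage, mem_empty_iff_false, iff_false, not_and]
      intro h1 h2
      exact Set.disjoint_left.1 hd h1 ⟨σ, h2, (hzy σ h2).symm⟩
    rw [_root_.sub_apply, Measure.toSignedMeasure_apply_measurable hA,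
      Measure.toSignedMeasure_apply_measurable hA, measureReal_def, measureReal_def,
      Measure.map_apply hz hA, Measure.map_apply hz hA,
      withDensity_absolutelyContinuous _ _ h0, withDensity_absolutelyContinuous _ _ h0, sub_self]

/-- The measure `μ` is the image under `y` of `g dσ` on `I`. -/
structure IsCarriedBy (I : Set ℝ) (y : ℝ → Plane) (g : ℝ → ℝ) (μ : SignedMeasure Plane) :
    Prop where
  continuousOn : ContinuousOn y I
  integrableOn : IntegrableOn g I
  integral_eq : ∀ φ : Plane → ℝ, ContDiff ℝ ∞ φ → HasCompactSupport φ →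
    ∫ᵛ z, φ z ∂<•μ = ∫ σ in I, g σ * φ (y σ)

/-- Test functions identify `μ` with the image measure, for which the formula holds for all bounded
continuous f. The kernel and φ ∘ η, neither of them a test function in general, are of this kind. -/
lemma IsCarriedBy.integral_eq_of_bound (h : IsCarriedBy I y g μ) (hI : MeasurableSet I) {G : Type}
    [NormedAddCommGroup G] [NormedSpace ℝ G] {f : Plane → G} {C : ℝ} (hf : Continuous f)
    (hC : ∀ x, ‖f x‖ ≤ C) : ∫ᵛ x, f x ∂<•μ = ∫ σ in I, g σ • f (y σ) := by
  obtain ⟨ν, hν, -⟩ := exists_curveMeasure hI h.continuousOn h.integrableOn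
  have : μ = ν := signedMeasure_ext_of_testFunctions fun φ hφ hc => by
    obtain ⟨C, hC⟩ := hφ.continuous.bounded_above_of_compact_support hc
    rw [h.integral_eq φ hφ hc, hν ℝ φ C hφ.continuous hC]
    simp
  rw [this, hν G f C hf hC]

lemma IsCarriedBy.apply_eq_zero (h : IsCarriedBy I y g μ) (hI : MeasurableSet I) {A : Set Plane}
    (hA : MeasurableSet A) (hd : Disjoint A (y '' I)) : μ A = 0 := by
  obtain ⟨ν, hν, h0⟩ := exists_curveMeasure hI h.continuousOn h.integrableOn
  have : μ = ν := signedMeasure_ext_of_testFunctions fun φ hφ hc => by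
    obtain ⟨C, hC⟩ := hφ.continuous.bounded_above_of_compact_support hc
    rw [h.integral_eq φ hφ hc, hν ℝ φ C hφ.continuous hC]
    simp
  rw [this, h0 A hA hd]

lemma IsCarriedBy.map (h : IsCarriedBy I y g μ) (hI : MeasurableSet I) (e : Plane ≃ₜ Plane) :
    IsCarriedBy I (fun σ => e (y σ)) g (μ.map e) where
  continuousOn := e.continuous.comp_continuousOn h.continuousOn
  integrableOn := h.integrableOn
  integral_eq φ hφ hc := by
    obtain ⟨C, hC⟩ := hφ.continuous.bounded_above_of_compact_support hc
    rw [integral_map_homeomorph, h.integral_eq_of_bound hI (f := fun x => φ (e x))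
      (hφ.continuous.comp e.continuous) fun x => hC _]
    simp

lemma integrable_arcMeasure_iff :
    Integrable γ (arcMeasure I y) ↔ IntegrableOn (fun σ => γ σ * ‖deriv y σ‖) I := by
  rw [arcMeasure, integrable_withDensity_iff_integrable_smul' (measurable_deriv y).enorm (by simp)]
  simp [IntegrableOn, mul_comm]

lemma HasSheetDensity.isCarriedBy (h : HasSheetDensity I y γ μ) :
    IsCarriedBy I y (fun σ => γ σ * ‖deriv y σ‖) μ where
  continuousOn := h.continuousOn
  integrableOn := integrable_arcMeasure_iff.1 h.integrable
  integral_eq φ hφ hc := by simp_rw [h.integral_eq φ hφ hc, mul_comm]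

lemma IsCarriedBy.hasSheetDensity (h : IsCarriedBy I y g μ)
    (hd : ∀ᵐ σ ∂(volume.restrict I), DifferentiableAt ℝ y σ)
    (hγ : ∀ᵐ σ ∂(volume.restrict I), γ σ * ‖deriv y σ‖ = g σ) : HasSheetDensity I y γ μ where
  continuousOn := h.continuousOn
  differentiableAt := hd
  integrable := integrable_arcMeasure_iff.2 (h.integrableOn.congr (hγ.mono fun _ hσ => hσ.symm))
  integral_eq φ hφ hc := by
    rw [h.integral_eq φ hφ hc]
    refine integral_congr_ae (hγ.mono fun σ hσ => ?_)
    simp only [hσ, mul_comm]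

lemma IsCarriedBy.velocity_eq {α : ℝ} (hα : 0 < α) (h : IsCarriedBy I y g μ) (hI : MeasurableSet I)
    (x : Plane) : IntegrableOn (fun σ => g σ • kernelAlpha α (x - y σ)) I ∧
      velocity α μ x = ∫ σ in I, g σ • kernelAlpha α (x - y σ) := by
  obtain ⟨C, -, -, hb⟩ := exists_logLipschitz_kernelAlpha hα
  have hc : Continuous fun z => kernelAlpha α (x - z) :=
    (continuous_kernelAlpha hα).comp (by fun_prop)
  exact ⟨integrableOn_smul_of_bound hI h.continuousOn h.integrableOn hc fun z => hb _,
    h.integral_eq_of_bound hI hc fun z => hb _⟩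

end Sheet

/-! ### The parameter interval. -/

section Interval

variable (σ₀ σ₁ : EReal)

lemma ordConnected_paramInterval : (paramInterval σ₀ σ₁).OrdConnected :=
  ⟨fun _ hx _ hy _ hz => ⟨hx.1.trans (EReal.coe_le_coe_iff.2 hz.1),
    (EReal.coe_le_coe_iff.2 hz.2).trans hy.2⟩⟩

lemma isClosed_paramInterval : IsClosed (paramInterval σ₀ σ₁) :=
  (isClosed_Icc (a := σ₀) (b := σ₁)).preimage continuous_coe_real_ereal

variable {σ₀ σ₁} in
lemma nontrivial_paramInterval (h : σ₀ < σ₁) : (paramInterval σ₀ σ₁).Nontrivial := by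
  obtain ⟨a, ha, hb⟩ := EReal.lt_iff_exists_real_btwn.1 h
  obtain ⟨b, hb1, hb2⟩ := EReal.lt_iff_exists_real_btwn.1 hb
  exact ⟨a, ⟨ha.le, hb.le⟩, b, ⟨(ha.trans hb1).le, hb2.le⟩, (EReal.coe_lt_coe_iff.1 hb1).ne⟩

end Interval


/-! ### Parametrization by circulation. -/

section Circulation

/-- The integral of `g` over the part of `[s, σ]` inside `I`. -/
noncomputable def cumul (I : Set ℝ) (g : ℝ → ℝ) (s σ : ℝ) : ℝ := ∫ r in s..σ, I.indicator g r

/-- An integrable density on a closed interval `I` with strictly increasing primitive. -/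
structure CirculationSetting (I : Set ℝ) (g : ℝ → ℝ) (s : ℝ) : Prop where
  isClosed : IsClosed I
  ordConnected : I.OrdConnected
  nontrivial : I.Nontrivial
  mem : s ∈ I
  integrableOn : IntegrableOn g I
  strictMonoOn : StrictMonoOn (cumul I g s) I

/-- The infimum of the circulation. -/
noncomputable def cumulInf (I : Set ℝ) (g : ℝ → ℝ) (s : ℝ) : ℝ := sInf (range (cumul I g s))

/-- The supremum of the circulation. -/
noncomputable def cumulSup (I : Set ℝ) (g : ℝ → ℝ) (s : ℝ) : ℝ := sSup (range (cumul I g s))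

/-- The parameter in `I` as a function of the circulation. -/
noncomputable def cumulInv (I : Set ℝ) (g : ℝ → ℝ) (s : ℝ) : ℝ → ℝ :=
  Function.invFunOn (cumul I g s) I

variable {I : Set ℝ} {g : ℝ → ℝ} {s : ℝ}

namespace CirculationSetting

lemma integrable_indicator (H : CirculationSetting I g s) : Integrable (I.indicator g) :=
  H.integrableOn.integrable_indicator H.isClosed.measurableSet

lemma intervalIntegrable (H : CirculationSetting I g s) (a b : ℝ) :
    IntervalIntegrable (I.indicator g) volume a b := H.integrable_indicator.intervalIntegrable

lemma cumul_sub (H : CirculationSetting I g s) (a b : ℝ) :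
    cumul I g s b - cumul I g s a = ∫ r in a..b, I.indicator g r :=
  intervalIntegral.integral_interval_sub_left (H.intervalIntegrable _ _) (H.intervalIntegrable _ _)

lemma continuous_cumul (H : CirculationSetting I g s) : Continuous (cumul I g s) :=
  intervalIntegral.continuous_primitive H.intervalIntegrable s

/-- Between σ and the nearest point of the closed set I on the way to s, the integrand vanishes.
Values on all of ℝ can thus be replaced by values on I. -/
lemma exists_mem_cumul_eq (H : CirculationSetting I g s) (σ : ℝ) :
    ∃ σ' ∈ I, cumul I g s σ' = cumul I g s σ := by
  rcases le_total s σ with h | h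
  · have hne : (I ∩ Iic σ).Nonempty := ⟨s, H.mem, h⟩
    have hb : BddAbove (I ∩ Iic σ) := ⟨σ, fun _ hx => hx.2⟩
    obtain ⟨h1, h2⟩ := (H.isClosed.inter isClosed_Iic).csSup_mem hne hb
    refine ⟨_, h1, ?_⟩
    rw [eq_comm, ← sub_eq_zero, H.cumul_sub]
    refine intervalIntegral.integral_zero_ae (Eventually.of_forall fun r hr => ?_)
    rw [uIoc_of_le h2] at hr
    exact indicator_of_notMem (fun hrI => hr.1.not_ge (le_csSup hb ⟨hrI, hr.2⟩)) _
  · have hne : (I ∩ Ici σ).Nonempty := ⟨s, H.mem, h⟩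
    have hb : BddBelow (I ∩ Ici σ) := ⟨σ, fun _ hx => hx.2⟩
    obtain ⟨h1, h2⟩ := (H.isClosed.inter isClosed_Ici).csInf_mem hne hb
    refine ⟨_, h1, ?_⟩
    rw [← sub_eq_zero, H.cumul_sub, intervalIntegral.integral_of_le h2,
      integral_Ioc_eq_integral_Ioo]
    refine setIntegral_eq_zero_of_forall_eq_zero fun r hr => ?_
    exact indicator_of_notMem (fun hrI => hr.2.not_ge (csInf_le hb ⟨hrI, hr.1.le⟩)) _

lemma range_eq (H : CirculationSetting I g s) : range (cumul I g s) = cumul I g s '' I := by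
  refine (range_subset_iff.2 fun σ => ?_).antisymm (image_subset_range _ _)
  obtain ⟨σ', h, e⟩ := H.exists_mem_cumul_eq σ
  exact ⟨σ', h, e⟩

lemma abs_cumul_le (H : CirculationSetting I g s) (σ : ℝ) :
    |cumul I g s σ| ≤ ∫ r, ‖I.indicator g r‖ :=
  (intervalIntegral.norm_integral_le_integral_norm_uIoc).trans
    (setIntegral_le_integral H.integrable_indicator.norm
      (Eventually.of_forall fun _ => norm_nonneg _))

lemma bddBelow (H : CirculationSetting I g s) : BddBelow (range (cumul I g s)) :=
  ⟨_, by rintro _ ⟨σ, rfl⟩; exact (abs_le.1 (H.abs_cumul_le σ)).1⟩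

lemma bddAbove (H : CirculationSetting I g s) : BddAbove (range (cumul I g s)) :=
  ⟨_, by rintro _ ⟨σ, rfl⟩; exact (abs_le.1 (H.abs_cumul_le σ)).2⟩

lemma cumul_mem_Icc (H : CirculationSetting I g s) (σ : ℝ) :
    cumul I g s σ ∈ Icc (cumulInf I g s) (cumulSup I g s) :=
  ⟨csInf_le H.bddBelow ⟨σ, rfl⟩, le_csSup H.bddAbove ⟨σ, rfl⟩⟩

lemma image_subset_Icc (H : CirculationSetting I g s) :
    cumul I g s '' I ⊆ Icc (cumulInf I g s) (cumulSup I g s) := by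
  rintro _ ⟨σ, -, rfl⟩
  exact H.cumul_mem_Icc σ

lemma Ioo_subset_image (H : CirculationSetting I g s) :
    Ioo (cumulInf I g s) (cumulSup I g s) ⊆ cumul I g s '' I := by
  rw [← H.range_eq]
  exact (isConnected_range H.continuous_cumul).Ioo_csInf_csSup_subset H.bddBelow H.bddAbove

lemma cumulInf_lt_cumulSup (H : CirculationSetting I g s) : cumulInf I g s < cumulSup I g s := by
  obtain ⟨a, ha, b, hb, hab⟩ := H.nontrivial.exists_lt
  exact ((H.cumul_mem_Icc a).1.trans_lt (H.strictMonoOn ha hb hab)).trans_le (H.cumul_mem_Icc b).2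

lemma cumulInv_mem (_ : CirculationSetting I g s) {c : ℝ} (hc : c ∈ cumul I g s '' I) :
    cumulInv I g s c ∈ I := Function.invFunOn_mem hc

lemma cumul_cumulInv (_ : CirculationSetting I g s) {c : ℝ} (hc : c ∈ cumul I g s '' I) :
    cumul I g s (cumulInv I g s c) = c := Function.invFunOn_eq hc

lemma cumulInv_cumul (H : CirculationSetting I g s) {σ : ℝ} (hσ : σ ∈ I) :
    cumulInv I g s (cumul I g s σ) = σ :=
  H.strictMonoOn.injOn (H.cumulInv_mem ⟨σ, hσ, rfl⟩) hσ (H.cumul_cumulInv ⟨σ, hσ, rfl⟩)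

lemma ae_hasDerivAt_cumul (H : CirculationSetting I g s) :
    ∀ᵐ σ, HasDerivAt (cumul I g s) (I.indicator g σ) σ :=
  (LocallyIntegrable.ae_hasDerivAt_integral H.integrable_indicator.locallyIntegrable).mono fun _ h => h s

/-- Almost every point is a Lebesgue point of g, where the slopes of the increasing primitive
converge to g. The frontier of an interval, where two-sided slopes may leave I, is null. -/
lemma ae_nonneg (H : CirculationSetting I g s) : 0 ≤ᵐ[volume] I.indicator g := by
  have hf : ∀ᵐ σ, σ ∉ frontier I :=
    measure_eq_zero_iff_ae_notMem.1 (H.ordConnected.convex.addHaar_frontier volume)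
  filter_upwards [H.ae_hasDerivAt_cumul, hf] with σ hd hσ
  by_cases hI : σ ∈ I
  · have hint : I ∈ 𝓝 σ := by
      by_contra h
      exact hσ ⟨subset_closure hI, fun h' => h (mem_interior_iff_mem_nhds.1 h')⟩
    refine ge_of_tendsto hd.tendsto_slope ?_
    filter_upwards [self_mem_nhdsWithin, mem_nhdsWithin_of_mem_nhds hint] with r hr hrI
    exact H.strictMonoOn.monotoneOn.slope_nonneg hI hrI
  · simp [hI]

lemma monotone_cumul (H : CirculationSetting I g s) : Monotone (cumul I g s) := fun a b hab => by
  rw [← sub_nonneg, H.cumul_sub]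
  exact intervalIntegral.integral_nonneg_of_ae hab H.ae_nonneg

lemma exists_between (H : CirculationSetting I g s) {c : ℝ}
    (hc : c ∈ Ioo (cumulInf I g s) (cumulSup I g s)) :
    ∃ a ∈ I, ∃ b ∈ I, a < cumulInv I g s c ∧ cumulInv I g s c < b := by
  obtain ⟨_, ⟨a', rfl⟩, ha⟩ := exists_lt_of_csInf_lt (range_nonempty _) hc.1
  obtain ⟨_, ⟨b', rfl⟩, hb⟩ := exists_lt_of_lt_csSup (range_nonempty _) hc.2
  obtain ⟨a, haI, ea⟩ := H.exists_mem_cumul_eq a'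
  obtain ⟨b, hbI, eb⟩ := H.exists_mem_cumul_eq b'
  rw [← ea] at ha
  rw [← eb] at hb
  have e := H.cumul_cumulInv (H.Ioo_subset_image hc)
  exact ⟨a, haI, b, hbI, H.monotone_cumul.reflect_lt (by rwa [e]),
    H.monotone_cumul.reflect_lt (by rwa [e])⟩

/-- The point b may lie outside I, where `cumul` is merely monotone; moving it to `max a b` with a
in I brings strict monotonicity to bear. The equivalence yields both the continuity of the inverse
and the preimages of intervals. -/
lemma cumulInv_le_iff (H : CirculationSetting I g s) {c b : ℝ}
    (hc : c ∈ Ioo (cumulInf I g s) (cumulSup I g s)) :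
    cumulInv I g s c ≤ b ↔ c ≤ cumul I g s b := by
  have e := H.cumul_cumulInv (H.Ioo_subset_image hc)
  refine ⟨fun h => e.symm.le.trans (H.monotone_cumul h), fun h => ?_⟩
  by_contra! hlt
  obtain ⟨a, ha, -, -, h1, -⟩ := H.exists_between hc
  have hcI := H.cumulInv_mem (H.Ioo_subset_image hc)
  have hm : max a b ∈ I := H.ordConnected.out ha hcI ⟨le_max_left _ _, (max_lt h1 hlt).le⟩
  have := H.strictMonoOn hm hcI (max_lt h1 hlt)
  rw [e] at this
  exact (this.trans_le h).not_ge (H.monotone_cumul (le_max_right _ _))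

lemma le_cumulInv_iff (H : CirculationSetting I g s) {c b : ℝ}
    (hc : c ∈ Ioo (cumulInf I g s) (cumulSup I g s)) :
    b ≤ cumulInv I g s c ↔ cumul I g s b ≤ c := by
  have e := H.cumul_cumulInv (H.Ioo_subset_image hc)
  refine ⟨fun h => (H.monotone_cumul h).trans e.le, fun h => ?_⟩
  by_contra! hlt
  obtain ⟨-, -, a, ha, -, h1⟩ := H.exists_between hc
  have hcI := H.cumulInv_mem (H.Ioo_subset_image hc)
  have hm : min a b ∈ I := H.ordConnected.out hcI ha ⟨(lt_min h1 hlt).le, min_le_left _ _⟩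
  have := H.strictMonoOn hcI hm (lt_min h1 hlt)
  rw [e] at this
  exact (h.trans_lt this).not_ge (H.monotone_cumul (min_le_right _ _))

lemma continuousAt_cumulInv (H : CirculationSetting I g s) {c : ℝ}
    (hc : c ∈ Ioo (cumulInf I g s) (cumulSup I g s)) : ContinuousAt (cumulInv I g s) c := by
  have hn := isOpen_Ioo.mem_nhds hc
  refine tendsto_order.2 ⟨fun a ha => ?_, fun a ha => ?_⟩
  · rw [← not_le, H.cumulInv_le_iff hc, not_le] at ha
    filter_upwards [hn, lt_mem_nhds ha] with c' hc' h
    rwa [← not_le, H.cumulInv_le_iff hc', not_le]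
  · rw [gt_iff_lt, ← not_le, H.le_cumulInv_iff hc, not_le] at ha
    filter_upwards [hn, gt_mem_nhds ha] with c' hc' h
    rwa [← not_le, H.le_cumulInv_iff hc', not_le]

lemma continuousOn_cumulInv (H : CirculationSetting I g s) :
    ContinuousOn (cumulInv I g s) (Ioo (cumulInf I g s) (cumulSup I g s)) := fun _ hc =>
  (H.continuousAt_cumulInv hc).continuousWithinAt

lemma aemeasurable_cumulInv (H : CirculationSetting I g s) : AEMeasurable (cumulInv I g s)
    (volume.restrict (Ioo (cumulInf I g s) (cumulSup I g s))) :=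
  H.continuousOn_cumulInv.aemeasurable measurableSet_Ioo

/-- The circulation pushes `g dσ` forward to Lebesgue measure. -/
lemma map_cumulInv (H : CirculationSetting I g s) :
    (volume.restrict (Ioo (cumulInf I g s) (cumulSup I g s))).map (cumulInv I g s) =
      (volume.restrict I).withDensity fun σ => ENNReal.ofReal (g σ) := by
  have e0 : ((volume.restrict I).withDensity fun σ => ENNReal.ofReal (g σ)) =
      volume.withDensity fun σ => ENNReal.ofReal (I.indicator g σ) := by
    rw [← withDensity_indicator H.isClosed.measurableSet]
    congr with σ
    by_cases h : σ ∈ I <;> simp [h]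
  rw [e0]
  refine Measure.ext_of_Ioc _ _ fun a b hab => ?_
  rw [Measure.map_apply_of_aemeasurable H.aemeasurable_cumulInv measurableSet_Ioc,
    withDensity_apply _ measurableSet_Ioc,
    ← ofReal_integral_eq_lintegral_ofReal H.integrable_indicator.integrableOn
      (ae_restrict_of_ae H.ae_nonneg), ← intervalIntegral.integral_of_le hab.le, ← H.cumul_sub,
    Measure.restrict_apply' measurableSet_Ioo]
  -- The preimage of (a,b] is the interval between the circulations of a and b, whose length is ∫ g
  -- over (a,b]; intersecting with the open range loses at most its end points.
  have e1 : cumulInv I g s ⁻¹' Ioc a b ∩ Ioo (cumulInf I g s) (cumulSup I g s) =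
      Ioc (cumul I g s a) (cumul I g s b) ∩ Ioo (cumulInf I g s) (cumulSup I g s) := by
    ext c
    simp only [mem_inter_iff, mem_preimage]
    refine and_congr_left fun hc => and_congr ?_ (H.cumulInv_le_iff hc)
    rw [← not_le, H.cumulInv_le_iff hc, not_le]
  rw [e1, ← Measure.restrict_apply' measurableSet_Ioo, Measure.restrict_congr_set Ioo_ae_eq_Icc,
    Measure.restrict_apply' measurableSet_Icc, inter_eq_left.2, Real.volume_Ioc]
  exact Ioc_subset_Icc_self.trans (Icc_subset_Icc (H.cumul_mem_Icc a).1 (H.cumul_mem_Icc b).2)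

lemma ae_nonneg_restrict (H : CirculationSetting I g s) : ∀ᵐ σ ∂(volume.restrict I), 0 ≤ g σ := by
  rw [ae_restrict_iff' H.isClosed.measurableSet]
  filter_upwards [H.ae_nonneg] with σ h hσ
  simpa [hσ] using h

lemma aestronglyMeasurable_map {E : Type*} [NormedAddCommGroup E] (H : CirculationSetting I g s)
    {f : ℝ → E} (hf : AEStronglyMeasurable f (volume.restrict I)) : AEStronglyMeasurable f
      ((volume.restrict (Ioo (cumulInf I g s) (cumulSup I g s))).map (cumulInv I g s)) := by
  rw [H.map_cumulInv]
  exact hf.mono_ac (withDensity_absolutelyContinuous _ _)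

lemma setIntegral_smul_eq {E : Type*} [NormedAddCommGroup E] [NormedSpace ℝ E]
    (H : CirculationSetting I g s) {f : ℝ → E} (hf : AEStronglyMeasurable f (volume.restrict I)) :
    ∫ σ in I, g σ • f σ = ∫ c in Ioo (cumulInf I g s) (cumulSup I g s), f (cumulInv I g s c) := by
  rw [← integral_map H.aemeasurable_cumulInv (H.aestronglyMeasurable_map hf), H.map_cumulInv,
    integral_withDensity_eq_integral_toReal_smul₀ H.integrableOn.1.aemeasurable.ennreal_ofReal
      (by simp)]
  refine integral_congr_ae ?_
  filter_upwards [H.ae_nonneg_restrict] with σ h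
  rw [ENNReal.toReal_ofReal h]

/-- The inverse pushes Lebesgue measure to g dσ, so null sets of parameters are invisible to almost
every Γ. So is the set where g = 0, which may have positive measure in σ even though the primitive
is strictly increasing. -/
lemma ae_cumulInv (H : CirculationSetting I g s) {P : ℝ → Prop}
    (hP : ∀ᵐ σ ∂(volume.restrict I), P σ) :
    ∀ᵐ c ∂(volume.restrict (Ioo (cumulInf I g s) (cumulSup I g s))),
      P (cumulInv I g s c) ∧ 0 < g (cumulInv I g s c) := by
  refine ae_of_ae_map (p := fun σ => P σ ∧ 0 < g σ) H.aemeasurable_cumulInv ?_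
  rw [H.map_cumulInv, ae_withDensity_iff' H.integrableOn.1.aemeasurable.ennreal_ofReal]
  filter_upwards [hP] with σ h h0
  exact ⟨h, by simpa using h0⟩

/-- Derivative of a continuous local inverse, at the almost every Γ whose parameter is a
differentiability point with g > 0. -/
lemma ae_hasDerivAt_cumulInv (H : CirculationSetting I g s) :
    ∀ᵐ c ∂(volume.restrict (Ioo (cumulInf I g s) (cumulSup I g s))),
      HasDerivAt (cumulInv I g s) (g (cumulInv I g s c))⁻¹ c := by
  have h1 : ∀ᵐ σ ∂(volume.restrict I), HasDerivAt (cumul I g s) (g σ) σ := by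
    rw [ae_restrict_iff' H.isClosed.measurableSet]
    filter_upwards [H.ae_hasDerivAt_cumul] with σ h hσ
    simpa [hσ] using h
  filter_upwards [H.ae_cumulInv h1, ae_restrict_mem measurableSet_Ioo] with c ⟨h, h0⟩ hc
  refine h.of_local_left_inverse (H.continuousAt_cumulInv hc) h0.ne' ?_
  filter_upwards [isOpen_Ioo.mem_nhds hc] with c' hc'
  exact H.cumul_cumulInv (H.Ioo_subset_image hc')

end CirculationSetting

variable {y : ℝ → Plane} {γ : ℝ → ℝ} {μ : SignedMeasure Plane}

lemma circulation_eq_cumul (hI : I.OrdConnected)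
    (hγ : ∀ᵐ σ ∂(volume.restrict I), γ σ * ‖deriv y σ‖ = g σ) {σ : ℝ} (hs : s ∈ I) (hσ : σ ∈ I) :
    circulation y γ s σ = cumul I g s σ := by
  have hsub : uIoc s σ ⊆ I := uIoc_subset_uIcc.trans (hI.uIcc_subset hs hσ)
  refine intervalIntegral.integral_congr_ae ?_
  rw [← ae_restrict_iff' measurableSet_uIoc]
  filter_upwards [ae_restrict_of_ae_restrict_of_subset hsub hγ, ae_restrict_mem measurableSet_uIoc]
    with r hr hrs
  rw [hr, indicator_of_mem (hsub hrs)]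

namespace CirculationSetting

/-- In the circulation parametrization the curve has derivative of length `1 / γ`. -/
lemma ae_deriv_curve (H : CirculationSetting I g s)
    (hd : ∀ᵐ σ ∂(volume.restrict I), DifferentiableAt ℝ y σ)
    (hγ : ∀ᵐ σ ∂(volume.restrict I), γ σ * ‖deriv y σ‖ = g σ) :
    ∀ᵐ c ∂(volume.restrict (Ioo (cumulInf I g s) (cumulSup I g s))),
      DifferentiableAt ℝ (fun c => y (cumulInv I g s c)) c ∧
      deriv (fun c => y (cumulInv I g s c)) c ≠ 0 ∧
      γ (cumulInv I g s c) = 1 / ‖deriv (fun c => y (cumulInv I g s c)) c‖ := by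
  filter_upwards [H.ae_cumulInv hd, H.ae_cumulInv hγ, H.ae_hasDerivAt_cumulInv]
    with c ⟨h1, h0⟩ ⟨h2, _⟩ h3
  have hD := h1.hasDerivAt.scomp c h3
  have hy : deriv y (cumulInv I g s c) ≠ 0 := by
    intro h
    rw [h, norm_zero, mul_zero] at h2
    exact h0.ne h2
  have hn : 0 < ‖deriv y (cumulInv I g s c)‖ := norm_pos_iff.2 hy
  refine ⟨hD.differentiableAt, ?_, ?_⟩
  · rw [show deriv (fun c => y (cumulInv I g s c)) c = _ from hD.deriv]
    exact smul_ne_zero (inv_ne_zero h0.ne') hy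
  · rw [show deriv (fun c => y (cumulInv I g s c)) c = _ from hD.deriv, norm_smul, norm_inv,
      Real.norm_of_nonneg h0.le, ← h2]
    rw [← h2] at h0
    have : 0 < γ (cumulInv I g s c) := pos_of_mul_pos_left h0 hn.le
    field_simp

lemma isCarriedBy (H : CirculationSetting I g s) (h : IsCarriedBy I y g μ) :
    IsCarriedBy (Ioo (cumulInf I g s) (cumulSup I g s)) (fun c => y (cumulInv I g s c))
      (fun _ => 1) μ where
  continuousOn := h.continuousOn.comp H.continuousOn_cumulInv fun _ hc =>
    H.cumulInv_mem (H.Ioo_subset_image hc)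
  integrableOn := integrableOn_const (by simp)
  integral_eq φ hφ hc := by
    rw [h.integral_eq φ hφ hc]
    simp_rw [one_mul]
    exact H.setIntegral_smul_eq (f := fun σ => φ (y σ))
      ((hφ.continuous.comp_continuousOn h.continuousOn).aestronglyMeasurable
        H.isClosed.measurableSet)

lemma hasSheetDensity (H : CirculationSetting I g s) (h : IsCarriedBy I y g μ)
    (hd : ∀ᵐ σ ∂(volume.restrict I), DifferentiableAt ℝ y σ)
    (hγ : ∀ᵐ σ ∂(volume.restrict I), γ σ * ‖deriv y σ‖ = g σ) :
    HasSheetDensity (Ioo (cumulInf I g s) (cumulSup I g s)) (fun c => y (cumulInv I g s c))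
      (fun c => 1 / ‖deriv (fun c => y (cumulInv I g s c)) c‖) μ := by
  have hD := H.ae_deriv_curve hd hγ
  refine (H.isCarriedBy h).hasSheetDensity (hD.mono fun _ h => h.1) (hD.mono fun c h => ?_)
  exact one_div_mul_cancel (norm_ne_zero_iff.2 h.2.1)

end CirculationSetting

end Circulation

end EulerAlpha

/-! ### The proposition. -/

theorem mainTheorem3 (α T : ℝ) (hα : 0 < α) (hT : 0 < T)
    (σ₀ σ₁ : EReal) (hσ : σ₀ < σ₁) (I : Set ℝ) (hI : I = paramInterval σ₀ σ₁)
    (xin : ℝ → Plane) (γin : ℝ → ℝ) (qin : SignedMeasure Plane)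
    (hin : HasSheetDensity I xin γin qin)
    (q : ℝ → SignedMeasure Plane) (hq : IsWeakSolution α T qin q) :
    -- the unique Lagrangian flow transports the vorticity, which stays on the evolving curve
    ∃ η : ℝ → Plane ≃ₜ Plane,
      IsLagrangianFlow α T q (fun t => η t) ∧
      (∀ η' : ℝ → Plane → Plane, IsLagrangianFlow α T q η' → ∀ t ∈ Icc 0 T, η' t = η t) ∧
      (∀ t ∈ Icc 0 T, q t = qin.map (η t)) ∧
      (∀ t ∈ Icc 0 T, ∀ A : Set Plane, MeasurableSet A →
        Disjoint A (evolvedCurve η xin t '' I) → q t A = 0) ∧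
      ∃ γ : ℝ → ℝ → ℝ, γ 0 = γin ∧
        -- whenever the curve is nice, it has the density `γ`, and it obeys the integral equation
        (∀ t ∈ Icc 0 T, IsNice I xin γin (evolvedCurve η xin t) →
          HasSheetDensity I (evolvedCurve η xin t) (γ t) (q t) ∧
          (∀ᵐ σ ∂(volume.restrict I),
            γ t σ * ‖deriv (evolvedCurve η xin t) σ‖ = γin σ * ‖deriv xin σ‖) ∧
          ∀ σ ∈ I,
            IntegrableOn (fun σ' => (γ t σ' * ‖deriv (evolvedCurve η xin t) σ'‖) •
              kernelAlpha α (evolvedCurve η xin t σ - evolvedCurve η xin t σ')) I ∧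
            HasDerivWithinAt (fun s => evolvedCurve η xin s σ)
              (∫ σ' in I, (γ t σ' * ‖deriv (evolvedCurve η xin t) σ'‖) •
                kernelAlpha α (evolvedCurve η xin t σ - evolvedCurve η xin t σ'))
              (Icc 0 T) t) ∧
        -- as long as the curve is nice and the circulation increases strictly along it,
        -- the curve, parametrized by its circulation, obeys the Birkhoff-Rott-α equation
        ∀ τ ∈ Ioc 0 T, (∀ t ∈ Icc 0 τ, IsNice I xin γin (evolvedCurve η xin t)) →
          ∀ σstar ∈ I,
          (∀ t ∈ Icc 0 τ,
            StrictMonoOn (circulation (evolvedCurve η xin t) (γ t) σstar) I) →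
          ∃ (Γ₀ Γ₁ : ℝ) (X : ℝ → ℝ → Plane), Γ₀ < Γ₁ ∧
            ∀ t ∈ Icc 0 τ,
              Ioo Γ₀ Γ₁ ⊆ circulation (evolvedCurve η xin t) (γ t) σstar '' I ∧
              circulation (evolvedCurve η xin t) (γ t) σstar '' I ⊆ Icc Γ₀ Γ₁ ∧
              (∀ σ ∈ I, X t (circulation (evolvedCurve η xin t) (γ t) σstar σ) =
                evolvedCurve η xin t σ) ∧
              (∀ Γ ∈ circulation (evolvedCurve η xin t) (γ t) σstar '' I,
                IntervalIntegrable (fun Γ' => kernelAlpha α (X t Γ - X t Γ')) volume Γ₀ Γ₁ ∧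
                HasDerivWithinAt (fun s => X s Γ)
                  (∫ Γ' in Γ₀..Γ₁, kernelAlpha α (X t Γ - X t Γ')) (Icc 0 τ) t) ∧
              -- `γ = 1 / |x_Γ|` is the vorticity density along the curve
              (∀ᵐ Γ ∂(volume.restrict (Ioo Γ₀ Γ₁)),
                DifferentiableAt ℝ (X t) Γ ∧ deriv (X t) Γ ≠ 0 ∧
                ∀ σ ∈ I, circulation (evolvedCurve η xin t) (γ t) σstar σ = Γ →
                  γ t σ = 1 / ‖deriv (X t) Γ‖) ∧
              HasSheetDensity (Ioo Γ₀ Γ₁) (X t) (fun Γ => 1 / ‖deriv (X t) Γ‖) (q t) := by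
  subst hI
  set I := paramInterval σ₀ σ₁
  have hcl : IsClosed I := isClosed_paramInterval σ₀ σ₁
  have hm : MeasurableSet I := hcl.measurableSet
  obtain ⟨C, M, H⟩ := hq.exists_transportSetting hα hT
  obtain ⟨η, hη0, hη⟩ := exists_flow H.field hT.le
  have h0T : (0 : ℝ) ∈ Icc 0 T := left_mem_Icc.2 hT.le
  have hmap : ∀ t ∈ Icc 0 T, q t = qin.map (η t) := fun t ht => by
    rw [← hq.initial]
    exact H.eq_map hη0 hη t ht
  -- The circulation per unit parameter, conserved because the flow moves the curve and its measure
  -- together.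
  set g : ℝ → ℝ := fun σ => γin σ * ‖deriv xin σ‖ with hg
  have hcar : ∀ t ∈ Icc 0 T, IsCarriedBy I (evolvedCurve η xin t) g (q t) := fun t ht => by
    rw [hmap t ht]
    exact hin.isCarriedBy.map hm (η t)
  have hev0 : evolvedCurve η xin 0 = xin := funext fun σ => hη0 _
  -- At t = 0 the quotient would be 0 wherever x^in_σ vanishes, so γ(·,0) = γ^in is imposed
  -- separately. Later, niceness guarantees g = 0 a.e. where x_σ = 0, and there the default value of
  -- the division is harmless.
  set γ : ℝ → ℝ → ℝ := fun t =>
    if t = 0 then γin else fun σ => g σ / ‖deriv (evolvedCurve η xin t) σ‖ with hγ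
  have hγg : ∀ t, IsNice I xin γin (evolvedCurve η xin t) → ∀ᵐ σ ∂(volume.restrict I),
      γ t σ * ‖deriv (evolvedCurve η xin t) σ‖ = g σ := by
    intro t ht
    by_cases h : t = 0
    · subst h
      rw [hev0]
      simp [hγ, hg]
    · filter_upwards [ht.2] with σ hσ
      simp only [hγ, if_neg h]
      by_cases h0 : g σ = 0
      · simp [h0]
      · exact div_mul_cancel₀ _ (norm_ne_zero_iff.2 (hσ h0))
  have hvel : ∀ t ∈ Icc 0 T, ∀ x, HasDerivWithinAt (fun s => η s x)
      (∫ σ in I, g σ • kernelAlpha α (η t x - evolvedCurve η xin t σ)) (Icc 0 T) t :=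
    fun t ht x => by
      rw [← ((hcar t ht).velocity_eq hα hm _).2]
      exact hη x t ht
  refine ⟨η, ⟨hη0, hη⟩, fun η' hη' t ht => funext fun x => ?_, hmap,
    fun t ht A hA hd => (hcar t ht).apply_eq_zero hm hA hd, γ, by simp [hγ],
    fun t ht hn => ⟨(hcar t ht).hasSheetDensity hn.1 (hγg t hn), hγg t hn, fun σ _ => ?_⟩, ?_⟩
  · exact IsSol.eq_of_eq H.field (fun t ht => hη'.hasDerivWithinAt x t ht) (hη x) h0T ht
      ((hη'.initial x).trans (hη0 x).symm)
  · have e : (fun σ' => (γ t σ' * ‖deriv (evolvedCurve η xin t) σ'‖) •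
        kernelAlpha α (evolvedCurve η xin t σ - evolvedCurve η xin t σ')) =ᵐ[volume.restrict I]
        fun σ' => g σ' • kernelAlpha α (evolvedCurve η xin t σ - evolvedCurve η xin t σ') :=
      (hγg t hn).mono fun σ' h => by simp only [h]
    exact ⟨((hcar t ht).velocity_eq hα hm _).1.congr e.symm, by
      rw [integral_congr_ae e]; exact hvel t ht _⟩
  intro τ hτ hn s hs hmono
  have hoc : I.OrdConnected := ordConnected_paramInterval σ₀ σ₁
  have hcirc : ∀ t ∈ Icc 0 τ, ∀ σ ∈ I,
      circulation (evolvedCurve η xin t) (γ t) s σ = cumul I g s σ := fun t ht σ hσ =>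
    circulation_eq_cumul hoc (hγg t (hn t ht)) hs hσ
  have h0τ : (0 : ℝ) ∈ Icc 0 τ := left_mem_Icc.2 hτ.1.le
  -- By `hcirc` the circulation is the primitive of g at every time, so a single setting, and with
  -- it Γ₀, Γ₁ and the inverse, serves all t.
  have K : CirculationSetting I g s := ⟨hcl, hoc, nontrivial_paramInterval hσ, hs,
    hin.isCarriedBy.integrableOn, (hmono 0 h0τ).congr (hcirc 0 h0τ)⟩
  refine ⟨cumulInf I g s, cumulSup I g s,
    fun t Γ => evolvedCurve η xin t (cumulInv I g s Γ), K.cumulInf_lt_cumulSup, fun t ht => ?_⟩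
  have htT : t ∈ Icc 0 T := ⟨ht.1, ht.2.trans hτ.2⟩
  have himg : circulation (evolvedCurve η xin t) (γ t) s '' I = cumul I g s '' I :=
    image_congr (hcirc t ht)
  have hcart := hcar t htT
  rw [himg]
  refine ⟨K.Ioo_subset_image, K.image_subset_Icc, fun σ hσ => ?_, fun Γ _ => ?_, ?_,
    K.hasSheetDensity hcart (hn t ht).1 (hγg t (hn t ht))⟩
  · simp only [hcirc t ht σ hσ, K.cumulInv_cumul hσ]
  -- A fixed Γ labels a fixed particle, so its time derivative is that of one trajectory; and q(·,t)
  -- has density 1 with respect to dΓ, which turns the velocity into the Birkhoff–Rott integral.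
  · have hcarX := K.isCarriedBy hcart
    obtain ⟨h1, h2⟩ := hcarX.velocity_eq hα measurableSet_Ioo
      (evolvedCurve η xin t (cumulInv I g s Γ))
    simp only [one_smul] at h1 h2
    rw [intervalIntegrable_iff_integrableOn_Ioo_of_le K.cumulInf_lt_cumulSup.le,
      intervalIntegral.integral_of_le K.cumulInf_lt_cumulSup.le, integral_Ioc_eq_integral_Ioo,
      ← h2]
    exact ⟨h1, (hη _ t htT).mono (Icc_subset_Icc_right hτ.2)⟩
  · filter_upwards [K.ae_deriv_curve (hn t ht).1 (hγg t (hn t ht))] with Γ ⟨h1, h2, h3⟩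
    refine ⟨h1, h2, fun σ hσ e => ?_⟩
    rw [hcirc t ht σ hσ] at e
    rw [← e, K.cumulInv_cumul hσ] at h3
    rw [h3, e]
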